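/- Write $L^2=L^2(\mathbb R^2;\mathbb C)$, let $Xf(x)=x_1f(x)$ with domain $\mathcal D(X)=\{f\in L^2: x_1f\in L^2\}$, and for $\gamma\ge 0$, $a\in\mathbb R^2$ let $B_{\gamma,a}$ be multiplication by $e^{\gamma\sqrt{1+(x_1-a_1)^2+(x_2-a_2)^2}}$ and $T_{\gamma,a}=B_{\gamma,a}TB_{\gamma,a}^{-1}$ for an operator $T$. For a possibly only partially defined operator, $\|T\|\le C$ means that $T$ is densely defined and bounded by $C$ on its domain. Let $P$ be an orthogonal projector on $L^2$ with an exponentially localized kernel, i.e. $P$ has an integral kernel with $|P(x,x')|\le C_0e^{-\gamma_1|x-x'|}$ for almost all $x,x'\in\mathbb R^2$, for some constants $C_0,\gamma_1>0$. Let $\widehat X$ be a symmetric operator defined (at least) on $\mathcal D(X)$ with $\|\widehat X-X\|\le C$. Then $\widehat X$ has domain $\mathcal D(X)$ and is self-adjoint, and $P\widehat XP$ is self-adjoint on $(\mathcal D(X)\cap\operatorname{ran}P)\oplus(\operatorname{ran}P)^\perp$. Suppose further that (1) there are $C'$ and $\gamma_0>0$ with $\|\widehat X_{\gamma,a}-\widehat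 X\|\le C'\gamma$ for all $0\le\gamma\le\gamma_0$ and all $a\in\mathbb R^2$; (2) $P\widehat XP$ has uniform spectral gaps: $\sigma(P\widehat XP)=\bigcup_{j\in\mathcal J}\sigma_j$ with $\mathcal J$ countable, $|x-y|\ge d>0$ for $x\in\sigma_j$, $y\in\sigma_k$, $j\ne k$, and $\operatorname{diam}\sigma_j\le D<\infty$ for all $j$. Call $(P_j)_{j\in\mathcal J}$ band projectors of $P\widehat XP$ if $$P_j=P\Big(\frac1{2\pi i}\int_{\mathcal C_j}(\lambda-P\widehat XP)^{-1}\,d\lambda\Big)P ,$$ where the contour $\mathcal C_j$ (finitely many closed rectifiable curves in the resolvent set) has winding number $1$ about each point of $\sigma_j$ and $0$ about each point of $\sigma_k$, $k\neq j$, and, for some constants $K,K'$ independent of $j$, $\sup_{\lambda\in\mathcal C_j}\|(\lambda-P\widehat XP)^{-1}\|\le Kd^{-1}$ and the length of $\mathcal C_j$ is at most $K'(D+d)$. Then band projectors exist, and for all band projectors $(P_j)_{j\in\mathcal J}$ there are constants $C_1,C_2,\gamma^*>0$, independent of $j$, such that for every $j\in\mathcal J$: $P_j$ is an orthogonal projector;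 it has an integral kernel with $|P_j(x,x')|\le C_1e^{-\gamma^*|x-x'|}$ for almost all $x,x'\in\mathbb R^2$; and for every $\eta\in\sigma_j$, $0\le\gamma\le\gamma^*$ and $a\in\mathbb R^2$ the operator $(X-\eta)P_{j,\gamma,a}$ is defined on all of $L^2$, $P_{j,\gamma,a}(X-\eta)$ is defined on all of $\mathcal D(X)$, and $$\|(X-\eta)P_{j,\gamma,a}\|\le C_2,\qquad \|P_{j,\gamma,a}(X-\eta)\|\le C_2 .$$ (Here $P_{j,\gamma,a}=(P_j)_{\gamma,a}$.) Consequently $\operatorname{ran}P$ has a basis of exponentially localized generalized Wannier functions: there are an orthonormal basis $(\psi_i)_{i\in I}$ of $\operatorname{ran}P$ with $I$ countable, points $c_i\in\mathbb R^2$ and constants $C_3,\gamma_3>0$ independent of $i$ with $$\int_{\mathbb R^2}e^{2\gamma_3\sqrt{1+|x-c_i|^2}}\,|\psi_i(x)|^2\,dx\le C_3\quad\text{for all } i\in I .$$ -/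

import Mathlib

open MeasureTheory

noncomputable section

namespace GWF

/-- The plane with its Euclidean norm. -/
abbrev Plane : Type := EuclideanSpace ℝ (Fin 2)

/-- The Hilbert space of square-integrable complex functions on the plane. -/
abbrev L2 : Type := Lp ℂ 2 (volume : Measure Plane)

/-! ### Unbounded operators -/

/-- The maximal domain `{f ∈ L² : w f ∈ L²}` of multiplication by the real function `w`. -/
def mulDomain (w : Plane → ℝ) : Submodule ℂ L2 where
  carrier := {f | MemLp (fun x => (w x : ℂ) * f x) 2 volume}
  add_mem' := by
    intro f g hf hg
    refine (memLp_congr_ae ?_).mp (MemLp.add hf hg)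
    filter_upwards [Lp.coeFn_add f g] with x hx
    simp only [Pi.add_apply, hx]
    ring
  zero_mem' := by
    refine (memLp_congr_ae ?_).mp (MemLp.zero (ε := ℂ))
    filter_upwards [Lp.coeFn_zero ℂ 2 (volume : Measure Plane)] with x hx
    rw [hx]
    simp
  smul_mem' := by
    intro c f hf
    refine (memLp_congr_ae ?_).mp (MemLp.const_smul hf c)
    filter_upwards [Lp.coeFn_smul c f] with x hx
    simp only [Pi.smul_apply, hx, smul_eq_mul]
    ring

/-- Multiplication by the real function `w`, on its maximal domain. -/
def mulOp (w : Plane → ℝ) : L2 →ₗ.[ℂ] L2 where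
  domain := mulDomain w
  toFun :=
    { toFun := fun f => MemLp.toLp (fun x => (w x : ℂ) * (f : L2) x) f.2
      map_add' := by
        intro f g
        refine Lp.ext ?_
        filter_upwards [Lp.coeFn_add (f : L2) (g : L2), MemLp.coeFn_toLp (f + g).2,
          MemLp.coeFn_toLp f.2, MemLp.coeFn_toLp g.2,
          Lp.coeFn_add (MemLp.toLp _ f.2) (MemLp.toLp _ g.2)] with x h1 h2 h3 h4 h5
        rw [h2, h5, Pi.add_apply, h3, h4, Submodule.coe_add, h1, Pi.add_apply]
        ring
      map_smul' := by
        intro c f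
        refine Lp.ext ?_
        filter_upwards [Lp.coeFn_smul c (f : L2), MemLp.coeFn_toLp (c • f).2,
          MemLp.coeFn_toLp f.2, Lp.coeFn_smul c (MemLp.toLp _ f.2)] with x h1 h2 h3 h4
        rw [h2, RingHom.id_apply, h4, Pi.smul_apply, h3, Submodule.coe_smul, h1, Pi.smul_apply,
          smul_eq_mul, smul_eq_mul]
        ring }

/-- The position operator `X f (x) = x₁ f (x)`. -/
def posX : L2 →ₗ.[ℂ] L2 := mulOp fun x => x 0

/-- The operator `X - η`, for real `η`. -/
def posXSub (η : ℝ) : L2 →ₗ.[ℂ] L2 := mulOp fun x => x 0 - η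

/-- The weight `√(1 + (x₁ - a₁)² + (x₂ - a₂)²)`. -/
def weight (a x : Plane) : ℝ := Real.sqrt (1 + (x 0 - a 0) ^ 2 + (x 1 - a 1) ^ 2)

/-- The exponential growth operator `B_{γ,a} = exp (γ √(1 + (X - a₁)² + (Y - a₂)²))`. Its inverse is
`B_{-γ,a}`. -/
def expOp (γ : ℝ) (a : Plane) : L2 →ₗ.[ℂ] L2 := mulOp fun x => Real.exp (γ * weight a x)

/-- The composition `S T` of partially defined operators, on its natural domain
`{f ∈ D(T) : T f ∈ D(S)}`. -/
def opComp (S T : L2 →ₗ.[ℂ] L2) : L2 →ₗ.[ℂ] L2 :=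
  S.comp (T.domRestrict ((S.domain.comap T.toFun).map T.domain.subtype)) (by
    rintro ⟨x, ⟨y, hy, rfl⟩, hx⟩
    exact hy)

/-- A bounded operator, regarded as an everywhere defined operator. -/
def ofBdd (A : L2 →L[ℂ] L2) : L2 →ₗ.[ℂ] L2 := A.toLinearMap.toPMap ⊤

/-- The operator `P T P`, on its natural domain `{f : P f ∈ D(T)}`. -/
def compress (P : L2 →L[ℂ] L2) (T : L2 →ₗ.[ℂ] L2) : L2 →ₗ.[ℂ] L2 :=
  opComp (ofBdd P) (opComp T (ofBdd P))

/-- The exponentially tilted operator `T_{γ,a} = B_{γ,a} T B_{γ,a}⁻¹`, on its natural domain. -/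
def tilt (T : L2 →ₗ.[ℂ] L2) (γ : ℝ) (a : Plane) : L2 →ₗ.[ℂ] L2 :=
  opComp (expOp γ a) (opComp T (expOp (-γ) a))

/-- `‖T‖ ≤ C`: the operator `T` is densely defined and bounded on its domain with bound `C`
(so that it extends uniquely to a bounded operator on `L²` of norm at most `C`). -/
def NormLE (T : L2 →ₗ.[ℂ] L2) (C : ℝ) : Prop :=
  Dense (T.domain : Set L2) ∧ ∀ f : T.domain, ‖T f‖ ≤ C * ‖(f : L2)‖

/-- `R` is the (bounded, everywhere defined) inverse of `z - T`. -/
def IsResolventAt (T : L2 →ₗ.[ℂ] L2) (z : ℂ) (R : L2 →L[ℂ] L2) : Prop :=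
  (∀ f : L2, ∃ h : R f ∈ T.domain, z • R f - T ⟨R f, h⟩ = f) ∧
    ∀ g : T.domain, R (z • (g : L2) - T g) = g

/-- The spectrum of a partially defined operator. -/
def opSpectrum (T : L2 →ₗ.[ℂ] L2) : Set ℂ := {z | ¬ ∃ R, IsResolventAt T z R}

open Classical in
/-- The resolvent `(z - T)⁻¹` (and `0` if `z` is in the spectrum). -/
def opResolvent (T : L2 →ₗ.[ℂ] L2) (z : ℂ) : L2 →L[ℂ] L2 :=
  if h : ∃ R, IsResolventAt T z R then h.choose else 0

/-! ### Exponentially localized kernels -/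

/-- The operator `A` has an integral kernel `K` with `|K(x, x')| ≤ C e^{-γ |x - x'|}` almost
everywhere. -/
def HasExpKernel (A : L2 →L[ℂ] L2) (C γ : ℝ) : Prop :=
  ∃ K : Plane × Plane → ℂ,
    AEStronglyMeasurable K ((volume : Measure Plane).prod volume) ∧
    (∀ᵐ z ∂((volume : Measure Plane).prod volume), ‖K z‖ ≤ C * Real.exp (-γ * ‖z.1 - z.2‖)) ∧
    ∀ f : L2, ∀ᵐ x, A f x = ∫ x', K (x, x') * f x'

/-- Exponentially localized orthogonal projectors. -/
def IsExpLocProjector (P : L2 →L[ℂ] L2) : Prop :=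
  IsStarProjection P ∧ ∃ C γ : ℝ, 0 < C ∧ 0 < γ ∧ HasExpKernel P C γ

/-! ### Uniform spectral gaps and band projectors -/

/-- The operator `T` has uniform spectral gaps with decomposition `(σ j)_j` and constants `d`, `D`:
its spectrum is the union of the `σ j`, any two of them have distance at least `d > 0`, and each
has diameter at most `D`. -/
structure UniformSpectralGaps {J : Type*} (T : L2 →ₗ.[ℂ] L2) (σ : J → Set ℝ) (d D : ℝ) : Prop where
  pos : 0 < d
  spectrum_eq : opSpectrum T = ⋃ j, (fun x : ℝ => (x : ℂ)) '' σ j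
  gap : ∀ j k, j ≠ k → ∀ x ∈ σ j, ∀ y ∈ σ k, d ≤ |x - y|
  diam : ∀ j, ∀ x ∈ σ j, ∀ y ∈ σ j, |x - y| ≤ D

/-- A contour in the complex plane: finitely many closed rectifiable curves, each of them with a
Lipschitz parametrization on `[0, 1]`. -/
structure Contour where
  n : ℕ
  curve : Fin n → ℝ → ℂ
  lipschitz : ∀ i, ∃ K, LipschitzOnWith K (curve i) (Set.Icc 0 1)
  closed : ∀ i, curve i 0 = curve i 1

/-- The points that lie on a contour. -/
def Contour.support (Γ : Contour) : Set ℂ := ⋃ i, Γ.curve i '' Set.Icc 0 1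

/-- The contour integral `∫_Γ F(z) dz`. -/
def Contour.integral {V : Type*} [NormedAddCommGroup V] [NormedSpace ℂ V] (Γ : Contour)
    (F : ℂ → V) : V :=
  ∑ i, ∫ t in (0 : ℝ)..1, deriv (Γ.curve i) t • F (Γ.curve i t)

/-- The length of a contour. -/
def Contour.length (Γ : Contour) : ℝ := ∑ i, ∫ t in (0 : ℝ)..1, ‖deriv (Γ.curve i) t‖

/-- The winding number of a contour about a point that is not on it. -/
def Contour.windingNumber (Γ : Contour) (w : ℂ) : ℂ :=
  (2 * Real.pi * Complex.I)⁻¹ * Γ.integral fun z => (z - w)⁻¹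

/-- The family `(Q j)_j` is the family of band projectors
`Q j = P (1/(2πi) ∫_{Γ j} (z - T)⁻¹ dz) P` of `T` for the decomposition `(σ j)_j` of its spectrum,
with constants `d`, `D`: here the contour `Γ j` lies in the resolvent set, winds once around each
point of `σ j` and does not wind around the rest of the spectrum, and for some `C`, `C'` that do not
depend on `j` one has `‖(z - T)⁻¹‖ ≤ C d⁻¹` on `Γ j`, and `Γ j` has length at most `C' (D + d)`. -/
def IsBandProjectors {J : Type*} (P : L2 →L[ℂ] L2) (T : L2 →ₗ.[ℂ] L2) (σ : J → Set ℝ) (d D : ℝ)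
    (Q : J → L2 →L[ℂ] L2) : Prop :=
  ∃ (Γ : J → Contour) (C C' : ℝ), ∀ j,
    Disjoint (Γ j).support (opSpectrum T) ∧
    (∀ x ∈ σ j, (Γ j).windingNumber (x : ℂ) = 1) ∧
    (∀ k, k ≠ j → ∀ x ∈ σ k, (Γ j).windingNumber (x : ℂ) = 0) ∧
    (∀ z ∈ (Γ j).support, ‖opResolvent T z‖ ≤ C * d⁻¹) ∧
    (Γ j).length ≤ C' * (D + d) ∧
    Q j = P ∘L ((2 * Real.pi * Complex.I : ℂ)⁻¹ • (Γ j).integral (opResolvent T)) ∘L P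

/-! ### Properties of band projectors and generalized Wannier bases -/

/-- The orthogonal projectors `Q j` have exponentially localized kernels and are localized along
lines `x₁ = η`, `η ∈ σ j`, with constants that do not depend on `j`. The estimates on tilted
operators are uniform in the center `a`. -/
def IsUniformlyLocalized {J : Type*} (σ : J → Set ℝ) (Q : J → L2 →L[ℂ] L2) : Prop :=
  ∃ C C' γ : ℝ, 0 < C ∧ 0 < C' ∧ 0 < γ ∧ ∀ j,
    IsStarProjection (Q j) ∧ HasExpKernel (Q j) C γ ∧
    ∀ η ∈ σ j, ∀ γ' ∈ Set.Icc 0 γ, ∀ a : Plane,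
      ((opComp (posXSub η) (tilt (ofBdd (Q j)) γ' a)).domain = ⊤ ∧
        NormLE (opComp (posXSub η) (tilt (ofBdd (Q j)) γ' a)) C') ∧
      ((opComp (tilt (ofBdd (Q j)) γ' a) (posXSub η)).domain = posX.domain ∧
        NormLE (opComp (tilt (ofBdd (Q j)) γ' a) (posXSub η)) C')

/-- The range of `P` has an orthonormal basis `(ψ i)_i` of exponentially localized functions
(generalized Wannier functions) with centers `c i`:
`∫ e^{2 γ √(1 + |x - c i|²)} |ψ i (x)|² dx ≤ C`, with constants that do not depend on `i`. -/
def HasExpLocWannierBasis (P : L2 →L[ℂ] L2) : Prop :=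
  ∃ (ι : Type) (_ : Countable ι) (ψ : ι → L2) (c : ι → Plane) (C γ : ℝ), 0 < C ∧ 0 < γ ∧
    Orthonormal ℂ ψ ∧
    (Submodule.span ℂ (Set.range ψ)).topologicalClosure = P.toLinearMap.range ∧
    ∀ i, ∫⁻ x, ENNReal.ofReal (Real.exp (2 * γ * weight (c i) x) * ‖ψ i x‖ ^ 2) ≤
      ENNReal.ofReal C

end GWF

end

open GWF

/-!
The operator `X̂` is a symmetric extension of `X + V` with `V` bounded and self-adjoint, hence equal
to `X + V`, as self-adjoint operators are maximal symmetric. If `P` has the kernel `p(x, x')`, then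
the commutator `K = [X, P]` has the kernel `(x₁ - x'₁) p(x, x')`, which is again exponentially
localized and therefore bounded by Schur's test. This makes `T = P X̂ P` self-adjoint
(`isSelfAdjoint_compress`).

*Riesz projections.* Mathlib has no functional calculus for unbounded operators, but `(i - T)⁻¹` is a
bounded normal operator, and all resolvents of `T` are continuous functions of it. A Riesz
projection is represented by the function `x ↦` winding number of the contour about `x`
(`exists_cfcHom_eq_rieszProj`). Thus it is an orthogonal projection if the winding numbers are `0`
and `1`, and the contours that define a band projector can be replaced by any others with the same
winding numbers. The real line is divided into cells of length `d / 2`; circles through consecutive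
empty cells separate the bands, have bounded radii and keep a fixed distance from the spectrum, so
that `(z - T)⁻¹` is bounded on them (`exists_separatingCircles`, `norm_opResolvent_le`).

*Combes–Thomas estimate.* Let `E = e^{-sw}` with the weight `w` centered at `a`. The operator `T` is
completed to the block-diagonal operator `P (λ - X̂) P + (1 - P) (c + i - X̂) (1 - P)`. It is
invertible, and up to the commutator `K` its unbounded part is `-(X - c + i)`, which commutes with
`E`. Conjugation with `E` therefore changes only the bounded part, which is made of `P`, `K` and `V`,
by an error of order `s`: for `P` and `K` by Schur's test, for `V` by hypothesis. A Neumann series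
shows that the conjugated block-diagonal operator is still invertible, and its inverse maps into the
domain of `X` with bounds for `X - c + i` from either side. All bounds are uniform in `a`, and also
in `c` as long as `|λ - c|` is bounded. Integration along a contour yields the bounds on the tilted
band projectors (`exists_lineLocalized`). Tilted operators enter through intertwining relations
`A E = E A'` between bounded operators; `E` is injective, so these determine `A'`.

*Kernels.* If `B` stays bounded under all exponential tilts, then `P B P` has the kernel
`⟨p(x, ·), B p(·, x')⟩` in terms of the sections of the kernel of `P`, and a tilt centered at `x'`
shows that it decays exponentially (`hasExpKernel_of_tilts`). For `B` the projection `Q` of a contour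
this gives a localized kernel of `Q`, and a localized operator `U` with `(X - c + i) Q = U`.

*Wannier functions.* Each separating circle with center `c` has a Riesz projection `Q`, which is
localized near the line `x₁ = c`. Let `Y` be the second position operator. Functions in `ran Q` on
which `Q Y Q` is bounded are concentrated in a box by Chebyshev's inequality, and an orthonormal
family of these is finite, because the local trace of `Q` is finite
(`finiteDimensional_of_concentrated`). So `Q Y Q` has an orthonormal basis of eigenfunctions in
`ran Q` (`exists_eigenbasis`). An eigenfunction `ψ` with eigenvalue `t` satisfies
`(X - c + i) ψ = U ψ` and `(Y - t) ψ = [Y, Q] ψ`, with localized operators on the right-hand sides.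
Conjugation with truncated exponential weights centered at `(c, t)` preserves the form of these
equations, and Chebyshev's inequality for the weighted function gives the exponential decay with
uniform constants (`exists_lintegral_exp_weight_le`). The projections of different circles are
orthogonal, and their ranges span `ran P` because the part of `(i - T)⁻¹` outside of a large ball is
small (`eq_zero_of_rieszProj_apply_eq_zero`).
-/

noncomputable section

namespace GWF

/-! ### Bounded multiplication operators -/

/-- Bounded measurable functions on the plane (bounded everywhere, not just almost everywhere). -/
def BddMeas (b : Plane → ℂ) : Prop := Measurable b ∧ ∃ M : ℝ, ∀ x, ‖b x‖ ≤ M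

theorem BddMeas.memLp_mul {b : Plane → ℂ} (hb : BddMeas b) (f : L2) :
    MemLp (fun x => b x * f x) 2 (volume : Measure Plane) := by
  obtain ⟨hm, M, hM⟩ := hb
  refine MemLp.of_le_mul (c := M) (Lp.memLp f)
    (hm.aestronglyMeasurable.mul (Lp.aestronglyMeasurable f)) ?_
  filter_upwards with x
  rw [norm_mul]
  exact mul_le_mul_of_nonneg_right (hM x) (norm_nonneg _)

theorem BddMeas.norm_toLp_le {b : Plane → ℂ} (hb : BddMeas b) {M : ℝ} (hM : ∀ x, ‖b x‖ ≤ M)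
    (f : L2) : ‖MemLp.toLp _ (hb.memLp_mul f)‖ ≤ M * ‖f‖ := by
  refine Lp.norm_le_mul_norm_of_ae_le_mul ?_
  filter_upwards [MemLp.coeFn_toLp (hb.memLp_mul f)] with x hx
  rw [hx, norm_mul]
  exact mul_le_mul_of_nonneg_right (hM x) (norm_nonneg _)

open Classical in
/-- Multiplication by a bounded measurable function, as a bounded operator (and `0` for functions
that are not bounded and measurable). -/
def bmul (b : Plane → ℂ) : L2 →L[ℂ] L2 :=
  if hb : BddMeas b then
    LinearMap.mkContinuousOfExistsBound
      { toFun := fun f => MemLp.toLp _ (hb.memLp_mul f)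
        map_add' := by
          intro f g
          refine Lp.ext ?_
          filter_upwards [Lp.coeFn_add f g, MemLp.coeFn_toLp (hb.memLp_mul (f + g)),
            MemLp.coeFn_toLp (hb.memLp_mul f), MemLp.coeFn_toLp (hb.memLp_mul g),
            Lp.coeFn_add (MemLp.toLp _ (hb.memLp_mul f)) (MemLp.toLp _ (hb.memLp_mul g))]
            with x h1 h2 h3 h4 h5
          rw [h2, h5, Pi.add_apply, h3, h4, h1, Pi.add_apply]
          ring
        map_smul' := by
          intro c f
          refine Lp.ext ?_
          filter_upwards [Lp.coeFn_smul c f, MemLp.coeFn_toLp (hb.memLp_mul (c • f)),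
            MemLp.coeFn_toLp (hb.memLp_mul f),
            Lp.coeFn_smul c (MemLp.toLp _ (hb.memLp_mul f))] with x h1 h2 h3 h4
          rw [h2, RingHom.id_apply, h4, Pi.smul_apply, h3, h1, Pi.smul_apply, smul_eq_mul,
            smul_eq_mul]
          ring }
      ⟨hb.2.choose, fun f => hb.norm_toLp_le hb.2.choose_spec f⟩
  else 0

theorem bmul_apply {b : Plane → ℂ} (hb : BddMeas b) (f : L2) :
    bmul b f = MemLp.toLp _ (hb.memLp_mul f) := by
  rw [bmul, dif_pos hb]
  rfl

theorem bmul_coe {b : Plane → ℂ} (hb : BddMeas b) (f : L2) :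
    bmul b f =ᵐ[volume] fun x => b x * f x := by
  rw [bmul_apply hb]
  exact MemLp.coeFn_toLp _

theorem norm_bmul_le {b : Plane → ℂ} (hb : BddMeas b) {M : ℝ} (hM : ∀ x, ‖b x‖ ≤ M) :
    ‖bmul b‖ ≤ M := by
  refine ContinuousLinearMap.opNorm_le_bound _ ((norm_nonneg _).trans (hM 0)) fun f => ?_
  rw [bmul_apply hb]
  exact hb.norm_toLp_le hM f

theorem BddMeas.mul {a b : Plane → ℂ} (ha : BddMeas a) (hb : BddMeas b) :
    BddMeas fun x => a x * b x := by
  obtain ⟨ha, M, hM⟩ := ha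
  obtain ⟨hb, N, hN⟩ := hb
  refine ⟨ha.mul hb, M * N, fun x => ?_⟩
  rw [norm_mul]
  exact mul_le_mul (hM x) (hN x) (norm_nonneg _) ((norm_nonneg _).trans (hM x))

theorem BddMeas.conj {a : Plane → ℂ} (ha : BddMeas a) :
    BddMeas fun x => (starRingEnd ℂ) (a x) := by
  obtain ⟨ha, M, hM⟩ := ha
  exact ⟨Complex.continuous_conj.measurable.comp ha, M, fun x => by
    simpa using hM x⟩

theorem bmul_comp {a b : Plane → ℂ} (ha : BddMeas a) (hb : BddMeas b) :
    bmul a ∘L bmul b = bmul fun x => a x * b x := by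
  ext1 f
  refine Lp.ext ?_
  filter_upwards [bmul_coe ha (bmul b f), bmul_coe hb f, bmul_coe (ha.mul hb) f] with x h1 h2 h3
  rw [ContinuousLinearMap.comp_apply, h1, h2, h3, mul_assoc]

theorem bmul_commute {a b : Plane → ℂ} (ha : BddMeas a) (hb : BddMeas b) :
    bmul a ∘L bmul b = bmul b ∘L bmul a := by
  rw [bmul_comp ha hb, bmul_comp hb ha]
  congr 1
  ext x
  ring

theorem bmul_one : bmul (fun _ => 1) = 1 := by
  ext1 f
  refine Lp.ext ?_
  filter_upwards [bmul_coe (b := fun _ => 1) ⟨measurable_const, 1, by simp⟩ f] with x h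
  rw [h, one_mul]
  rfl

theorem bmul_adjoint {b : Plane → ℂ} (hb : BddMeas b) (f g : L2) :
    inner ℂ (bmul b f) g = inner ℂ f (bmul (fun x => (starRingEnd ℂ) (b x)) g) := by
  rw [L2.inner_def, L2.inner_def]
  refine integral_congr_ae ?_
  filter_upwards [bmul_coe hb f, bmul_coe hb.conj g] with x h1 h2
  rw [h1, h2]
  simp only [RCLike.inner_apply, map_mul]
  ring

theorem bmul_injective {b : Plane → ℂ} (hb : BddMeas b) (h0 : ∀ x, b x ≠ 0) :
    Function.Injective (bmul b) := by
  rw [injective_iff_map_eq_zero]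
  intro f hf
  refine Lp.ext ?_
  filter_upwards [bmul_coe hb f, Lp.coeFn_zero ℂ 2 (volume : Measure Plane)] with x h1 h2
  rw [hf, h2] at h1
  rw [h2]
  simpa [h0 x] using h1.symm

/-! ### Unbounded multiplication operators -/

theorem mem_mulOp_domain {w : Plane → ℝ} {f : L2} :
    f ∈ (mulOp w).domain ↔ MemLp (fun x => (w x : ℂ) * f x) 2 volume := Iff.rfl

theorem mulOp_coe {w : Plane → ℝ} (f : (mulOp w).domain) :
    mulOp w f =ᵐ[volume] fun x => (w x : ℂ) * (f : L2) x :=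
  MemLp.coeFn_toLp f.2

theorem mem_mulOp_domain_of_ae {w : Plane → ℝ} {f h : L2}
    (H : (fun x => (w x : ℂ) * f x) =ᵐ[volume] h) :
    ∃ hf : f ∈ (mulOp w).domain, mulOp w ⟨f, hf⟩ = h := by
  have hf : f ∈ (mulOp w).domain :=
    mem_mulOp_domain.2 ((memLp_congr_ae H).2 (Lp.memLp h))
  refine ⟨hf, Lp.ext ?_⟩
  filter_upwards [mulOp_coe ⟨f, hf⟩, H] with x h1 h2
  rw [h1, h2]

/-- The bounded function `(w + i)⁻¹`, which is the resolvent of the multiplication operator `w`. -/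
def resFun (w : Plane → ℝ) (x : Plane) : ℂ := ((w x : ℂ) + Complex.I)⁻¹

theorem ofReal_add_I_ne_zero (t : ℝ) : (t : ℂ) + Complex.I ≠ 0 := by
  intro h
  have := congrArg Complex.im h
  simp at this

theorem resFun_ne_zero (w : Plane → ℝ) (x : Plane) : resFun w x ≠ 0 :=
  inv_ne_zero (ofReal_add_I_ne_zero _)

theorem norm_resFun_le (w : Plane → ℝ) (x : Plane) : ‖resFun w x‖ ≤ 1 := by
  rw [resFun, norm_inv]
  refine inv_le_one_of_one_le₀ ?_
  have := Complex.abs_im_le_norm ((w x : ℂ) + Complex.I)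
  simpa using this

theorem bddMeas_resFun {w : Plane → ℝ} (hw : Measurable w) : BddMeas (resFun w) :=
  ⟨((Complex.measurable_ofReal.comp hw).add_const _).inv, 1, norm_resFun_le w⟩

theorem bmul_resFun_mem {w : Plane → ℝ} (hw : Measurable w) (h : L2) :
    ∃ hf : bmul (resFun w) h ∈ (mulOp w).domain,
      mulOp w ⟨_, hf⟩ = h - Complex.I • bmul (resFun w) h := by
  refine mem_mulOp_domain_of_ae ?_
  filter_upwards [bmul_coe (bddMeas_resFun hw) h,
    Lp.coeFn_sub h (Complex.I • bmul (resFun w) h),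
    Lp.coeFn_smul Complex.I (bmul (resFun w) h)] with x h1 h2 h3
  rw [h2, Pi.sub_apply, h3, Pi.smul_apply, h1, resFun, smul_eq_mul]
  field_simp [ofReal_add_I_ne_zero (w x)]
  ring

theorem eq_bmul_resFun {w : Plane → ℝ} (hw : Measurable w) (f : (mulOp w).domain) :
    bmul (resFun w) (mulOp w f + Complex.I • (f : L2)) = f := by
  refine Lp.ext ?_
  filter_upwards [bmul_coe (bddMeas_resFun hw) (mulOp w f + Complex.I • (f : L2)),
    Lp.coeFn_add (mulOp w f) (Complex.I • (f : L2)),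
    Lp.coeFn_smul Complex.I (f : L2), mulOp_coe f] with x h1 h2 h3 h4
  rw [h1, h2, Pi.add_apply, h3, Pi.smul_apply, h4, resFun, smul_eq_mul, ← add_mul,
    inv_mul_cancel_left₀ (ofReal_add_I_ne_zero _)]

/-- If `b = 1 / w` is bounded, then the domain of the multiplication by `w` is the range of the
multiplication by `b`. -/
theorem bmul_inv_mem {w : Plane → ℝ} {b : Plane → ℂ} (hb : BddMeas b) (h1 : ∀ x, (w x : ℂ) * b x = 1)
    (h : L2) : ∃ hf : bmul b h ∈ (mulOp w).domain, mulOp w ⟨_, hf⟩ = h := by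
  refine mem_mulOp_domain_of_ae ?_
  filter_upwards [bmul_coe hb h] with x h2
  rw [h2, ← mul_assoc, h1, one_mul]

theorem eq_bmul_inv {w : Plane → ℝ} {b : Plane → ℂ} (hb : BddMeas b) (h1 : ∀ x, (w x : ℂ) * b x = 1)
    (f : (mulOp w).domain) : bmul b (mulOp w f) = f := by
  refine Lp.ext ?_
  filter_upwards [bmul_coe hb (mulOp w f), mulOp_coe f] with x h2 h3
  rw [h2, h3, ← mul_assoc, mul_comm (b x), h1, one_mul]

theorem mulOp_symm (w : Plane → ℝ) : (mulOp w).IsFormalAdjoint (mulOp w) := by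
  intro f g
  rw [L2.inner_def, L2.inner_def]
  refine integral_congr_ae ?_
  filter_upwards [mulOp_coe f, mulOp_coe g] with x h1 h2
  rw [h1, h2]
  simp only [RCLike.inner_apply, map_mul, Complex.conj_ofReal]
  ring

/-- The maximal multiplication operator has no proper symmetric extension: every `g` that satisfies
the defining identity of the adjoint lies in the domain. -/
theorem ae_smul_eq_of_inner_eq {w : Plane → ℝ} (hw : Measurable w) {g h : L2}
    (H : ∀ f : (mulOp w).domain, inner ℂ h (f : L2) = inner ℂ g (mulOp w f)) :
    ∃ hg : g ∈ (mulOp w).domain, mulOp w ⟨g, hg⟩ = h := by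
  have hb := bddMeas_resFun hw
  -- testing against `f = (w + i)⁻¹ u` for arbitrary `u ∈ L²` gives a pointwise identity
  have key : bmul (fun x => (starRingEnd ℂ) (resFun w x)) (h - Complex.I • g) = g := by
    refine ext_inner_right ℂ fun u => ?_
    obtain ⟨hf, hfu⟩ := bmul_resFun_mem hw u
    have h1 := H ⟨_, hf⟩
    rw [hfu, inner_sub_right] at h1
    rw [bmul_adjoint hb.conj]
    simp only [Complex.conj_conj]
    change inner ℂ _ (bmul (resFun w) u) = _
    rw [inner_sub_left, h1, inner_smul_left, inner_smul_right]
    simp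
  refine mem_mulOp_domain_of_ae ?_
  filter_upwards [bmul_coe hb.conj (h - Complex.I • g), Lp.coeFn_sub h (Complex.I • g),
    Lp.coeFn_smul Complex.I g] with x h1 h2 h3
  rw [key, h2, Pi.sub_apply, h3, Pi.smul_apply, smul_eq_mul, resFun, map_inv₀, map_add,
    Complex.conj_ofReal, Complex.conj_I] at h1
  have h4 : (w x : ℂ) + -Complex.I ≠ 0 := by
    intro h
    have := congrArg Complex.im h
    simp at this
  have h5 : ((w x : ℂ) + -Complex.I) * g x = h x - Complex.I * g x := by
    rw [h1, mul_inv_cancel_left₀ h4]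
    rw [← h1]
  linear_combination h5

theorem mulOp_dense {w : Plane → ℝ} (hw : Measurable w) :
    Dense ((mulOp w).domain : Set L2) := by
  rw [Submodule.dense_iff_topologicalClosure_eq_top, Submodule.topologicalClosure_eq_top_iff,
    Submodule.eq_bot_iff]
  intro g hg
  refine bmul_injective (bddMeas_resFun hw).conj
    (fun x => (map_ne_zero _).2 (resFun_ne_zero w x)) ?_
  rw [map_zero]
  refine ext_inner_left ℂ fun u => ?_
  rw [← bmul_adjoint (bddMeas_resFun hw), inner_zero_right]
  exact (Submodule.mem_orthogonal _ _).1 hg _ (bmul_resFun_mem hw u).1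

/-! ### Compositions of partially defined operators -/

theorem mem_opComp_domain {S T : L2 →ₗ.[ℂ] L2} {f : L2} :
    f ∈ (opComp S T).domain ↔ ∃ h : f ∈ T.domain, T ⟨f, h⟩ ∈ S.domain := by
  constructor
  · rintro ⟨h1, h2⟩
    obtain ⟨⟨y, hy⟩, hy', rfl⟩ := h1
    exact ⟨hy, hy'⟩
  · rintro ⟨h, h'⟩
    exact ⟨⟨⟨f, h⟩, h', rfl⟩, h⟩

theorem opComp_apply {S T : L2 →ₗ.[ℂ] L2} {f : L2} (hf : f ∈ (opComp S T).domain)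
    (h : f ∈ T.domain) (h' : T ⟨f, h⟩ ∈ S.domain) :
    opComp S T ⟨f, hf⟩ = S ⟨T ⟨f, h⟩, h'⟩ := rfl

theorem ofBdd_apply (A : L2 →L[ℂ] L2) (f : (ofBdd A).domain) : ofBdd A f = A f := rfl

theorem mem_compress_domain {P : L2 →L[ℂ] L2} {T : L2 →ₗ.[ℂ] L2} {f : L2} :
    f ∈ (compress P T).domain ↔ P f ∈ T.domain := by
  rw [compress, mem_opComp_domain]
  constructor
  · rintro ⟨h, -⟩
    exact (mem_opComp_domain.1 h).2
  · intro h
    exact ⟨mem_opComp_domain.2 ⟨trivial, h⟩, trivial⟩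

theorem compress_apply {P : L2 →L[ℂ] L2} {T : L2 →ₗ.[ℂ] L2} {f : L2}
    (hf : f ∈ (compress P T).domain) (h : P f ∈ T.domain) :
    compress P T ⟨f, hf⟩ = P (T ⟨P f, h⟩) := rfl

/-! ### Self-adjoint operators -/

/-- A densely defined symmetric operator is self-adjoint if the domain of its adjoint is contained
in its own domain. The hypothesis `hm` expresses this without mentioning the adjoint. -/
theorem isSelfAdjoint_of_symm {T : L2 →ₗ.[ℂ] L2} (hd : Dense (T.domain : Set L2))
    (hs : T.IsFormalAdjoint T)
    (hm : ∀ g h : L2, (∀ f : T.domain, inner ℂ h (f : L2) = inner ℂ g (T f)) → g ∈ T.domain) :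
    IsSelfAdjoint T := by
  rw [LinearPMap.isSelfAdjoint_def]
  have hle : T ≤ T.adjoint := LinearPMap.IsFormalAdjoint.le_adjoint hd hs
  refine (LinearPMap.eq_of_le_of_domain_eq hle (le_antisymm hle.1 fun g hg => ?_)).symm
  exact hm g (T.adjoint ⟨g, hg⟩) fun f => LinearPMap.adjoint_isFormalAdjoint hd ⟨g, hg⟩ f

theorem symm_of_isSelfAdjoint {T : L2 →ₗ.[ℂ] L2} (hT : IsSelfAdjoint T) :
    T.IsFormalAdjoint T := by
  have h := LinearPMap.adjoint_isFormalAdjoint hT.dense_domain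
  rwa [LinearPMap.isSelfAdjoint_def.1 hT] at h

/-- The defining identity of the adjoint places `g` in the domain of a self-adjoint operator. -/
theorem mem_domain_of_isSelfAdjoint {T : L2 →ₗ.[ℂ] L2} (hT : IsSelfAdjoint T) {g h : L2}
    (H : ∀ f : T.domain, inner ℂ h (f : L2) = inner ℂ g (T f)) :
    ∃ hg : g ∈ T.domain, T ⟨g, hg⟩ = h := by
  have hg : g ∈ T.domain := by
    have := LinearPMap.mem_adjoint_domain_of_exists (T := T) g ⟨h, H⟩
    rwa [LinearPMap.isSelfAdjoint_def.1 hT] at this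
  refine ⟨hg, hT.dense_domain.eq_of_inner_left ℂ fun f hf => ?_⟩
  rw [H ⟨f, hf⟩]
  exact symm_of_isSelfAdjoint hT ⟨g, hg⟩ ⟨f, hf⟩

theorem isSelfAdjoint_mulOp {w : Plane → ℝ} (hw : Measurable w) : IsSelfAdjoint (mulOp w) :=
  isSelfAdjoint_of_symm (mulOp_dense hw) (mulOp_symm w) fun _ _ H =>
    (ae_smul_eq_of_inner_eq hw H).1

theorem inner_apply_self_im {T : L2 →ₗ.[ℂ] L2} (hT : IsSelfAdjoint T) (f : T.domain) :
    (inner ℂ (f : L2) (T f)).im = 0 := by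
  have h := symm_of_isSelfAdjoint hT f f
  rw [← inner_conj_symm] at h
  exact Complex.conj_eq_iff_im.1 h

/-- A self-adjoint operator has a real quadratic form, so that `z - T` is bounded below by `|im z|`.
-/
theorem abs_im_mul_norm_le {T : L2 →ₗ.[ℂ] L2} (hT : IsSelfAdjoint T) (z : ℂ) (f : T.domain) :
    |z.im| * ‖(f : L2)‖ ≤ ‖z • (f : L2) - T f‖ := by
  by_cases h0 : ‖(f : L2)‖ = 0
  · rw [h0, mul_zero]
    exact norm_nonneg _
  have h1 : (inner ℂ (f : L2) (z • (f : L2) - T f)).im = z.im * ‖(f : L2)‖ ^ 2 := by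
    rw [inner_sub_right, Complex.sub_im, inner_apply_self_im hT, sub_zero, inner_smul_right,
      inner_self_eq_norm_sq_to_K]
    norm_cast
    exact Complex.im_mul_ofReal _ _
  have h2 : |z.im| * ‖(f : L2)‖ ^ 2 ≤ ‖(f : L2)‖ * ‖z • (f : L2) - T f‖ := by
    calc |z.im| * ‖(f : L2)‖ ^ 2 = |(inner ℂ (f : L2) (z • (f : L2) - T f)).im| := by
          rw [h1, abs_mul, abs_of_nonneg (sq_nonneg ‖(f : L2)‖)]
      _ ≤ ‖inner ℂ (f : L2) (z • (f : L2) - T f)‖ := Complex.abs_im_le_norm _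
      _ ≤ _ := norm_inner_le_norm _ _
  have h3 : 0 < ‖(f : L2)‖ := lt_of_le_of_ne (norm_nonneg _) (Ne.symm h0)
  nlinarith

/-! ### Resolvents -/

theorem IsResolventAt.unique {T : L2 →ₗ.[ℂ] L2} {z : ℂ} {R R' : L2 →L[ℂ] L2}
    (h : IsResolventAt T z R) (h' : IsResolventAt T z R') : R = R' := by
  ext1 f
  obtain ⟨h1, h2⟩ := h.1 f
  have h3 := h'.2 ⟨R f, h1⟩
  rw [h2] at h3
  exact h3.symm

theorem IsResolventAt.opResolvent_eq {T : L2 →ₗ.[ℂ] L2} {z : ℂ} {R : L2 →L[ℂ] L2}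
    (h : IsResolventAt T z R) : opResolvent T z = R := by
  have hex : ∃ R, IsResolventAt T z R := ⟨R, h⟩
  rw [opResolvent, dif_pos hex]
  exact hex.choose_spec.unique h

theorem isResolventAt_opResolvent {T : L2 →ₗ.[ℂ] L2} {z : ℂ} (hz : z ∉ opSpectrum T) :
    IsResolventAt T z (opResolvent T z) := by
  have hex : ∃ R, IsResolventAt T z R := not_not.1 hz
  rw [opResolvent, dif_pos hex]
  exact hex.choose_spec

/-- A surjective operator `z - T` that is bounded below has a bounded inverse. -/
theorem exists_isResolventAt {T : L2 →ₗ.[ℂ] L2} {z : ℂ} {c : ℝ} (hc : 0 < c)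
    (hb : ∀ f : T.domain, c * ‖(f : L2)‖ ≤ ‖z • (f : L2) - T f‖)
    (hs : ∀ g : L2, ∃ f : T.domain, z • (f : L2) - T f = g) :
    ∃ R, IsResolventAt T z R ∧ ‖R‖ ≤ 1 / c := by
  have hinj : ∀ f g : T.domain, z • (f : L2) - T f = z • (g : L2) - T g → f = g := by
    intro f g hfg
    have h1 := hb (f - g)
    have h2 : z • ((f - g : T.domain) : L2) - T (f - g) = 0 := by
      rw [LinearPMap.map_sub, Submodule.coe_sub, smul_sub, sub_sub_sub_comm, hfg, sub_self]
    rw [h2, norm_zero] at h1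
    have h3 : ‖((f - g : T.domain) : L2)‖ = 0 :=
      le_antisymm (by nlinarith [norm_nonneg ((f - g : T.domain) : L2)]) (norm_nonneg _)
    exact sub_eq_zero.1 (Subtype.ext (norm_eq_zero.1 h3))
  choose r hr using hs
  let R : L2 →ₗ[ℂ] L2 :=
    { toFun := fun g => r g
      map_add' := fun g h => by
        have : r (g + h) = r g + r h := hinj _ _ (by
          rw [hr, LinearPMap.map_add, Submodule.coe_add, smul_add, add_sub_add_comm, hr, hr])
        rw [this, Submodule.coe_add]
      map_smul' := fun a g => by
        have : r (a • g) = a • r g := hinj _ _ (by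
          rw [hr, LinearPMap.map_smul, Submodule.coe_smul, smul_comm, ← smul_sub, hr])
        rw [this, Submodule.coe_smul, RingHom.id_apply] }
  have hR : ∀ g, ‖R g‖ ≤ 1 / c * ‖g‖ := by
    intro g
    have h1 := hb (r g)
    rw [hr] at h1
    rw [div_mul_eq_mul_div, one_mul, le_div_iff₀ hc, mul_comm]
    exact h1
  refine ⟨LinearMap.mkContinuous R _ hR, ⟨fun f => ⟨(r f).2, hr f⟩, fun g => ?_⟩,
    LinearMap.mkContinuous_norm_le _ (by positivity) _⟩
  change ((r (z • (g : L2) - T g) : T.domain) : L2) = g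
  rw [hinj _ _ (hr (z • (g : L2) - T g))]

/-- The spectrum of a self-adjoint operator is real: for nonreal `z` the range of `z - T` is closed
because `z - T` is bounded below, and dense because the same holds for the adjoint `conj z - T`. -/
theorem exists_isResolventAt_of_im_ne_zero {T : L2 →ₗ.[ℂ] L2} (hT : IsSelfAdjoint T) {z : ℂ}
    (hz : z.im ≠ 0) : ∃ R, IsResolventAt T z R ∧ ‖R‖ ≤ 1 / |z.im| := by
  have hc : 0 < |z.im| := abs_pos.2 hz
  refine exists_isResolventAt hc (abs_im_mul_norm_le hT z) ?_
  -- it remains to show that the range of `z - T` is closed and has trivial orthogonal complement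
  let ℓ : T.domain →ₗ[ℂ] L2 := z • T.domain.subtype - T.toFun
  have hℓ : ∀ f : T.domain, ℓ f = z • (f : L2) - T f := fun f => rfl
  have hclosed : IsClosed (LinearMap.range ℓ : Set L2) := by
    rw [← isSeqClosed_iff_isClosed]
    intro y g hy hlim
    choose f hf using hy
    have hC : CauchySeq fun n => ((f n : T.domain) : L2) := by
      have hyC := hlim.cauchySeq
      rw [Metric.cauchySeq_iff] at hyC ⊢
      intro ε hε
      obtain ⟨N, hN⟩ := hyC (|z.im| * ε) (by positivity)
      refine ⟨N, fun m hm n hn => ?_⟩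
      have h1 := hN m hm n hn
      have h2 := abs_im_mul_norm_le hT z (f m - f n)
      rw [← hℓ, map_sub, hf, hf, Submodule.coe_sub] at h2
      rw [dist_eq_norm] at h1 ⊢
      exact lt_of_mul_lt_mul_left (h2.trans_lt h1) hc.le
    obtain ⟨f₀, hf₀⟩ := cauchySeq_tendsto_of_complete hC
    have hmem : ∃ h : f₀ ∈ T.domain, T ⟨f₀, h⟩ = z • f₀ - g := by
      refine mem_domain_of_isSelfAdjoint hT fun u => ?_
      have l1 : Filter.Tendsto (fun n => inner ℂ (z • ((f n : T.domain) : L2) - y n) (u : L2))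
          Filter.atTop (nhds (inner ℂ (z • f₀ - g) (u : L2))) :=
        ((hf₀.const_smul z).sub hlim).inner tendsto_const_nhds
      have l2 : Filter.Tendsto (fun n => inner ℂ ((f n : T.domain) : L2) (T u))
          Filter.atTop (nhds (inner ℂ f₀ (T u))) := hf₀.inner tendsto_const_nhds
      refine tendsto_nhds_unique l1 (l2.congr fun n => ?_)
      rw [← symm_of_isSelfAdjoint hT (f n) u, ← hf n, hℓ, sub_sub_cancel]
    obtain ⟨h, h'⟩ := hmem
    refine ⟨⟨f₀, h⟩, ?_⟩
    rw [hℓ, h', sub_sub_cancel]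
  have hperp : (LinearMap.range ℓ)ᗮ = ⊥ := by
    rw [Submodule.eq_bot_iff]
    intro g hg
    have hmem : ∃ h : g ∈ T.domain, T ⟨g, h⟩ = (starRingEnd ℂ) z • g := by
      refine mem_domain_of_isSelfAdjoint hT fun u => ?_
      have h1 := (Submodule.mem_orthogonal' _ _).1 hg _ ⟨u, rfl⟩
      rw [hℓ, inner_sub_right, inner_smul_right, sub_eq_zero] at h1
      rw [← h1, inner_smul_left, Complex.conj_conj]
    obtain ⟨h, h'⟩ := hmem
    have h2 := abs_im_mul_norm_le hT ((starRingEnd ℂ) z) ⟨g, h⟩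
    rw [h', sub_self, norm_zero, Complex.conj_im, abs_neg] at h2
    exact norm_eq_zero.1 (le_antisymm (by nlinarith [norm_nonneg g]) (norm_nonneg g))
  have htop : LinearMap.range ℓ = ⊤ := by
    rw [← hclosed.submodule_topologicalClosure_eq, Submodule.topologicalClosure_eq_top_iff, hperp]
  intro g
  have hg : g ∈ LinearMap.range ℓ := htop ▸ Submodule.mem_top
  exact hg

theorem not_mem_opSpectrum_of_im_ne_zero {T : L2 →ₗ.[ℂ] L2} (hT : IsSelfAdjoint T) {z : ℂ}
    (hz : z.im ≠ 0) : z ∉ opSpectrum T := by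
  obtain ⟨R, hR, -⟩ := exists_isResolventAt_of_im_ne_zero hT hz
  exact not_not.2 ⟨R, hR⟩

theorem norm_opResolvent_le_of_im_ne_zero {T : L2 →ₗ.[ℂ] L2} (hT : IsSelfAdjoint T) {z : ℂ}
    (hz : z.im ≠ 0) : ‖opResolvent T z‖ ≤ 1 / |z.im| := by
  obtain ⟨R, hR, hle⟩ := exists_isResolventAt_of_im_ne_zero hT hz
  rwa [hR.opResolvent_eq]

/-! ### Bounded perturbations -/

/-- The extension of a densely defined bounded operator by continuity. -/
theorem exists_extension {p : Submodule ℂ L2} (hp : Dense (p : Set L2)) (ℓ : p →ₗ[ℂ] L2) {C : ℝ}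
    (hC : ∀ f : p, ‖ℓ f‖ ≤ C * ‖(f : L2)‖) :
    ∃ V : L2 →L[ℂ] L2, (∀ f : p, V f = ℓ f) ∧ ∀ f, ‖V f‖ ≤ C * ‖f‖ := by
  let ℓ' : p →L[ℂ] L2 := LinearMap.mkContinuous ℓ C hC
  have hV : ∀ f : p, ℓ'.extend p.subtypeL f = ℓ f := fun f =>
    ContinuousLinearMap.extend_eq ℓ' hp.denseRange_val
      isUniformEmbedding_subtype_val.isUniformInducing f
  refine ⟨ℓ'.extend p.subtypeL, hV, fun f => ?_⟩
  have hcl : IsClosed {f : L2 | ‖ℓ'.extend p.subtypeL f‖ ≤ C * ‖f‖} :=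
    isClosed_le (by fun_prop) (by fun_prop)
  refine hcl.closure_subset_iff.2 ?_ (hp f)
  intro g hg
  have := hC ⟨g, hg⟩
  rwa [← hV] at this

/-- A symmetric operator at bounded distance from a self-adjoint operator `X` is a bounded
self-adjoint perturbation of `X`. -/
theorem exists_bounded_perturbation {X Xhat : L2 →ₗ.[ℂ] L2} (hX : IsSelfAdjoint X)
    (hdom : X.domain ≤ Xhat.domain) (hsymm : Xhat.IsFormalAdjoint Xhat) {C : ℝ}
    (hC : NormLE (Xhat - X) C) :
    ∃ V : L2 →L[ℂ] L2, (∀ f g, inner ℂ (V f) g = inner ℂ f (V g)) ∧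
      ∀ f (h : f ∈ X.domain) (h' : f ∈ Xhat.domain), Xhat ⟨f, h'⟩ = X ⟨f, h⟩ + V f := by
  have hd : (Xhat - X).domain = X.domain := by
    rw [LinearPMap.sub_domain]
    exact inf_eq_right.2 hdom
  obtain ⟨V, hV, -⟩ := exists_extension hC.1 (Xhat - X).toFun hC.2
  have hV' : ∀ f (h : f ∈ X.domain) (h' : f ∈ Xhat.domain), Xhat ⟨f, h'⟩ = X ⟨f, h⟩ + V f := by
    intro f h h'
    have h1 := hV ⟨f, hd.symm ▸ h⟩
    rw [LinearPMap.toFun_eq_coe, LinearPMap.sub_apply] at h1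
    rw [h1]
    exact (add_sub_cancel _ _).symm
  refine ⟨V, ?_, hV'⟩
  have hDX := hX.dense_domain
  have key : ∀ f ∈ X.domain, ∀ g ∈ X.domain, inner ℂ (V f) g = inner ℂ f (V g) := by
    intro f hf g hg
    have h1 := hsymm ⟨f, hdom hf⟩ ⟨g, hdom hg⟩
    have h2 := symm_of_isSelfAdjoint hX ⟨f, hf⟩ ⟨g, hg⟩
    rw [hV' f hf, hV' g hg] at h1
    simp only [inner_add_left, inner_add_right] at h1 h2 ⊢
    linear_combination h1 - h2
  have hadj : ContinuousLinearMap.adjoint V = V := by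
    refine DFunLike.coe_injective (Continuous.ext_on hDX (by fun_prop) (by fun_prop) ?_)
    intro f hf
    refine hDX.eq_of_inner_left ℂ fun g hg => ?_
    rw [ContinuousLinearMap.adjoint_inner_left, key f hf g hg]
  intro f g
  rw [← ContinuousLinearMap.adjoint_inner_left, hadj]

/-- The self-adjoint operator `X + V` has no proper symmetric extension. -/
theorem domain_eq_of_bounded_perturbation {X Xhat : L2 →ₗ.[ℂ] L2} (hX : IsSelfAdjoint X)
    (hdom : X.domain ≤ Xhat.domain) (hsymm : Xhat.IsFormalAdjoint Xhat) {V : L2 →L[ℂ] L2}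
    (hVs : ∀ f g, inner ℂ (V f) g = inner ℂ f (V g))
    (hV : ∀ f (h : f ∈ X.domain) (h' : f ∈ Xhat.domain), Xhat ⟨f, h'⟩ = X ⟨f, h⟩ + V f) :
    Xhat.domain = X.domain := by
  refine le_antisymm (fun g hg => ?_) hdom
  refine (mem_domain_of_isSelfAdjoint hX (h := Xhat ⟨g, hg⟩ - V g) fun f => ?_).1
  have h1 := hsymm ⟨g, hg⟩ ⟨f, hdom f.2⟩
  rw [hV f f.2, inner_add_right, ← hVs] at h1
  rw [inner_sub_left, h1, add_sub_cancel_right]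

theorem isSelfAdjoint_of_bounded_perturbation {X Xhat : L2 →ₗ.[ℂ] L2} (hX : IsSelfAdjoint X)
    (hdom : Xhat.domain = X.domain) (hsymm : Xhat.IsFormalAdjoint Xhat) {V : L2 →L[ℂ] L2}
    (hVs : ∀ f g, inner ℂ (V f) g = inner ℂ f (V g))
    (hV : ∀ f (h : f ∈ X.domain) (h' : f ∈ Xhat.domain), Xhat ⟨f, h'⟩ = X ⟨f, h⟩ + V f) :
    IsSelfAdjoint Xhat := by
  refine isSelfAdjoint_of_symm (hdom ▸ hX.dense_domain) hsymm fun g h H => ?_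
  rw [hdom]
  refine (mem_domain_of_isSelfAdjoint hX (h := h - V g) fun f => ?_).1
  have h1 := H ⟨f, hdom.symm ▸ f.2⟩
  rw [hV f f.2, inner_add_right, ← hVs] at h1
  rw [inner_sub_left, h1, add_sub_cancel_right]

/-! ### Compressions to the range of a projection -/

/-- The projection `P` preserves the domain of `T`, and the bounded operator `K` is the commutator
`[T, P]`. -/
def HasCommutator (T : L2 →ₗ.[ℂ] L2) (P K : L2 →L[ℂ] L2) : Prop :=
  ∀ f : T.domain, ∃ h : P f ∈ T.domain, T ⟨P f, h⟩ = P (T f) + K f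

theorem _root_.IsStarProjection.apply_apply {P : L2 →L[ℂ] L2} (hP : IsStarProjection P) (f : L2) :
    P (P f) = P f :=
  DFunLike.congr_fun hP.isIdempotentElem.eq f

theorem _root_.IsStarProjection.inner_apply {P : L2 →L[ℂ] L2} (hP : IsStarProjection P)
    (f g : L2) : inner ℂ (P f) g = inner ℂ f (P g) := by
  conv_lhs => rw [← hP.isSelfAdjoint.star_eq]
  exact ContinuousLinearMap.adjoint_inner_left _ _ _

/-- `P T P` is self-adjoint if the commutator `[T, P]` is bounded: a vector `g` in the domain of the
adjoint satisfies `⟨P g, T f⟩ = ⟨h - K* P g, f⟩` for all `f` in the domain of `T`, hence `P g` lies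
in the domain of `T`. -/
theorem isSelfAdjoint_compress {T : L2 →ₗ.[ℂ] L2} (hT : IsSelfAdjoint T) {P K : L2 →L[ℂ] L2}
    (hP : IsStarProjection P) (hK : HasCommutator T P K) : IsSelfAdjoint (compress P T) := by
  have hsub : ∀ f ∈ T.domain, f ∈ (compress P T).domain := fun f hf =>
    mem_compress_domain.2 (hK ⟨f, hf⟩).1
  refine isSelfAdjoint_of_symm (hT.dense_domain.mono hsub) ?_ ?_
  · rintro ⟨f, hf⟩ ⟨g, hg⟩
    have hf' := mem_compress_domain.1 hf
    have hg' := mem_compress_domain.1 hg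
    rw [compress_apply hf hf', compress_apply hg hg']
    rw [hP.inner_apply, ← hP.inner_apply f]
    exact symm_of_isSelfAdjoint hT ⟨P f, hf'⟩ ⟨P g, hg'⟩
  · intro g h H
    rw [mem_compress_domain]
    refine (mem_domain_of_isSelfAdjoint hT (h := h - ContinuousLinearMap.adjoint K (P g))
      fun f => ?_).1
    obtain ⟨h1, h2⟩ := hK f
    have h3 := H ⟨f, hsub f f.2⟩
    rw [compress_apply _ h1, h2, map_add, hP.apply_apply, inner_add_right] at h3
    rw [inner_sub_left, ContinuousLinearMap.adjoint_inner_left, h3, hP.inner_apply g,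
      hP.inner_apply g, add_sub_cancel_right]

theorem mem_range_iff {P : L2 →L[ℂ] L2} (hP : IsStarProjection P) {f : L2} :
    f ∈ P.toLinearMap.range ↔ P f = f := by
  constructor
  · rintro ⟨g, rfl⟩
    exact hP.apply_apply g
  · intro h
    exact ⟨f, h⟩

theorem mem_range_orthogonal_iff {P : L2 →L[ℂ] L2} (hP : IsStarProjection P) {f : L2} :
    f ∈ (P.toLinearMap.range)ᗮ ↔ P f = 0 := by
  rw [Submodule.mem_orthogonal']
  constructor
  · intro h
    have := h (P (P f)) ⟨P f, rfl⟩
    rw [← hP.inner_apply, inner_self_eq_zero] at this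
    exact this
  · rintro h _ ⟨g, rfl⟩
    change inner ℂ f (P g) = 0
    rw [← hP.inner_apply, h, inner_zero_left]

theorem compress_domain {T : L2 →ₗ.[ℂ] L2} {P : L2 →L[ℂ] L2} (hP : IsStarProjection P) :
    (compress P T).domain = (T.domain ⊓ P.toLinearMap.range) ⊔ (P.toLinearMap.range)ᗮ := by
  ext f
  rw [mem_compress_domain, Submodule.mem_sup]
  constructor
  · intro h
    refine ⟨P f, ⟨h, ⟨f, rfl⟩⟩, f - P f, ?_, add_sub_cancel _ _⟩
    rw [mem_range_orthogonal_iff hP, map_sub, hP.apply_apply, sub_self]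
  · rintro ⟨g, ⟨hg, hg'⟩, h, hh, rfl⟩
    replace hg' := (mem_range_iff hP).1 hg'
    rw [mem_range_orthogonal_iff hP] at hh
    rwa [map_add, hg', hh, add_zero]

theorem HasCommutator.one_sub {T : L2 →ₗ.[ℂ] L2} {P K : L2 →L[ℂ] L2} (h : HasCommutator T P K) :
    HasCommutator T (1 - P) (-K) := by
  intro f
  obtain ⟨h1, h2⟩ := h f
  refine ⟨T.domain.sub_mem f.2 h1, ?_⟩
  have h3 : T (f - ⟨P f, h1⟩) = T f - T ⟨P f, h1⟩ := T.map_sub _ _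
  have h4 : (⟨(1 - P) f, T.domain.sub_mem f.2 h1⟩ : T.domain) = f - ⟨P f, h1⟩ := rfl
  rw [h4, h3, h2]
  simp only [sub_apply, one_apply_eq_self,
    neg_apply]
  abel

theorem HasCommutator.of_perturbation {X Xhat : L2 →ₗ.[ℂ] L2} {P K V : L2 →L[ℂ] L2}
    (h : HasCommutator X P K) (hdom : Xhat.domain = X.domain)
    (hV : ∀ f (h : f ∈ X.domain) (h' : f ∈ Xhat.domain), Xhat ⟨f, h'⟩ = X ⟨f, h⟩ + V f) :
    HasCommutator Xhat P (K + V ∘L P - P ∘L V) := by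
  rintro ⟨f, hf⟩
  obtain ⟨h1, h2⟩ := h ⟨f, hdom.le hf⟩
  refine ⟨hdom.ge h1, ?_⟩
  rw [hV _ h1, h2, hV f (hdom.le hf)]
  simp only [sub_apply, add_apply,
    ContinuousLinearMap.comp_apply, map_add]
  abel

/-! ### Resolvents of self-adjoint operators -/

/-- The resolvent identity. -/
theorem opResolvent_sub {T : L2 →ₗ.[ℂ] L2} {z w : ℂ} (hz : z ∉ opSpectrum T)
    (hw : w ∉ opSpectrum T) :
    opResolvent T z - opResolvent T w = (w - z) • (opResolvent T w * opResolvent T z) := by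
  ext1 f
  obtain ⟨h1, h2⟩ := (isResolventAt_opResolvent hz).1 f
  have h3 := (isResolventAt_opResolvent hw).2 ⟨_, h1⟩
  have h4 : T ⟨opResolvent T z f, h1⟩ = z • opResolvent T z f - f := by
    rw [eq_sub_iff_add_eq, ← eq_sub_iff_add_eq', h2]
  rw [h4] at h3
  change opResolvent T z f - opResolvent T w f = (w - z) • opResolvent T w (opResolvent T z f)
  simp only [map_sub, map_smul] at h3
  rw [sub_smul, ← sub_eq_zero]
  rw [← sub_eq_zero] at h3
  rw [← neg_eq_zero, ← h3]
  abel

theorem opResolvent_commute {T : L2 →ₗ.[ℂ] L2} {z w : ℂ} (hz : z ∉ opSpectrum T)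
    (hw : w ∉ opSpectrum T) : Commute (opResolvent T z) (opResolvent T w) := by
  by_cases hzw : z = w
  · rw [hzw]
  have h1 := opResolvent_sub hz hw
  have h2 := opResolvent_sub hw hz
  rw [← neg_sub, h1, ← neg_smul, neg_sub] at h2
  exact (smul_right_injective _ (sub_ne_zero.2 hzw) h2).symm

theorem star_opResolvent {T : L2 →ₗ.[ℂ] L2} (hT : IsSelfAdjoint T) {z : ℂ}
    (hz : z ∉ opSpectrum T) (hz' : (starRingEnd ℂ) z ∉ opSpectrum T) :
    star (opResolvent T z) = opResolvent T ((starRingEnd ℂ) z) := by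
  rw [ContinuousLinearMap.star_eq_adjoint]
  symm
  rw [ContinuousLinearMap.eq_adjoint_iff]
  intro f g
  obtain ⟨h1, h2⟩ := (isResolventAt_opResolvent hz).1 g
  obtain ⟨h3, h4⟩ := (isResolventAt_opResolvent hz').1 f
  have h5 := symm_of_isSelfAdjoint hT ⟨_, h3⟩ ⟨_, h1⟩
  calc inner ℂ (opResolvent T ((starRingEnd ℂ) z) f) g
      = inner ℂ (opResolvent T ((starRingEnd ℂ) z) f)
          (z • opResolvent T z g - T ⟨opResolvent T z g, h1⟩) := by rw [h2]
    _ = inner ℂ ((starRingEnd ℂ) z • opResolvent T ((starRingEnd ℂ) z) f -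
          T ⟨opResolvent T ((starRingEnd ℂ) z) f, h3⟩) (opResolvent T z g) := by
        rw [inner_sub_left, inner_sub_right, h5, inner_smul_left, inner_smul_right,
          Complex.conj_conj]
    _ = inner ℂ f (opResolvent T z g) := by rw [h4]

theorem conj_not_mem_opSpectrum {T : L2 →ₗ.[ℂ] L2} (hT : IsSelfAdjoint T) {z : ℂ}
    (hz : z ∉ opSpectrum T) : (starRingEnd ℂ) z ∉ opSpectrum T := by
  by_cases h : z.im = 0
  · rwa [Complex.conj_eq_iff_im.2 h]
  · refine not_mem_opSpectrum_of_im_ne_zero hT ?_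
    simpa using h

theorem isStarNormal_opResolvent {T : L2 →ₗ.[ℂ] L2} (hT : IsSelfAdjoint T) {z : ℂ}
    (hz : z ∉ opSpectrum T) : IsStarNormal (opResolvent T z) := by
  have hz' := conj_not_mem_opSpectrum hT hz
  refine ⟨?_⟩
  rw [star_opResolvent hT hz hz']
  exact opResolvent_commute hz' hz

/-- The nonzero points of the spectrum of `(z - T)⁻¹` are of the form `(z - x)⁻¹` with `x` in the
spectrum of `T`. -/
theorem mem_spectrum_opResolvent {T : L2 →ₗ.[ℂ] L2} {z : ℂ} (hz : z ∉ opSpectrum T) {t : ℂ}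
    (ht : t ∈ spectrum ℂ (opResolvent T z)) : t = 0 ∨ ∃ x ∈ opSpectrum T, t = (z - x)⁻¹ := by
  by_cases h0 : t = 0
  · exact Or.inl h0
  refine Or.inr ⟨z - t⁻¹, ?_, by rw [sub_sub_cancel, inv_inv]⟩
  by_contra hw
  revert ht
  rw [imp_false, spectrum.mem_iff, not_not]
  set w := z - t⁻¹ with hwdef
  have hzw : z - w = t⁻¹ := by rw [hwdef, sub_sub_cancel]
  have h1 := opResolvent_sub hw hz
  rw [hzw] at h1
  have h2 : opResolvent T z * opResolvent T w
      = t • (opResolvent T w - opResolvent T z) := by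
    rw [h1, smul_smul, mul_inv_cancel₀ h0, one_smul]
  rw [Algebra.algebraMap_eq_smul_one]
  have e1 : (t • 1 - opResolvent T z) * (t⁻¹ • (1 + t⁻¹ • opResolvent T w)) = 1 := by
    rw [mul_smul_comm, mul_add, sub_mul, sub_mul, mul_smul_comm, mul_smul_comm, mul_one, mul_one,
      smul_mul_assoc, one_mul, h2, smul_smul, smul_smul, inv_mul_cancel₀ h0, one_smul, one_smul]
    rw [sub_add_sub_comm, sub_eq_iff_eq_add.2 (_ : t • 1 + opResolvent T w
      = t • 1 + (opResolvent T z + (opResolvent T w - opResolvent T z))), smul_smul,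
      inv_mul_cancel₀ h0, one_smul]
    abel
  have e2 : (t⁻¹ • (1 + t⁻¹ • opResolvent T w)) * (t • 1 - opResolvent T z) = 1 := by
    have h3 : Commute (opResolvent T z) (1 + t⁻¹ • opResolvent T w) :=
      (Commute.one_right _).add_right ((opResolvent_commute hz hw).smul_right _)
    have h4 : Commute (t • 1 - opResolvent T z) (t⁻¹ • (1 + t⁻¹ • opResolvent T w)) :=
      (((Commute.one_left _).smul_left _).sub_left h3).smul_right _
    rw [← h4.eq, e1]
  exact ⟨⟨_, _, e1, e2⟩, rfl⟩

/-- The norm of the resolvent is at most the inverse distance to the spectrum, because the resolvent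
is normal and its norm is its spectral radius. -/
theorem norm_opResolvent_le {T : L2 →ₗ.[ℂ] L2} (hT : IsSelfAdjoint T) {z : ℂ}
    (hz : z ∉ opSpectrum T) {δ : ℝ} (hδ : 0 < δ) (h : ∀ x ∈ opSpectrum T, δ ≤ ‖z - x‖) :
    ‖opResolvent T z‖ ≤ 1 / δ := by
  have hn := isStarNormal_opResolvent hT hz
  have h1 := IsStarNormal.spectralRadius_eq_nnnorm (opResolvent T z)
  have h2 : spectralRadius ℂ (opResolvent T z) ≤ ENNReal.ofReal (1 / δ) := by
    refine iSup₂_le fun t ht => ?_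
    rw [← enorm_eq_nnnorm, ← ofReal_norm]
    refine ENNReal.ofReal_le_ofReal ?_
    rcases mem_spectrum_opResolvent hz ht with rfl | ⟨x, hx, rfl⟩
    · rw [norm_zero]
      positivity
    · rw [norm_inv, ← one_div]
      exact one_div_le_one_div_of_le hδ (h x hx)
  rw [h1] at h2
  have h3 : ENNReal.ofReal ‖opResolvent T z‖ ≤ ENNReal.ofReal (1 / δ) := by
    rw [← enorm_eq_nnnorm, ← ofReal_norm] at h2
    exact h2
  exact (ENNReal.ofReal_le_ofReal_iff (by positivity)).1 h3

theorem continuousOn_opResolvent {T : L2 →ₗ.[ℂ] L2} {s : Set ℂ} {M : ℝ}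
    (hs : ∀ z ∈ s, z ∉ opSpectrum T) (hM : ∀ z ∈ s, ‖opResolvent T z‖ ≤ M) :
    ContinuousOn (opResolvent T) s := by
  have hL : LipschitzOnWith (Real.toNNReal (M * M)) (opResolvent T) s := by
    refine LipschitzOnWith.of_dist_le_mul fun z hz w hw => ?_
    have hM0 : 0 ≤ M := (norm_nonneg _).trans (hM z hz)
    rw [dist_eq_norm, opResolvent_sub (hs z hz) (hs w hw), norm_smul, ← dist_eq_norm, dist_comm w,
      Real.coe_toNNReal _ (mul_nonneg hM0 hM0), mul_comm]
    refine mul_le_mul_of_nonneg_right ((norm_mul_le _ _).trans ?_) dist_nonneg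
    exact mul_le_mul (hM w hw) (hM z hz) (norm_nonneg _) hM0
  exact hL.continuousOn

/-! ### Contour integrals -/

theorem Contour.intervalIntegrable (Γ : Contour) {V : Type*} [NormedAddCommGroup V]
    [NormedSpace ℂ V] (i : Fin Γ.n) {G : ℝ → V} (hG : ContinuousOn G (Set.Icc 0 1)) :
    IntervalIntegrable (fun t => deriv (Γ.curve i) t • G t) volume 0 1 := by
  obtain ⟨K, hK⟩ := Γ.lipschitz i
  rw [intervalIntegrable_iff_integrableOn_Ioo_of_le zero_le_one]
  have hG' : IntegrableOn G (Set.Ioo 0 1) :=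
    (hG.integrableOn_Icc).mono_set Set.Ioo_subset_Icc_self
  refine Integrable.bdd_smul hG' (K : ℝ) (stronglyMeasurable_deriv _).aestronglyMeasurable ?_
  refine (ae_restrict_iff' measurableSet_Ioo).2 (Filter.Eventually.of_forall fun t ht => ?_)
  exact norm_deriv_le_of_lipschitzOn (Icc_mem_nhds ht.1 ht.2) hK

theorem Contour.continuousOn_comp (Γ : Contour) {V : Type*} [TopologicalSpace V] (i : Fin Γ.n)
    {F : ℂ → V} (hF : ContinuousOn F Γ.support) :
    ContinuousOn (fun t => F (Γ.curve i t)) (Set.Icc 0 1) := by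
  obtain ⟨K, hK⟩ := Γ.lipschitz i
  exact hF.comp hK.continuousOn fun t ht => Set.mem_iUnion.2 ⟨i, t, ht, rfl⟩

/-- Continuous linear maps commute with contour integrals. -/
theorem Contour.map_integral (Γ : Contour) {V W : Type*} [NormedAddCommGroup V] [NormedSpace ℂ V]
    [NormedAddCommGroup W] [NormedSpace ℂ W] [CompleteSpace V] [CompleteSpace W] (ℓ : V →L[ℂ] W)
    {F : ℂ → V} (hF : ContinuousOn F Γ.support) :
    ℓ (Γ.integral F) = Γ.integral fun z => ℓ (F z) := by
  rw [Contour.integral, Contour.integral, map_sum]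
  refine Finset.sum_congr rfl fun i _ => ?_
  rw [← ContinuousLinearMap.intervalIntegral_comp_comm ℓ
    (Γ.intervalIntegrable i (Γ.continuousOn_comp i hF))]
  simp only [map_smul]

theorem Contour.integral_congr (Γ : Contour) {V : Type*} [NormedAddCommGroup V] [NormedSpace ℂ V]
    {F G : ℂ → V} (h : ∀ z ∈ Γ.support, F z = G z) : Γ.integral F = Γ.integral G := by
  rw [Contour.integral, Contour.integral]
  refine Finset.sum_congr rfl fun i _ => intervalIntegral.integral_congr fun t ht => ?_
  rw [Set.uIcc_of_le zero_le_one] at ht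
  rw [h _ (Set.mem_iUnion.2 ⟨i, t, ht, rfl⟩)]

/-! ### Riesz projections -/

/-- The Riesz projection `(2πi)⁻¹ ∫_Γ (z - T)⁻¹ dz`. -/
def rieszProj (T : L2 →ₗ.[ℂ] L2) (Γ : Contour) : L2 →L[ℂ] L2 :=
  (2 * Real.pi * Complex.I : ℂ)⁻¹ • Γ.integral (opResolvent T)

/-- The contour `Γ` lies in the resolvent set of `T`, and the resolvent is bounded on it. -/
def Admissible (T : L2 →ₗ.[ℂ] L2) (Γ : Contour) : Prop :=
  (∀ z ∈ Γ.support, z ∉ opSpectrum T) ∧ ∃ M : ℝ, ∀ z ∈ Γ.support, ‖opResolvent T z‖ ≤ M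

theorem I_not_mem_opSpectrum {T : L2 →ₗ.[ℂ] L2} (hT : IsSelfAdjoint T) :
    Complex.I ∉ opSpectrum T :=
  not_mem_opSpectrum_of_im_ne_zero hT (by simp)

/-- The function that represents `(z - T)⁻¹` in the functional calculus of `(i - T)⁻¹`. -/
def resolventFun (z t : ℂ) : ℂ := t * (1 + (z - Complex.I) * t)⁻¹

theorem one_add_mul_ne_zero {T : L2 →ₗ.[ℂ] L2} (hT : IsSelfAdjoint T) {z : ℂ}
    (hz : z ∉ opSpectrum T) {t : ℂ} (ht : t ∈ spectrum ℂ (opResolvent T Complex.I)) :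
    1 + (z - Complex.I) * t ≠ 0 := by
  have hI := I_not_mem_opSpectrum hT
  rcases mem_spectrum_opResolvent hI ht with rfl | ⟨x, hx, rfl⟩
  · simp
  · have h1 : Complex.I - x ≠ 0 := by
      rintro h
      rw [← sub_eq_zero.1 h] at hx
      exact hI hx
    have h2 : z - x ≠ 0 := by
      rintro h
      rw [← sub_eq_zero.1 h] at hx
      exact hz hx
    have h3 : 1 + (z - Complex.I) * (Complex.I - x)⁻¹ = (z - x) * (Complex.I - x)⁻¹ := by
      field_simp
      ring
    rw [h3]
    exact mul_ne_zero h2 (inv_ne_zero h1)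

theorem continuousOn_resolventFun {T : L2 →ₗ.[ℂ] L2} (hT : IsSelfAdjoint T) {z : ℂ}
    (hz : z ∉ opSpectrum T) :
    ContinuousOn (resolventFun z) (spectrum ℂ (opResolvent T Complex.I)) := by
  unfold resolventFun
  exact continuousOn_id.mul (ContinuousOn.inv₀ (by fun_prop) fun t ht => one_add_mul_ne_zero hT hz ht)

theorem opResolvent_eq_cfc {T : L2 →ₗ.[ℂ] L2} (hT : IsSelfAdjoint T) {z : ℂ}
    (hz : z ∉ opSpectrum T) :
    cfc (resolventFun z) (opResolvent T Complex.I) = opResolvent T z := by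
  have hI := I_not_mem_opSpectrum hT
  have hn := isStarNormal_opResolvent hT hI
  set A := opResolvent T Complex.I with hA
  have hc : ContinuousOn (fun t : ℂ => (1 + (z - Complex.I) * t)⁻¹) (spectrum ℂ A) :=
    ContinuousOn.inv₀ (by fun_prop) fun t ht => one_add_mul_ne_zero hT hz ht
  have h1 : cfc (fun t : ℂ => 1 + (z - Complex.I) * t) A = 1 + (z - Complex.I) • A := by
    rw [cfc_add (a := A) (fun _ => 1) (fun t => (z - Complex.I) * t), cfc_const_one ℂ A,
      cfc_const_mul_id (z - Complex.I) A]
  have h2 : (1 + (z - Complex.I) • A) * cfc (fun t : ℂ => (1 + (z - Complex.I) * t)⁻¹) A = 1 := by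
    rw [← h1, ← cfc_mul _ _ _ (by fun_prop) hc, ← cfc_const_one ℂ A]
    exact cfc_congr fun t ht => mul_inv_cancel₀ (one_add_mul_ne_zero hT hz ht)
  have h3 : opResolvent T z * (1 + (z - Complex.I) • A) = A := by
    have := opResolvent_sub hI hz
    rw [mul_add, mul_one, mul_smul_comm, ← this, hA]
    abel
  have h4 : cfc (resolventFun z) A = A * cfc (fun t : ℂ => (1 + (z - Complex.I) * t)⁻¹) A := by
    unfold resolventFun
    rw [cfc_mul _ _ _ (by fun_prop) hc, cfc_id' ℂ A]
  rw [h4]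
  nth_rewrite 1 [← h3]
  rw [mul_assoc, h2, mul_one]

/-- In the functional calculus of `(i - T)⁻¹`, the Riesz projection of a contour `Γ` is represented
by the winding numbers of `Γ` about the points of the spectrum of `T`. -/
theorem exists_cfcHom_eq_rieszProj {T : L2 →ₗ.[ℂ] L2} (hT : IsSelfAdjoint T) {Γ : Contour}
    (hΓ : Admissible T Γ) (hn : IsStarNormal (opResolvent T Complex.I)) :
    ∃ g : C(spectrum ℂ (opResolvent T Complex.I), ℂ), cfcHom hn g = rieszProj T Γ ∧
      ∀ t : spectrum ℂ (opResolvent T Complex.I), ((t : ℂ) = 0 → g t = 0) ∧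
        ∀ x ∈ opSpectrum T, (t : ℂ) = (Complex.I - x)⁻¹ → g t = Γ.windingNumber x := by
  classical
  have hI := I_not_mem_opSpectrum hT
  obtain ⟨hΓ1, M, hM⟩ := hΓ
  set A := opResolvent T Complex.I with hA
  let φ : ℂ → C(spectrum ℂ A, ℂ) := fun z =>
    if hz : z ∉ opSpectrum T then ⟨_, (continuousOn_resolventFun hT hz).domRestrict⟩ else 0
  have hφ : ∀ z ∉ opSpectrum T, cfcHom hn (φ z) = opResolvent T z := by
    intro z hz
    rw [← opResolvent_eq_cfc hT hz, cfc_apply _ _ hn (continuousOn_resolventFun hT hz)]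
    simp only [φ, dif_pos hz]
    rfl
  have hφc : ContinuousOn φ Γ.support := by
    have h1 := continuousOn_opResolvent hΓ1 hM
    have h2 : Isometry (cfcHom (R := ℂ) hn) := isometry_cfcHom A hn
    rw [h2.isEmbedding.isInducing.continuousOn_iff]
    exact h1.congr fun z hz => hφ z (hΓ1 z hz)
  refine ⟨(2 * Real.pi * Complex.I : ℂ)⁻¹ • Γ.integral φ, ?_, fun t => ?_⟩
  · rw [map_smul, rieszProj]
    congr 1
    rw [Γ.integral_congr (fun z hz => (hφ z (hΓ1 z hz)).symm)]
    exact Γ.map_integral (V := C(spectrum ℂ A, ℂ)) (cfcL hn) hφc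
  · have h1 : (Γ.integral φ) t = Γ.integral fun z => φ z t :=
      Γ.map_integral (V := C(spectrum ℂ A, ℂ)) (ContinuousMap.evalCLM ℂ t) hφc
    have h2 : ∀ z ∈ Γ.support, φ z t = resolventFun z t := by
      intro z hz
      simp only [φ, dif_pos (hΓ1 z hz)]
      rfl
    rw [ContinuousMap.smul_apply, h1, Γ.integral_congr h2]
    constructor
    · intro ht
      have : ∀ z ∈ Γ.support, resolventFun z t = 0 := fun z _ => by
        rw [resolventFun, ht, zero_mul]
      rw [Γ.integral_congr this]
      simp [Contour.integral]
    · intro x hx ht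
      rw [Contour.windingNumber, smul_eq_mul]
      congr 1
      refine Γ.integral_congr fun z hz => ?_
      have h3 : Complex.I - x ≠ 0 := by
        rintro h
        rw [← sub_eq_zero.1 h] at hx
        exact hI hx
      have h4 : z - x ≠ 0 := by
        rintro h
        rw [← sub_eq_zero.1 h] at hx
        exact hΓ1 z hz hx
      have h5 : 1 + (z - Complex.I) * (Complex.I - x)⁻¹ = (z - x) * (Complex.I - x)⁻¹ := by
        field_simp
        ring
      rw [resolventFun, ht, h5]
      field_simp

/-- Riesz projections depend only on the winding numbers about the spectrum. No homology between the
contours is needed, as both projections are functions of `(i - T)⁻¹`. -/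
theorem rieszProj_eq_of_windingNumber_eq {T : L2 →ₗ.[ℂ] L2} (hT : IsSelfAdjoint T) {Γ Γ' : Contour}
    (hΓ : Admissible T Γ) (hΓ' : Admissible T Γ')
    (h : ∀ x ∈ opSpectrum T, Γ.windingNumber x = Γ'.windingNumber x) :
    rieszProj T Γ = rieszProj T Γ' := by
  have hI := I_not_mem_opSpectrum hT
  have hn := isStarNormal_opResolvent hT hI
  obtain ⟨g, hg, hg'⟩ := exists_cfcHom_eq_rieszProj hT hΓ hn
  obtain ⟨k, hk, hk'⟩ := exists_cfcHom_eq_rieszProj hT hΓ' hn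
  rw [← hg, ← hk]
  congr 1
  ext t
  rcases mem_spectrum_opResolvent hI t.2 with h0 | ⟨x, hx, h1⟩
  · rw [(hg' t).1 h0, (hk' t).1 h0]
  · rw [(hg' t).2 x hx h1, (hk' t).2 x hx h1, h x hx]

/-- A function with values in `{0, 1}` is a projection in the functional calculus. -/
theorem isStarProjection_rieszProj {T : L2 →ₗ.[ℂ] L2} (hT : IsSelfAdjoint T) {Γ : Contour}
    (hΓ : Admissible T Γ)
    (h : ∀ x ∈ opSpectrum T, Γ.windingNumber x = 0 ∨ Γ.windingNumber x = 1) :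
    IsStarProjection (rieszProj T Γ) := by
  have hI := I_not_mem_opSpectrum hT
  have hn := isStarNormal_opResolvent hT hI
  obtain ⟨g, hg, hg'⟩ := exists_cfcHom_eq_rieszProj hT hΓ hn
  have key : ∀ t, g t = 0 ∨ g t = 1 := by
    intro t
    rcases mem_spectrum_opResolvent hI t.2 with h0 | ⟨x, hx, h1⟩
    · exact Or.inl ((hg' t).1 h0)
    · rw [(hg' t).2 x hx h1]
      exact h x hx
  rw [← hg]
  refine ⟨?_, ?_⟩
  · rw [IsIdempotentElem, ← map_mul]
    congr 1
    ext t
    rw [ContinuousMap.mul_apply]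
    rcases key t with h0 | h0 <;> simp [h0]
  · rw [isSelfAdjoint_iff, ← map_star]
    congr 1
    ext t
    rw [ContinuousMap.star_apply]
    rcases key t with h0 | h0 <;> simp [h0]

theorem rieszProj_mul_eq_zero {T : L2 →ₗ.[ℂ] L2} (hT : IsSelfAdjoint T) {Γ Γ' : Contour}
    (hΓ : Admissible T Γ) (hΓ' : Admissible T Γ')
    (h : ∀ x ∈ opSpectrum T, Γ.windingNumber x = 0 ∨ Γ'.windingNumber x = 0) :
    rieszProj T Γ * rieszProj T Γ' = 0 := by
  have hI := I_not_mem_opSpectrum hT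
  have hn := isStarNormal_opResolvent hT hI
  obtain ⟨g, hg, hg'⟩ := exists_cfcHom_eq_rieszProj hT hΓ hn
  obtain ⟨k, hk, hk'⟩ := exists_cfcHom_eq_rieszProj hT hΓ' hn
  rw [← hg, ← hk, ← map_mul, ← map_zero (cfcHom (R := ℂ) hn)]
  congr 1
  ext t
  rw [ContinuousMap.mul_apply, ContinuousMap.zero_apply]
  rcases mem_spectrum_opResolvent hI t.2 with h0 | ⟨x, hx, h1⟩
  · rw [(hg' t).1 h0, zero_mul]
  · rw [(hg' t).2 x hx h1, (hk' t).2 x hx h1]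
    rcases h x hx with h2 | h2 <;> simp [h2]

/-- If `Γ` winds once around the spectrum of `T` in `{|i - x| < c⁻¹}`, then the Riesz projection of
`Γ` is the identity up to an error that `(i - T)⁻¹` maps to vectors of norm at most `c`. -/
theorem norm_opResolvent_sub_le {T : L2 →ₗ.[ℂ] L2} (hT : IsSelfAdjoint T) {Γ : Contour}
    (hΓ : Admissible T Γ) {c : ℝ} (hc : 0 ≤ c)
    (h : ∀ x ∈ opSpectrum T, Γ.windingNumber x = 1 ∨
      (Γ.windingNumber x = 0 ∧ ‖(Complex.I - x)⁻¹‖ ≤ c)) :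
    ‖opResolvent T Complex.I - opResolvent T Complex.I * rieszProj T Γ‖ ≤ c := by
  have hI := I_not_mem_opSpectrum hT
  have hn := isStarNormal_opResolvent hT hI
  obtain ⟨g, hg, hg'⟩ := exists_cfcHom_eq_rieszProj hT hΓ hn
  have h1 : opResolvent T Complex.I - opResolvent T Complex.I * rieszProj T Γ =
      cfcHom hn (ContinuousMap.restrict _ (ContinuousMap.id ℂ) -
        ContinuousMap.restrict _ (ContinuousMap.id ℂ) * g) := by
    rw [map_sub, map_mul, cfcHom_id, hg]
  rw [h1, norm_cfcHom _ _ hn, ContinuousMap.norm_le _ hc]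
  intro t
  change ‖(t : ℂ) - (t : ℂ) * g t‖ ≤ c
  rcases mem_spectrum_opResolvent hI t.2 with h0 | ⟨x, hx, h1⟩
  · rw [h0]
    simpa using hc
  · rw [(hg' t).2 x hx h1]
    rcases h x hx with h2 | ⟨h2, h3⟩
    · rw [h2]
      simpa using hc
    · rw [h2, h1, mul_zero, sub_zero]
      exact h3

theorem opResolvent_injective {T : L2 →ₗ.[ℂ] L2} {z : ℂ} (hz : z ∉ opSpectrum T) {f : L2}
    (hf : opResolvent T z f = 0) : f = 0 := by
  obtain ⟨h1, h2⟩ := (isResolventAt_opResolvent hz).1 f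
  have h3 : (⟨opResolvent T z f, h1⟩ : T.domain) = 0 := Subtype.ext hf
  rw [← h2, h3, LinearPMap.map_zero, hf, smul_zero, sub_zero]

theorem commute_rieszProj {T : L2 →ₗ.[ℂ] L2} {Γ : Contour} (hΓ : Admissible T Γ)
    {P : L2 →L[ℂ] L2} (hP : ∀ z ∉ opSpectrum T, Commute P (opResolvent T z)) :
    Commute P (rieszProj T Γ) := by
  obtain ⟨hΓ1, M, hM⟩ := hΓ
  have hc := continuousOn_opResolvent hΓ1 hM
  refine Commute.smul_right ?_ _
  have h1 := Γ.map_integral (ContinuousLinearMap.mul ℂ (L2 →L[ℂ] L2) P) hc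
  have h2 := Γ.map_integral ((ContinuousLinearMap.mul ℂ (L2 →L[ℂ] L2)).flip P) hc
  simp only [ContinuousLinearMap.mul_apply', ContinuousLinearMap.flip_apply] at h1 h2
  rw [Commute, SemiconjBy, h1, h2]
  exact Γ.integral_congr fun z hz => hP z (hΓ1 z hz)

/-! ### Integral operators -/

theorem eLpNorm_two_sq (g : Plane → ℂ) :
    eLpNorm g 2 (volume : Measure Plane) ^ 2 = ∫⁻ x, ‖g x‖ₑ ^ 2 := by
  rw [eLpNorm_eq_lintegral_rpow_enorm_toReal (by norm_num) (by norm_num), ← ENNReal.rpow_natCast,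
    ← ENNReal.rpow_mul]
  simp

theorem memLp_two_of_lintegral_lt {g : Plane → ℂ} (hg : AEStronglyMeasurable g volume)
    (h : ∫⁻ x, ‖g x‖ₑ ^ 2 < ⊤) : MemLp g 2 volume := by
  refine ⟨hg, ?_⟩
  rw [← eLpNorm_two_sq] at h
  exact (ENNReal.pow_lt_top_iff.1 h).resolve_right two_ne_zero

theorem ofReal_norm_sq (f : L2) : ENNReal.ofReal (‖f‖ ^ 2) = ∫⁻ x, ‖f x‖ₑ ^ 2 := by
  rw [← eLpNorm_two_sq, Lp.norm_def, ← ENNReal.toReal_pow, ENNReal.ofReal_toReal]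
  exact ENNReal.pow_ne_top (Lp.eLpNorm_ne_top f)

theorem norm_le_of_lintegral_le {f : L2} {C : ℝ} (hC : 0 ≤ C)
    (h : ∫⁻ x, ‖f x‖ₑ ^ 2 ≤ ENNReal.ofReal (C ^ 2)) : ‖f‖ ≤ C := by
  rw [← ofReal_norm_sq, ENNReal.ofReal_le_ofReal_iff (by positivity)] at h
  exact (pow_le_pow_iff_left₀ (norm_nonneg f) hC two_ne_zero).1 h

/-- The Cauchy–Schwarz inequality with a weight. -/
theorem lintegral_mul_sq_le {κ g : Plane → ENNReal} (hκ : AEMeasurable κ volume)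
    (hg : AEMeasurable g volume) :
    (∫⁻ x, κ x * g x) ^ 2 ≤ (∫⁻ x, κ x) * ∫⁻ x, κ x * g x ^ 2 := by
  have h := ENNReal.lintegral_mul_le_Lp_mul_Lq (volume : Measure Plane) Real.HolderConjugate.two_two
    (f := fun x => κ x ^ (1 / 2 : ℝ)) (g := fun x => κ x ^ (1 / 2 : ℝ) * g x)
    (hκ.pow_const _) ((hκ.pow_const _).mul hg)
  have e1 : ∀ x, κ x ^ (1 / 2 : ℝ) * κ x ^ (1 / 2 : ℝ) = κ x := fun x => by
    rw [← ENNReal.rpow_add_of_nonneg _ _ (by norm_num) (by norm_num)]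
    norm_num
  have e2 : ∀ t : ENNReal, (t ^ (1 / 2 : ℝ)) ^ 2 = t := fun t => by
    rw [← ENNReal.rpow_natCast, ← ENNReal.rpow_mul]
    norm_num
  have e3 : ∀ t : ENNReal, t ^ (2 : ℝ) = t ^ 2 := fun t => by
    rw [← ENNReal.rpow_natCast]
    norm_num
  simp only [Pi.mul_apply, ← mul_assoc, e1, e3, e2, mul_pow] at h
  calc (∫⁻ x, κ x * g x) ^ 2 ≤
      ((∫⁻ x, κ x) ^ (1 / 2 : ℝ) * (∫⁻ x, κ x * g x ^ 2) ^ (1 / 2 : ℝ)) ^ 2 :=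
        pow_le_pow_left' h 2
    _ = _ := by rw [mul_pow, e2, e2]

/-- Schur's test for kernels dominated by a convolution kernel. -/
theorem exists_integralOp {K : Plane × Plane → ℂ} {κ : Plane → ℝ}
    (hK : AEStronglyMeasurable K ((volume : Measure Plane).prod volume))
    (hκ : Integrable κ volume) (hκm : Measurable κ) (hκ0 : ∀ u, 0 ≤ κ u)
    (h : ∀ᵐ z ∂((volume : Measure Plane).prod volume), ‖K z‖ ≤ κ (z.1 - z.2)) :
    (∀ f : L2, ∀ᵐ x, Integrable (fun x' => K (x, x') * f x') volume) ∧
    ∃ A : L2 →L[ℂ] L2, ‖A‖ ≤ ∫ u, κ u ∧ ∀ f : L2, ∀ᵐ x, A f x = ∫ x', K (x, x') * f x' := by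
  set k : Plane → ENNReal := fun u => ENNReal.ofReal (κ u) with hk
  have hkm : Measurable k := hκm.ennreal_ofReal
  have hkI : ∫⁻ u, k u = ENNReal.ofReal (∫ u, κ u) :=
    (ofReal_integral_eq_lintegral_ofReal hκ (Filter.Eventually.of_forall hκ0)).symm
  have hI0 : 0 ≤ ∫ u, κ u := integral_nonneg hκ0
  have hae : ∀ᵐ x : Plane, ∀ᵐ x' : Plane, ‖K (x, x')‖ ≤ κ (x - x') := Measure.ae_ae_of_ae_prod h
  have hleft : ∀ x : Plane, ∫⁻ x', k (x - x') = ENNReal.ofReal (∫ u, κ u) := fun x => by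
    rw [lintegral_sub_left_eq_self k x, hkI]
  have hright : ∀ x' : Plane, ∫⁻ x, k (x - x') = ENNReal.ofReal (∫ u, κ u) := fun x' => by
    rw [lintegral_sub_right_eq_self k x', hkI]
  have hfm : ∀ f : L2, Measurable fun x => ‖f x‖ₑ := fun f => (Lp.stronglyMeasurable f).enorm
  have hkf : ∀ f : L2, ∫⁻ x, ∫⁻ x', k (x - x') * ‖f x'‖ₑ ^ 2 =
      ENNReal.ofReal (∫ u, κ u) * ENNReal.ofReal (‖f‖ ^ 2) := by
    intro f
    rw [lintegral_lintegral_swap]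
    · rw [ofReal_norm_sq, ← lintegral_const_mul _ ((hfm f).pow_const 2)]
      refine lintegral_congr fun x' => ?_
      rw [lintegral_mul_const _ (show Measurable fun x => k (x - x') from
        hkm.comp (measurable_id.sub_const x')), hright]
    · refine Measurable.aemeasurable ?_
      exact (hkm.comp (measurable_fst.sub measurable_snd)).mul
        (((hfm f).comp measurable_snd).pow_const 2)
  have hpt : ∀ f : L2, ∀ᵐ x, (∫⁻ x', ‖K (x, x') * f x'‖ₑ) ^ 2 ≤
      ENNReal.ofReal (∫ u, κ u) * ∫⁻ x', k (x - x') * ‖f x'‖ₑ ^ 2 := by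
    intro f
    filter_upwards [hae] with x hx
    calc (∫⁻ x', ‖K (x, x') * f x'‖ₑ) ^ 2 ≤ (∫⁻ x', k (x - x') * ‖f x'‖ₑ) ^ 2 := by
          refine pow_le_pow_left' (lintegral_mono_ae ?_) 2
          filter_upwards [hx] with x' hx'
          rw [enorm_mul]
          refine mul_le_mul_left ?_ _
          rw [← ofReal_norm]
          exact ENNReal.ofReal_le_ofReal hx'
      _ ≤ _ := by
          rw [← hleft x]
          exact lintegral_mul_sq_le (hkm.comp (measurable_id.const_sub x)).aemeasurable
            (hfm f).aemeasurable
  have htot : ∀ f : L2, ∫⁻ x, (∫⁻ x', ‖K (x, x') * f x'‖ₑ) ^ 2 ≤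
      ENNReal.ofReal (((∫ u, κ u) * ‖f‖) ^ 2) := by
    intro f
    refine (lintegral_mono_ae (hpt f)).trans ?_
    rw [lintegral_const_mul, hkf, ← mul_assoc, ← ENNReal.ofReal_mul hI0,
      ← ENNReal.ofReal_mul (mul_nonneg hI0 hI0), mul_pow, sq (∫ u, κ u)]
    refine Measurable.lintegral_prod_right' (f := fun z : Plane × Plane =>
      k (z.1 - z.2) * ‖f z.2‖ₑ ^ 2) ?_
    exact (hkm.comp (measurable_fst.sub measurable_snd)).mul
        (((hfm f).comp measurable_snd).pow_const 2)
  have hKf : ∀ f : L2, AEStronglyMeasurable (fun z : Plane × Plane => K z * f z.2)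
      ((volume : Measure Plane).prod volume) := fun f =>
    hK.mul (Lp.aestronglyMeasurable f).comp_snd
  have hint : ∀ f : L2, ∀ᵐ x, Integrable (fun x' => K (x, x') * f x') volume := by
    intro f
    have hfin : ∀ᵐ x : Plane, (∫⁻ x', k (x - x') * ‖f x'‖ₑ ^ 2) < ⊤ := by
      refine ae_lt_top' ?_ ?_
      · refine (Measurable.lintegral_prod_right' (f := fun z : Plane × Plane =>
          k (z.1 - z.2) * ‖f z.2‖ₑ ^ 2) ?_).aemeasurable
        exact (hkm.comp (measurable_fst.sub measurable_snd)).mul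
          (((hfm f).comp measurable_snd).pow_const 2)
      · rw [hkf]
        exact ENNReal.mul_ne_top ENNReal.ofReal_ne_top ENNReal.ofReal_ne_top
    filter_upwards [hpt f, hfin, (hKf f).prodMk_left] with x h1 h2 h3
    refine ⟨h3, ?_⟩
    have h4 : (∫⁻ x', ‖K (x, x') * f x'‖ₑ) ^ 2 < ⊤ :=
      h1.trans_lt (ENNReal.mul_lt_top ENNReal.ofReal_lt_top h2)
    exact (ENNReal.pow_lt_top_iff.1 h4).resolve_right two_ne_zero
  have hbd : ∀ f : L2, ∫⁻ x, ‖∫ x', K (x, x') * f x'‖ₑ ^ 2 ≤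
      ENNReal.ofReal (((∫ u, κ u) * ‖f‖) ^ 2) := fun f =>
    (lintegral_mono fun x => pow_le_pow_left' (enorm_integral_le_lintegral_enorm _) 2).trans (htot f)
  have hmem : ∀ f : L2, MemLp (fun x => ∫ x', K (x, x') * f x') 2 volume := fun f =>
    memLp_two_of_lintegral_lt (hKf f).integral_prod_right' ((hbd f).trans_lt ENNReal.ofReal_lt_top)
  refine ⟨hint, ?_⟩
  let A₀ : L2 →ₗ[ℂ] L2 :=
    { toFun := fun f => (hmem f).toLp _
      map_add' := by
        intro f g
        refine Lp.ext ?_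
        filter_upwards [(hmem (f + g)).coeFn_toLp, (hmem f).coeFn_toLp, (hmem g).coeFn_toLp,
          Lp.coeFn_add ((hmem f).toLp _) ((hmem g).toLp _), hint f, hint g]
          with x h1 h2 h3 h4 h5 h6
        rw [h1, h4, Pi.add_apply, h2, h3, ← integral_add h5 h6]
        refine integral_congr_ae ?_
        filter_upwards [Lp.coeFn_add f g] with x' h7
        rw [h7, Pi.add_apply, mul_add]
      map_smul' := by
        intro c f
        refine Lp.ext ?_
        filter_upwards [(hmem (c • f)).coeFn_toLp, (hmem f).coeFn_toLp,
          Lp.coeFn_smul c ((hmem f).toLp _)] with x h1 h2 h3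
        rw [h1, RingHom.id_apply, h3, Pi.smul_apply, h2, smul_eq_mul, ← integral_const_mul]
        refine integral_congr_ae ?_
        filter_upwards [Lp.coeFn_smul c f] with x' h7
        rw [h7, Pi.smul_apply, smul_eq_mul]
        ring }
  have hA₀ : ∀ f, ‖A₀ f‖ ≤ (∫ u, κ u) * ‖f‖ := by
    intro f
    refine norm_le_of_lintegral_le (by positivity) ?_
    refine le_trans (le_of_eq (lintegral_congr_ae ?_)) (hbd f)
    filter_upwards [(hmem f).coeFn_toLp] with x hx
    change ‖(hmem f).toLp _ x‖ₑ ^ 2 = _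
    rw [hx]
  refine ⟨A₀.mkContinuous _ hA₀, A₀.mkContinuous_norm_le hI0 hA₀, fun f => ?_⟩
  exact (hmem f).coeFn_toLp

/-! ### Exponentially localized kernels -/

theorem exp_neg_mul_le {γ : ℝ} (hγ : 0 < γ) (r : ℝ) : r * Real.exp (-γ * r) ≤ 1 / γ := by
  have h1 := Real.add_one_le_exp (γ * r)
  have h2 : γ * r * Real.exp (-γ * r) ≤ 1 := by
    rw [neg_mul, Real.exp_neg, ← div_eq_mul_inv, div_le_one (Real.exp_pos _)]
    linarith
  rw [le_div_iff₀ hγ]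
  linarith

theorem integrable_exp_neg_norm {γ : ℝ} (hγ : 0 < γ) :
    Integrable (fun u : Plane => Real.exp (-γ * ‖u‖)) volume := by
  have hdim : (Module.finrank ℝ Plane : ℝ) < 3 := by
    rw [finrank_euclideanSpace, Fintype.card_fin]
    norm_num
  have h1 := (integrable_one_add_norm (E := Plane) (μ := volume) hdim).const_mul
    ((3 / γ) ^ 3 * Real.exp γ)
  refine h1.mono' (by fun_prop) (Filter.Eventually.of_forall fun u => ?_)
  rw [Real.norm_of_nonneg (Real.exp_pos _).le]
  have hpos : 0 < 1 + ‖u‖ := by positivity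
  have h2 := exp_neg_mul_le (γ := γ / 3) (by positivity) (1 + ‖u‖)
  have h3 : ((1 + ‖u‖) * Real.exp (-(γ / 3) * (1 + ‖u‖))) ^ 3 ≤ (1 / (γ / 3)) ^ 3 :=
    pow_le_pow_left₀ (by positivity) h2 3
  rw [mul_pow, ← Real.exp_nat_mul] at h3
  have h4 : Real.exp (-γ * ‖u‖) = Real.exp γ * Real.exp ((3 : ℕ) * (-(γ / 3) * (1 + ‖u‖))) := by
    rw [← Real.exp_add]
    congr 1
    push_cast
    ring
  rw [Real.rpow_neg hpos.le, h4]
  have h5 : (1 + ‖u‖) ^ (3 : ℝ) = (1 + ‖u‖) ^ 3 := by norm_cast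
  rw [h5, ← div_eq_mul_inv, le_div_iff₀ (by positivity)]
  have h6 : (1 / (γ / 3)) = 3 / γ := by field_simp
  rw [h6] at h3
  nlinarith [Real.exp_pos γ]

/-- The integral of `e^{-γ|u|}` over the plane. -/
def expInt (γ : ℝ) : ℝ := ∫ u : Plane, Real.exp (-γ * ‖u‖)

theorem expInt_nonneg (γ : ℝ) : 0 ≤ expInt γ := integral_nonneg fun _ => (Real.exp_pos _).le

/-- Schur's test for exponentially localized kernels. -/
theorem exists_expKernelOp {K : Plane × Plane → ℂ} {C γ : ℝ} (hC : 0 ≤ C) (hγ : 0 < γ)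
    (hK : AEStronglyMeasurable K ((volume : Measure Plane).prod volume))
    (h : ∀ᵐ z ∂((volume : Measure Plane).prod volume),
      ‖K z‖ ≤ C * Real.exp (-γ * ‖z.1 - z.2‖)) :
    (∀ f : L2, ∀ᵐ x, Integrable (fun x' => K (x, x') * f x') volume) ∧
    ∃ A : L2 →L[ℂ] L2, ‖A‖ ≤ C * expInt γ ∧ HasExpKernel A C γ ∧
      ∀ f : L2, ∀ᵐ x, A f x = ∫ x', K (x, x') * f x' := by
  obtain ⟨h1, A, h2, h3⟩ := exists_integralOp (κ := fun u => C * Real.exp (-γ * ‖u‖)) hK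
    ((integrable_exp_neg_norm hγ).const_mul C) (by fun_prop)
    (fun u => mul_nonneg hC (Real.exp_pos _).le) h
  refine ⟨h1, A, ?_, ⟨K, hK, h, h3⟩, h3⟩
  rwa [integral_const_mul] at h2

theorem HasExpKernel.norm_le {A : L2 →L[ℂ] L2} {C γ : ℝ} (hA : HasExpKernel A C γ) (hC : 0 ≤ C)
    (hγ : 0 < γ) : ‖A‖ ≤ C * expInt γ := by
  obtain ⟨K, hK, hKb, hKA⟩ := hA
  obtain ⟨-, B, hB, -, hKB⟩ := exists_expKernelOp hC hγ hK hKb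
  have : A = B := by
    ext1 f
    refine Lp.ext ?_
    filter_upwards [hKA f, hKB f] with x h1 h2
    rw [h1, h2]
  rwa [this]

theorem HasExpKernel.mono {A : L2 →L[ℂ] L2} {C C' γ γ' : ℝ} (hA : HasExpKernel A C γ)
    (hC : 0 ≤ C) (hCC : C ≤ C') (hγ : γ' ≤ γ) : HasExpKernel A C' γ' := by
  obtain ⟨K, hK, hKb, hKA⟩ := hA
  refine ⟨K, hK, ?_, hKA⟩
  filter_upwards [hKb] with z hz
  refine hz.trans (mul_le_mul hCC (Real.exp_le_exp.2 ?_) (Real.exp_pos _).le (hC.trans hCC))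
  nlinarith [norm_nonneg (z.1 - z.2)]

theorem HasExpKernel.add {A B : L2 →L[ℂ] L2} {C D γ : ℝ} (hA : HasExpKernel A C γ)
    (hB : HasExpKernel B D γ) (hC : 0 ≤ C) (hD : 0 ≤ D) (hγ : 0 < γ) :
    HasExpKernel (A + B) (C + D) γ := by
  obtain ⟨K, hK, hKb, hKA⟩ := hA
  obtain ⟨L, hL, hLb, hLB⟩ := hB
  obtain ⟨iK, -⟩ := exists_expKernelOp hC hγ hK hKb
  obtain ⟨iL, -⟩ := exists_expKernelOp hD hγ hL hLb
  refine ⟨K + L, hK.add hL, ?_, fun f => ?_⟩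
  · filter_upwards [hKb, hLb] with z h1 h2
    rw [Pi.add_apply, add_mul]
    exact (norm_add_le _ _).trans (add_le_add h1 h2)
  · filter_upwards [hKA f, hLB f, iK f, iL f, Lp.coeFn_add (A f) (B f)] with x h1 h2 h3 h4 h5
    change (A f + B f : L2) x = _
    rw [h5, Pi.add_apply, h1, h2, ← integral_add h3 h4]
    simp only [Pi.add_apply, add_mul]

theorem abs_coord_le (i : Fin 2) (u : Plane) : |u i| ≤ ‖u‖ := by
  simpa using PiLp.norm_apply_le u i

/-- The commutator of a coordinate with an operator with an exponentially localized kernel again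
has an exponentially localized kernel. -/
theorem HasExpKernel.exists_commutator {A : L2 →L[ℂ] L2} {C γ : ℝ} (hA : HasExpKernel A C γ)
    (hC : 0 ≤ C) (hγ : 0 < γ) (i : Fin 2) :
    ∃ K : L2 →L[ℂ] L2, HasExpKernel K (C * (2 / γ)) (γ / 2) ∧
      ∀ w : Plane → ℝ, (∀ x y, w x - w y = x i - y i) → HasCommutator (mulOp w) A K := by
  obtain ⟨K, hK, hKb, hKA⟩ := hA
  obtain ⟨iK, -⟩ := exists_expKernelOp hC hγ hK hKb
  obtain ⟨iL, B, -, hB, hLB⟩ := exists_expKernelOp (C := C * (2 / γ)) (γ := γ / 2) (by positivity)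
    (by positivity) (K := fun z => ((z.1 i - z.2 i : ℝ) : ℂ) * K z) (by
      refine AEStronglyMeasurable.mul (Continuous.aestronglyMeasurable ?_) hK
      fun_prop) (by
      filter_upwards [hKb] with z hz
      rw [norm_mul, Complex.norm_real, Real.norm_eq_abs]
      have h1 := abs_coord_le i (z.1 - z.2)
      have h2 := exp_neg_mul_le (γ := γ / 2) (by positivity) ‖z.1 - z.2‖
      have h3 : Real.exp (-γ * ‖z.1 - z.2‖) =
          Real.exp (-(γ / 2) * ‖z.1 - z.2‖) * Real.exp (-(γ / 2) * ‖z.1 - z.2‖) := by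
        rw [← Real.exp_add]
        congr 1
        ring
      have h4 : (1 / (γ / 2)) = 2 / γ := by field_simp
      rw [h4] at h2
      calc |z.1 i - z.2 i| * ‖K z‖ ≤ ‖z.1 - z.2‖ * (C * Real.exp (-γ * ‖z.1 - z.2‖)) :=
            mul_le_mul h1 hz (norm_nonneg _) (norm_nonneg _)
        _ = C * (‖z.1 - z.2‖ * Real.exp (-(γ / 2) * ‖z.1 - z.2‖)) *
              Real.exp (-(γ / 2) * ‖z.1 - z.2‖) := by rw [h3]; ring
        _ ≤ _ := by gcongr)
  refine ⟨B, hB, fun w hw f => ?_⟩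
  have key : (fun x => (w x : ℂ) * A f x) =ᵐ[volume]
      ((A (mulOp w f) + B f : L2) : Plane → ℂ) := by
    filter_upwards [hKA f, hKA (mulOp w f), hLB f, iK (mulOp w f), iL f,
      Lp.coeFn_add (A (mulOp w f)) (B f)] with x h1 h2 h3 h4 h5 h6
    rw [h1, h6, Pi.add_apply, h2, h3, ← integral_add h4 h5, ← integral_const_mul]
    refine integral_congr_ae ?_
    filter_upwards [mulOp_coe f] with x' h7
    rw [h7, ← hw]
    push_cast
    ring
  exact mem_mulOp_domain_of_ae key

/-! ### Exponential tilts of integral operators -/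

/-- Multiplication by the bounded function `e^{-sρ}`. -/
def expMul (s : ℝ) (ρ : Plane → ℝ) : L2 →L[ℂ] L2 := bmul fun x => (Real.exp (-s * ρ x) : ℂ)

theorem bddMeas_exp {s : ℝ} {ρ : Plane → ℝ} (hρ : Measurable ρ) (h : ∀ x, 0 ≤ s * ρ x) :
    BddMeas fun x => (Real.exp (-s * ρ x) : ℂ) := by
  refine ⟨by fun_prop, 1, fun x => ?_⟩
  rw [Complex.norm_real, Real.norm_of_nonneg (Real.exp_pos _).le, Real.exp_le_one_iff, neg_mul]
  exact neg_nonpos.2 (h x)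

theorem abs_exp_sub_one_le (t : ℝ) : |Real.exp t - 1| ≤ |t| * Real.exp |t| := by
  have h1 : Real.exp |t| - 1 ≤ |t| * Real.exp |t| := by
    have h2 := Real.add_one_le_exp (-|t|)
    have h3 : Real.exp (-|t|) * Real.exp |t| = 1 := by rw [← Real.exp_add]; simp
    nlinarith [Real.exp_pos |t|]
  refine le_trans ?_ h1
  rcases le_total 0 t with ht | ht
  · rw [abs_of_nonneg ht, abs_of_nonneg]
    have := Real.add_one_le_exp t
    linarith
  · rw [abs_of_nonpos ht, abs_of_nonpos]
    · have h2 := Real.add_one_le_exp t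
      have h3 := Real.add_one_le_exp (-t)
      have h4 : Real.exp t * Real.exp (-t) = 1 := by rw [← Real.exp_add]; simp
      nlinarith [Real.exp_pos t, Real.exp_pos (-t), sq_nonneg (Real.exp t - 1)]
    · rw [sub_nonpos, Real.exp_le_one_iff]
      exact ht

/-- Conjugating an operator with an exponentially localized kernel by `e^{sρ}`, where `ρ` is
1-Lipschitz, changes it by `O(s)`. -/
theorem HasExpKernel.exists_tilt {A : L2 →L[ℂ] L2} {C γ : ℝ} (hA : HasExpKernel A C γ) (hC : 0 ≤ C)
    (hγ : 0 < γ) {ρ : Plane → ℝ} (hρ : Measurable ρ) (hρ0 : ∀ x, 0 ≤ ρ x)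
    (hρL : ∀ x y, |ρ x - ρ y| ≤ ‖x - y‖) {s : ℝ} (hs : 0 ≤ s) (hsγ : s ≤ γ / 2) :
    ∃ A' : L2 →L[ℂ] L2, A ∘L expMul s ρ = expMul s ρ ∘L A' ∧
      ‖A' - A‖ ≤ C * (4 / γ) * expInt (γ / 4) * s := by
  obtain ⟨K, hK, hKb, hKA⟩ := hA
  obtain ⟨iK, -⟩ := exists_expKernelOp hC hγ hK hKb
  obtain ⟨iL, B, hBn, -, hLB⟩ := exists_expKernelOp (C := C * (4 / γ) * s) (γ := γ / 4)
    (by positivity) (by positivity)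
    (K := fun z => ((Real.exp (s * (ρ z.1 - ρ z.2)) - 1 : ℝ) : ℂ) * K z) (by
      refine AEStronglyMeasurable.mul (Measurable.aestronglyMeasurable ?_) hK
      fun_prop) (by
      filter_upwards [hKb] with z hz
      rw [norm_mul, Complex.norm_real, Real.norm_eq_abs]
      set r := ‖z.1 - z.2‖
      have hr0 : 0 ≤ r := norm_nonneg _
      have h1 : |s * (ρ z.1 - ρ z.2)| ≤ s * r := by
        rw [abs_mul, abs_of_nonneg hs]
        exact mul_le_mul_of_nonneg_left (hρL _ _) hs
      have h2 := abs_exp_sub_one_le (s * (ρ z.1 - ρ z.2))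
      have h3 : |Real.exp (s * (ρ z.1 - ρ z.2)) - 1| ≤ s * r * Real.exp (γ / 2 * r) := by
        refine h2.trans (mul_le_mul h1 (Real.exp_le_exp.2 (h1.trans ?_)) (Real.exp_pos _).le
          (by positivity))
        exact mul_le_mul_of_nonneg_right hsγ hr0
      have h4 := exp_neg_mul_le (γ := γ / 4) (by positivity) r
      have h5 : Real.exp (γ / 2 * r) * Real.exp (-γ * r) =
          Real.exp (-(γ / 4) * r) * Real.exp (-(γ / 4) * r) := by
        rw [← Real.exp_add, ← Real.exp_add]
        congr 1
        ring
      have h6 : (1 / (γ / 4)) = 4 / γ := by field_simp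
      rw [h6] at h4
      calc |Real.exp (s * (ρ z.1 - ρ z.2)) - 1| * ‖K z‖
          ≤ (s * r * Real.exp (γ / 2 * r)) * (C * Real.exp (-γ * r)) :=
            mul_le_mul h3 hz (norm_nonneg _) (by positivity)
        _ = C * (r * Real.exp (-(γ / 4) * r)) * s * Real.exp (-(γ / 4) * r) := by
            linear_combination (s * r * C) * h5
        _ ≤ _ := by gcongr)
  refine ⟨A + B, ?_, ?_⟩
  · have hb : BddMeas fun x => (Real.exp (-s * ρ x) : ℂ) :=
      bddMeas_exp hρ fun x => mul_nonneg hs (hρ0 x)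
    ext1 f
    refine Lp.ext ?_
    rw [ContinuousLinearMap.comp_apply, ContinuousLinearMap.comp_apply]
    filter_upwards [hKA (expMul s ρ f), bmul_coe hb ((A + B) f), hKA f, hLB f, iK f, iL f,
      Lp.coeFn_add (A f) (B f)] with x h1 h2 h3 h4 h5 h6 h7
    have h8 : ((A + B) f : L2) x = A f x + B f x := h7
    rw [h1, expMul, h2, h8, h3, h4, ← integral_add h5 h6, ← integral_const_mul]
    refine integral_congr_ae ?_
    filter_upwards [bmul_coe hb f] with x' h9
    rw [h9]
    have h10 : (Real.exp (-s * ρ x') : ℂ) =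
        (Real.exp (-s * ρ x) : ℂ) * (Real.exp (s * (ρ x - ρ x')) : ℂ) := by
      rw [← Complex.ofReal_mul, ← Real.exp_add]
      congr 2
      ring
    rw [h10]
    push_cast
    ring
  · rw [add_sub_cancel_left]
    refine hBn.trans (le_of_eq ?_)
    ring

/-! ### The weight -/

theorem weight_eq (a x : Plane) : weight a x = Real.sqrt (1 + ‖x - a‖ ^ 2) := by
  rw [weight, EuclideanSpace.norm_eq, Real.sq_sqrt (by positivity), Fin.sum_univ_two]
  simp [add_assoc]

theorem norm_sub_le_weight (a x : Plane) : ‖x - a‖ ≤ weight a x := by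
  rw [weight_eq]
  exact Real.le_sqrt_of_sq_le (by linarith)

theorem weight_nonneg (a x : Plane) : 0 ≤ weight a x := Real.sqrt_nonneg _

theorem weight_le (a x : Plane) : weight a x ≤ 1 + ‖x - a‖ := by
  rw [weight_eq]
  exact Real.sqrt_le_iff.2 ⟨by positivity, by nlinarith [norm_nonneg (x - a)]⟩

theorem measurable_weight (a : Plane) : Measurable (weight a) := by
  unfold weight
  fun_prop

theorem weight_sub_le (a x y : Plane) : weight a x - weight a y ≤ ‖x - y‖ := by
  rw [sub_le_iff_le_add, weight_eq, weight_eq]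
  have h1 : ‖x - a‖ ≤ ‖x - y‖ + ‖y - a‖ := norm_sub_le_norm_sub_add_norm_sub x y a
  have h2 : ‖y - a‖ ≤ Real.sqrt (1 + ‖y - a‖ ^ 2) := Real.le_sqrt_of_sq_le (by linarith)
  have h3 : Real.sqrt (1 + ‖y - a‖ ^ 2) ^ 2 = 1 + ‖y - a‖ ^ 2 := Real.sq_sqrt (by positivity)
  refine Real.sqrt_le_iff.2 ⟨by positivity, ?_⟩
  nlinarith [norm_nonneg (x - a), norm_nonneg (x - y), norm_nonneg (y - a),
    mul_le_mul_of_nonneg_left h2 (norm_nonneg (x - y))]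

theorem abs_weight_sub_le (a x y : Plane) : |weight a x - weight a y| ≤ ‖x - y‖ := by
  rw [abs_sub_le_iff]
  exact ⟨weight_sub_le a x y, by rw [norm_sub_rev]; exact weight_sub_le a y x⟩

theorem bddMeas_exp_weight {s : ℝ} (hs : 0 ≤ s) (a : Plane) :
    BddMeas fun x => (Real.exp (-s * weight a x) : ℂ) :=
  bddMeas_exp (measurable_weight a) fun x => mul_nonneg hs (weight_nonneg a x)

theorem expMul_injective {s : ℝ} {ρ : Plane → ℝ}
    (hb : BddMeas fun x => (Real.exp (-s * ρ x) : ℂ)) : Function.Injective (expMul s ρ) :=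
  bmul_injective hb fun _ => Complex.ofReal_ne_zero.2 (Real.exp_pos _).ne'

/-! ### Separability -/

/-- The balls of radius `1 / 2` about the vectors are disjoint and open. -/
theorem _root_.Orthonormal.countable_of_separableSpace {ι E : Type*} [NormedAddCommGroup E]
    [InnerProductSpace ℂ E] [TopologicalSpace.SeparableSpace E] {v : ι → E}
    (hv : Orthonormal ℂ v) : Countable ι := by
  have hd : ∀ i j, i ≠ j → 1 ≤ dist (v i) (v j) := by
    intro i j hij
    have h1 : ‖v i - v j‖ ^ 2 = 2 := by
      rw [@norm_sub_sq ℂ, hv.2 hij, hv.1 i, hv.1 j]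
      norm_num
    rw [dist_eq_norm]
    nlinarith [norm_nonneg (v i - v j)]
  have hp : Set.PairwiseDisjoint Set.univ fun i => Metric.ball (v i) (1 / 2) := by
    intro i _ j _ hij
    refine Metric.ball_disjoint_ball ?_
    have := hd i j hij
    linarith
  have := hp.countable_of_isOpen (fun i _ => Metric.isOpen_ball)
    (fun i _ => ⟨v i, Metric.mem_ball_self (by norm_num)⟩)
  exact Set.countable_univ_iff.1 this

instance : Fact ((2 : ENNReal) ≠ ⊤) := ⟨by norm_num⟩

/-- The Pettis measurability theorem, for `L²`. -/
theorem aestronglyMeasurable_of_inner {u : Plane → L2}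
    (h : ∀ g : L2, AEStronglyMeasurable (fun x => inner ℂ (u x) g) volume) :
    AEStronglyMeasurable u volume := by
  obtain ⟨w, b, hb⟩ := exists_hilbertBasis ℂ L2
  have hw : Countable w := b.orthonormal.countable_of_separableSpace
  refine aestronglyMeasurable_of_tendsto_ae (Filter.atTop : Filter (Finset w))
    (f := fun s x => ∑ i ∈ s, b.repr (u x) i • b i) (fun s => ?_)
    (Filter.Eventually.of_forall fun x => b.hasSum_repr (u x))
  refine Finset.aestronglyMeasurable_fun_sum _ fun i _ => ?_
  refine AEStronglyMeasurable.smul_const ?_ _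
  simp only [HilbertBasis.repr_apply_apply]
  simp_rw [← inner_conj_symm (b i)]
  exact Complex.continuous_conj.comp_aestronglyMeasurable (h _)

/-! ### Kernels from bounds on tilted operators -/

theorem lintegral_exp_sq {c γ : ℝ} (hγ : 0 < γ) (x : Plane) :
    ∫⁻ y, ENNReal.ofReal ((c * Real.exp (-(γ / 2) * ‖x - y‖)) ^ 2) =
      ENNReal.ofReal (c ^ 2 * expInt γ) := by
  have e : ∀ u : Plane, (c * Real.exp (-(γ / 2) * ‖u‖)) ^ 2 = c ^ 2 * Real.exp (-γ * ‖u‖) := by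
    intro u
    rw [mul_pow, ← Real.exp_nat_mul]
    congr 2
    push_cast
    ring
  rw [lintegral_sub_left_eq_self
    (fun u : Plane => ENNReal.ofReal ((c * Real.exp (-(γ / 2) * ‖u‖)) ^ 2)) x]
  simp_rw [e]
  rw [← ofReal_integral_eq_lintegral_ofReal ((integrable_exp_neg_norm hγ).const_mul _)
    (Filter.Eventually.of_forall fun u => by positivity), integral_const_mul, expInt]

theorem lintegral_sq_le_of_exp_bound {f : Plane → ℂ} {c γ : ℝ} (hγ : 0 < γ) (x : Plane)
    (h : ∀ᵐ y, ‖f y‖ ≤ c * Real.exp (-(γ / 2) * ‖x - y‖)) :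
    ∫⁻ y, ‖f y‖ₑ ^ 2 ≤ ENNReal.ofReal (c ^ 2 * expInt γ) := by
  rw [← lintegral_exp_sq hγ x]
  refine lintegral_mono_ae ?_
  filter_upwards [h] with y hy
  rw [← ofReal_norm, ← ENNReal.ofReal_pow (norm_nonneg _)]
  exact ENNReal.ofReal_le_ofReal (pow_le_pow_left₀ (norm_nonneg _) hy 2)

theorem norm_le_of_exp_bound {f : L2} {c γ : ℝ} (hc : 0 ≤ c) (hγ : 0 < γ) (x : Plane)
    (h : ∀ᵐ y, ‖f y‖ ≤ c * Real.exp (-(γ / 2) * ‖x - y‖)) :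
    ‖f‖ ≤ c * Real.sqrt (expInt γ) := by
  refine norm_le_of_lintegral_le (by positivity) ?_
  rw [mul_pow, Real.sq_sqrt (expInt_nonneg γ)]
  exact lintegral_sq_le_of_exp_bound hγ x h

/-- An operator with an exponentially localized kernel is given by the inner products with a
measurable family of exponentially localized functions. -/
theorem HasExpKernel.exists_sections {U : L2 →L[ℂ] L2} {C γ : ℝ} (hU : HasExpKernel U C γ)
    (hγ : 0 < γ) :
    ∃ u : Plane → L2, AEStronglyMeasurable u volume ∧
      (∀ g : L2, ∀ᵐ x, U g x = inner ℂ (u x) g) ∧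
      ∀ᵐ x, ∀ᵐ y, ‖u x y‖ ≤ C * Real.exp (-γ * ‖x - y‖) := by
  classical
  obtain ⟨K, hK, hKb, hKU⟩ := hU
  let k : Plane → Plane → ℂ := fun x y => (starRingEnd ℂ) (K (x, y))
  have hkb : ∀ᵐ x, ∀ᵐ y, ‖k x y‖ ≤ C * Real.exp (-γ * ‖x - y‖) := by
    filter_upwards [Measure.ae_ae_of_ae_prod hKb] with x hx
    filter_upwards [hx] with y hy
    simpa [k] using hy
  have hmem : ∀ᵐ x, MemLp (k x) 2 volume := by
    filter_upwards [hkb, hK.prodMk_left] with x h1 h2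
    refine memLp_two_of_lintegral_lt (Complex.continuous_conj.comp_aestronglyMeasurable h2)
      ((lintegral_sq_le_of_exp_bound (c := C) (γ := 2 * γ) (by positivity) x ?_).trans_lt
        ENNReal.ofReal_lt_top)
    filter_upwards [h1] with y hy
    rwa [mul_div_cancel_left₀ _ two_ne_zero]
  let u : Plane → L2 := fun x => if h : MemLp (k x) 2 volume then h.toLp _ else 0
  have hu : ∀ᵐ x, u x =ᵐ[volume] k x := by
    filter_upwards [hmem] with x hx
    simp only [u, dif_pos hx]
    exact hx.coeFn_toLp
  have hUu : ∀ g : L2, ∀ᵐ x, U g x = inner ℂ (u x) g := by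
    intro g
    filter_upwards [hKU g, hu] with x h1 h2
    rw [h1, L2.inner_def]
    refine integral_congr_ae ?_
    filter_upwards [h2] with y hy
    rw [hy, RCLike.inner_apply, Complex.conj_conj, mul_comm]
  refine ⟨u, aestronglyMeasurable_of_inner fun g => ?_, hUu, ?_⟩
  · exact (Lp.aestronglyMeasurable (U g)).congr (hUu g)
  · filter_upwards [hu, hkb] with x h1 h2
    filter_upwards [h1, h2] with y h3 h4
    rwa [h3]

/-- Let `U` and `V` have exponentially localized kernels, and let `B` be a bounded operator such
that `e^{sw} B e^{-sw}` is bounded, uniformly in the center of the weight `w`. Then `U B V*` has an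
exponentially localized kernel: its value at `(x, x')` is the matrix element of `B` between the
sections of the kernels of `U` and `V`, and the bound follows with a weight centered at `x'`. -/
theorem hasExpKernel_of_tilts {U V B : L2 →L[ℂ] L2} {C₁ C₂ γ M s : ℝ} (hU : HasExpKernel U C₁ γ)
    (hV : HasExpKernel V C₂ γ) (hC₁ : 0 ≤ C₁) (hC₂ : 0 ≤ C₂) (hγ : 0 < γ) (hs : 0 ≤ s)
    (hsγ : s ≤ γ / 2) (hB : ∀ a : Plane, ∃ B' : L2 →L[ℂ] L2,
      B ∘L expMul s (weight a) = expMul s (weight a) ∘L B' ∧ ‖B'‖ ≤ M) :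
    HasExpKernel (U ∘L B ∘L star V) (C₁ * C₂ * Real.exp s * M * expInt γ) s := by
  obtain ⟨u, hum, hu, hub⟩ := hU.exists_sections hγ
  obtain ⟨v, hvm, hv, hvb⟩ := hV.exists_sections hγ
  refine ⟨fun z => inner ℂ (u z.1) (B (v z.2)), ?_, ?_, fun f => ?_⟩
  · exact hum.comp_fst.inner (B.continuous.comp_aestronglyMeasurable hvm.comp_snd)
  · filter_upwards [Measure.quasiMeasurePreserving_fst.ae hub,
      Measure.quasiMeasurePreserving_snd.ae hvb] with ⟨x, x'⟩ hx hx'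
    simp only at hx hx' ⊢
    obtain ⟨B', hB', hB'M⟩ := hB x'
    have hM : 0 ≤ M := (norm_nonneg _).trans hB'M
    set w := weight x' with hw
    have hb := bddMeas_exp_weight hs x'
    -- `t` is the section of the kernel of `V`, multiplied by `e^{sw}`
    have htb : ∀ᵐ y, ‖(Real.exp (s * w y) : ℂ) * v x' y‖ ≤
        C₂ * Real.exp s * Real.exp (-(γ / 2) * ‖x' - y‖) := by
      filter_upwards [hx'] with y hy
      rw [norm_mul, Complex.norm_real, Real.norm_of_nonneg (Real.exp_pos _).le]
      have h1 := weight_le x' y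
      rw [norm_sub_rev] at h1
      calc Real.exp (s * w y) * ‖v x' y‖
          ≤ Real.exp (s * (1 + ‖x' - y‖)) * (C₂ * Real.exp (-γ * ‖x' - y‖)) := by gcongr
        _ = C₂ * Real.exp (s + (s - γ) * ‖x' - y‖) := by
            rw [mul_left_comm, ← Real.exp_add]
            congr 2
            ring
        _ ≤ C₂ * Real.exp (s + (-(γ / 2)) * ‖x' - y‖) := by
            gcongr
            linarith
        _ = _ := by rw [Real.exp_add]; ring
    have htm : MemLp (fun y => (Real.exp (s * w y) : ℂ) * v x' y) 2 volume := by
      refine memLp_two_of_lintegral_lt (AEStronglyMeasurable.mul ?_ (Lp.aestronglyMeasurable _))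
        ((lintegral_sq_le_of_exp_bound hγ x' htb).trans_lt ENNReal.ofReal_lt_top)
      have := measurable_weight x'
      exact Measurable.aestronglyMeasurable (by fun_prop)
    set t : L2 := htm.toLp _ with ht
    have htn : ‖t‖ ≤ C₂ * Real.exp s * Real.sqrt (expInt γ) := by
      refine norm_le_of_exp_bound (by positivity) hγ x' ?_
      filter_upwards [htm.coeFn_toLp, htb] with y h1 h2
      rwa [ht, h1]
    have htv : expMul s w t = v x' := by
      refine Lp.ext ?_
      filter_upwards [htm.coeFn_toLp, bmul_coe hb t] with y h1 h2
      rw [expMul, h2, ht, h1, ← mul_assoc, ← Complex.ofReal_mul, ← Real.exp_add]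
      simp [hw]
    have hun : ‖expMul s w (u x)‖ ≤
        C₁ * Real.exp (-s * ‖x - x'‖) * Real.sqrt (expInt γ) := by
      refine norm_le_of_exp_bound (by positivity) hγ x ?_
      filter_upwards [hx, bmul_coe hb (u x)] with y h1 h2
      rw [expMul, h2, norm_mul, Complex.norm_real, Real.norm_of_nonneg (Real.exp_pos _).le]
      have h3 := norm_sub_le_weight x' y
      have h4 : ‖x - x'‖ ≤ ‖x - y‖ + ‖y - x'‖ := norm_sub_le_norm_sub_add_norm_sub x y x'
      calc Real.exp (-s * w y) * ‖u x y‖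
          ≤ Real.exp (-s * w y) * (C₁ * Real.exp (-γ * ‖x - y‖)) := by gcongr
        _ = C₁ * Real.exp (-s * w y + -γ * ‖x - y‖) := by
            rw [mul_left_comm, ← Real.exp_add]
        _ ≤ C₁ * Real.exp (-s * ‖x - x'‖ + -(γ / 2) * ‖x - y‖) := by
            refine mul_le_mul_of_nonneg_left (Real.exp_le_exp.2 ?_) hC₁
            nlinarith [norm_nonneg (x - y), mul_le_mul_of_nonneg_left h3 hs,
              mul_le_mul_of_nonneg_left h4 hs, mul_le_mul_of_nonneg_right hsγ (norm_nonneg (x - y))]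
        _ = _ := by rw [Real.exp_add, mul_assoc]
    have hkey : inner ℂ (u x) (B (v x')) = inner ℂ (expMul s w (u x)) (B' t) := by
      have h1 : B (expMul s w t) = expMul s w (B' t) := DFunLike.congr_fun hB' t
      rw [← htv, h1]
      symm
      rw [expMul, bmul_adjoint hb]
      simp only [Complex.conj_ofReal]
      rfl
    rw [hkey]
    calc ‖inner ℂ (expMul s w (u x)) (B' t)‖ ≤ ‖expMul s w (u x)‖ * (‖B'‖ * ‖t‖) :=
          (norm_inner_le_norm _ _).trans
            (mul_le_mul_of_nonneg_left (B'.le_opNorm t) (norm_nonneg _))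
      _ ≤ (C₁ * Real.exp (-s * ‖x - x'‖) * Real.sqrt (expInt γ)) *
          (M * (C₂ * Real.exp s * Real.sqrt (expInt γ))) := by gcongr
      _ = C₁ * C₂ * Real.exp s * M * (Real.sqrt (expInt γ) * Real.sqrt (expInt γ)) *
          Real.exp (-s * ‖x - x'‖) := by ring
      _ = _ := by rw [Real.mul_self_sqrt (expInt_nonneg γ)]
  · filter_upwards [hu (B (star V f))] with x hx
    change U (B (star V f)) x = _
    rw [hx, ← ContinuousLinearMap.adjoint_inner_left, ContinuousLinearMap.star_eq_adjoint,
      ContinuousLinearMap.adjoint_inner_right, L2.inner_def]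
    refine integral_congr_ae ?_
    filter_upwards [hv (ContinuousLinearMap.adjoint B (u x))] with y hy
    rw [RCLike.inner_apply, hy, inner_conj_symm, ContinuousLinearMap.adjoint_inner_left, mul_comm]

/-! ### Exponential tilts of bounded operators -/

/-- Conjugating the bounded operator `A` by `e^{sw}` gives a bounded operator that differs from `A`
by at most `M s`, for all `0 ≤ s ≤ s₀` and all weights `w`. As the bounded operator `E = e^{-sw}` is
injective, the conjugated operator `A'` is characterized by `A E = E A'`. -/
def Tilts (A : L2 →L[ℂ] L2) (s₀ M : ℝ) : Prop :=
  ∀ s ∈ Set.Icc 0 s₀, ∀ a : Plane, ∃ A' : L2 →L[ℂ] L2,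
    A * expMul s (weight a) = expMul s (weight a) * A' ∧ ‖A' - A‖ ≤ M * s

theorem Tilts.mono {A : L2 →L[ℂ] L2} {s₀ s₁ M : ℝ} (hA : Tilts A s₀ M) (h : s₁ ≤ s₀) :
    Tilts A s₁ M := fun s hs a => hA s ⟨hs.1, hs.2.trans h⟩ a

theorem tilts_one {s₀ : ℝ} : Tilts 1 s₀ 0 := fun s _ a => ⟨1, by simp, by simp⟩

theorem Tilts.add {A B : L2 →L[ℂ] L2} {s₀ M N : ℝ} (hA : Tilts A s₀ M) (hB : Tilts B s₀ N) :
    Tilts (A + B) s₀ (M + N) := by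
  intro s hs a
  obtain ⟨A', h1, h2⟩ := hA s hs a
  obtain ⟨B', h3, h4⟩ := hB s hs a
  refine ⟨A' + B', by rw [add_mul, mul_add, h1, h3], ?_⟩
  rw [add_sub_add_comm, add_mul]
  exact (norm_add_le _ _).trans (add_le_add h2 h4)

theorem Tilts.smul {A : L2 →L[ℂ] L2} {s₀ M : ℝ} (hA : Tilts A s₀ M) (z : ℂ) :
    Tilts (z • A) s₀ (‖z‖ * M) := by
  intro s hs a
  obtain ⟨A', h1, h2⟩ := hA s hs a
  refine ⟨z • A', by rw [smul_mul_assoc, mul_smul_comm, h1], ?_⟩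
  rw [← smul_sub, norm_smul, mul_assoc]
  exact mul_le_mul_of_nonneg_left h2 (norm_nonneg _)

theorem Tilts.neg {A : L2 →L[ℂ] L2} {s₀ M : ℝ} (hA : Tilts A s₀ M) : Tilts (-A) s₀ M := by
  simpa using hA.smul (-1)

theorem Tilts.sub {A B : L2 →L[ℂ] L2} {s₀ M N : ℝ} (hA : Tilts A s₀ M) (hB : Tilts B s₀ N) :
    Tilts (A - B) s₀ (M + N) := by
  rw [sub_eq_add_neg]
  exact hA.add hB.neg

theorem Tilts.mul {A B : L2 →L[ℂ] L2} {s₀ M N : ℝ} (hA : Tilts A s₀ M) (hB : Tilts B s₀ N)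
    (hM : 0 ≤ M) (hN : 0 ≤ N) :
    Tilts (A * B) s₀ (M * (‖B‖ + N * s₀) + ‖A‖ * N) := by
  intro s hs a
  obtain ⟨A', h1, h2⟩ := hA s hs a
  obtain ⟨B', h3, h4⟩ := hB s hs a
  refine ⟨A' * B', by rw [mul_assoc, h3, ← mul_assoc, h1, mul_assoc], ?_⟩
  have h5 : ‖B'‖ ≤ ‖B‖ + N * s₀ := by
    calc ‖B'‖ = ‖B + (B' - B)‖ := by rw [add_sub_cancel]
      _ ≤ ‖B‖ + ‖B' - B‖ := norm_add_le _ _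
      _ ≤ ‖B‖ + N * s₀ := by
          have := mul_le_mul_of_nonneg_left hs.2 hN
          linarith
  have hs0 := hs.1
  calc ‖A' * B' - A * B‖ = ‖(A' - A) * B' + A * (B' - B)‖ := by
        congr 1
        rw [sub_mul, mul_sub]
        abel
    _ ≤ ‖A' - A‖ * ‖B'‖ + ‖A‖ * ‖B' - B‖ :=
        (norm_add_le _ _).trans (add_le_add (norm_mul_le _ _) (norm_mul_le _ _))
    _ ≤ (M * s) * (‖B‖ + N * s₀) + ‖A‖ * (N * s) := by gcongr
    _ = _ := by ring

theorem Tilts.norm_le {A : L2 →L[ℂ] L2} {s₀ M : ℝ} (hM : 0 ≤ M) {A' : L2 →L[ℂ] L2} {s : ℝ}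
    (hs : s ≤ s₀) (h : ‖A' - A‖ ≤ M * s) : ‖A'‖ ≤ ‖A‖ + M * s₀ := by
  calc ‖A'‖ = ‖A + (A' - A)‖ := by rw [add_sub_cancel]
    _ ≤ ‖A‖ + ‖A' - A‖ := norm_add_le _ _
    _ ≤ ‖A‖ + M * s₀ := by
        have := mul_le_mul_of_nonneg_left hs hM
        linarith

theorem HasExpKernel.exists_tilts {A : L2 →L[ℂ] L2} {C γ : ℝ} (hA : HasExpKernel A C γ)
    (hC : 0 ≤ C) (hγ : 0 < γ) : ∃ M, 0 ≤ M ∧ Tilts A (γ / 2) M := by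
  refine ⟨C * (4 / γ) * expInt (γ / 4), ?_, fun s hs a => ?_⟩
  · have := expInt_nonneg (γ / 4)
    positivity
  · exact hA.exists_tilt hC hγ (measurable_weight a) (weight_nonneg a) (abs_weight_sub_le a) hs.1 hs.2

/-! ### The growth operators -/

theorem exp_weight_mul (γ : ℝ) (a x : Plane) :
    ((Real.exp (γ * weight a x) : ℝ) : ℂ) * (Real.exp (-γ * weight a x) : ℂ) = 1 := by
  rw [← Complex.ofReal_mul, ← Real.exp_add]
  simp

theorem expMul_mem_expOp_domain {γ : ℝ} (hγ : 0 ≤ γ) (a : Plane) (f : L2) :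
    ∃ h : expMul γ (weight a) f ∈ (expOp γ a).domain, expOp γ a ⟨_, h⟩ = f :=
  bmul_inv_mem (bddMeas_exp_weight hγ a) (exp_weight_mul γ a) f

theorem expMul_expOp {γ : ℝ} (hγ : 0 ≤ γ) (a : Plane) (f : (expOp γ a).domain) :
    expMul γ (weight a) (expOp γ a f) = f :=
  eq_bmul_inv (bddMeas_exp_weight hγ a) (exp_weight_mul γ a) f

theorem expOp_neg {γ : ℝ} (hγ : 0 ≤ γ) (a : Plane) (f : L2) :
    ∃ h : f ∈ (expOp (-γ) a).domain, expOp (-γ) a ⟨f, h⟩ = expMul γ (weight a) f := by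
  refine mem_mulOp_domain_of_ae ?_
  filter_upwards [bmul_coe (bddMeas_exp_weight hγ a) f] with x hx
  rw [expMul, hx]

theorem expMul_mem_mulOp_domain {w ρ : Plane → ℝ} {s : ℝ}
    (hb : BddMeas fun x => (Real.exp (-s * ρ x) : ℂ)) (f : (mulOp w).domain) :
    ∃ h : expMul s ρ f ∈ (mulOp w).domain, mulOp w ⟨_, h⟩ = expMul s ρ (mulOp w f) := by
  refine mem_mulOp_domain_of_ae ?_
  filter_upwards [bmul_coe hb (f : L2), bmul_coe hb (mulOp w f), mulOp_coe f] with x h1 h2 h3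
  rw [expMul, h1, h2, h3]
  ring

/-- If the conjugates of `X + V` by `e^{γw}` are close to `X + V`, then the conjugates of the bounded
operator `V` are bounded and close to `V`. -/
theorem tilts_of_perturbation {Xhat : L2 →ₗ.[ℂ] L2} {V : L2 →L[ℂ] L2}
    (hdom : Xhat.domain = posX.domain)
    (hV : ∀ f (h : f ∈ posX.domain) (h' : f ∈ Xhat.domain), Xhat ⟨f, h'⟩ = posX ⟨f, h⟩ + V f)
    {C' γ₀ : ℝ}
    (H : ∀ γ ∈ Set.Icc 0 γ₀, ∀ a : Plane, NormLE (tilt Xhat γ a - Xhat) (C' * γ)) :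
    Tilts V γ₀ |C'| := by
  intro γ hγ a
  obtain ⟨hd, hb⟩ := H γ hγ a
  obtain ⟨Δ, hΔ, hΔn⟩ := exists_extension hd (tilt Xhat γ a - Xhat).toFun hb
  set E := expMul γ (weight a) with hE
  -- on the dense domain of the bounded operator `Δ`, where `e^{γw} X̂ e^{-γw} = X̂ + Δ`, the two
  -- multiplication operators `X` cancel
  have key : V * E = E * (V + Δ) := by
    refine DFunLike.coe_injective (Continuous.ext_on hd (V * E).continuous
      (E * (V + Δ)).continuous fun f hf => ?_)
    have h1 := hΔ ⟨f, hf⟩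
    obtain ⟨hf1, hf2⟩ := hf
    obtain ⟨h3, h4⟩ := mem_opComp_domain.1 hf1
    obtain ⟨h5, h6⟩ := mem_opComp_domain.1 h3
    obtain ⟨h7, h8⟩ := expOp_neg hγ.1 a f
    have h9 : E f ∈ Xhat.domain := by
      rw [hE, ← h8]
      exact h6
    have h10 : Xhat ⟨E f, h9⟩ ∈ (expOp γ a).domain := by
      have : Xhat ⟨E f, h9⟩ = opComp Xhat (expOp (-γ) a) ⟨f, h3⟩ := by
        rw [opComp_apply h3 h5 h6]
        congr 1
        exact Subtype.ext h8.symm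
      rw [this]
      exact h4
    have h11 : tilt Xhat γ a ⟨f, hf1⟩ = expOp γ a ⟨_, h10⟩ := by
      change expOp γ a ⟨opComp Xhat (expOp (-γ) a) ⟨f, h3⟩, h4⟩ = _
      congr 1
      refine Subtype.ext ?_
      change opComp Xhat (expOp (-γ) a) ⟨f, h3⟩ = Xhat ⟨E f, h9⟩
      rw [opComp_apply h3 h5 h6]
      congr 1
      exact Subtype.ext h8
    rw [LinearPMap.toFun_eq_coe, LinearPMap.sub_apply] at h1
    have h12 : Δ f = expOp γ a ⟨_, h10⟩ - Xhat ⟨f, hf2⟩ := by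
      rw [← h11]
      exact h1
    obtain ⟨h13, h14⟩ := expMul_mem_mulOp_domain (bddMeas_exp_weight hγ.1 a)
      (⟨f, hdom.le hf2⟩ : posX.domain)
    have h15 := hV (E f) h13 h9
    have h16 := hV f (hdom.le hf2) hf2
    have h17 : posX ⟨E f, h13⟩ = E (posX ⟨f, hdom.le hf2⟩) := h14
    change V (E f) = E (V f + Δ f)
    rw [h12, map_add, map_sub, expMul_expOp hγ.1 a, h16, map_add]
    change _ = E (V f) + (Xhat ⟨E f, h9⟩ - _)
    rw [h15, h17]
    abel
  refine ⟨V + Δ, key, ?_⟩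
  rw [add_sub_cancel_left]
  refine ContinuousLinearMap.opNorm_le_bound _ (mul_nonneg (abs_nonneg _) hγ.1) fun f => ?_
  exact (hΔn f).trans (mul_le_mul_of_nonneg_right (mul_le_mul_of_nonneg_right (le_abs_self _) hγ.1)
    (norm_nonneg _))

/-! ### Perturbation of resolvents in a Banach algebra -/

section Algebra

variable {𝒜 : Type*} [NormedRing 𝒜] [CompleteSpace 𝒜]

theorem isUnit_one_add_of_norm_le {x : 𝒜} (hx : ‖x‖ ≤ 1 / 2) : IsUnit (1 + x) := by
  have h : IsUnit (1 - -x) := isUnit_one_sub_of_norm_lt_one (by rw [norm_neg]; linarith)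
  rwa [sub_neg_eq_add] at h

/-- The resolvent `R₀ (1 + (W' - W) R₀)⁻¹` of the perturbed operator. -/
def perturbedResolvent (R₀ W W' : 𝒜) : 𝒜 := R₀ * Ring.inverse (1 + (W' - W) * R₀)

theorem norm_perturbedResolvent_le (h𝒜 : ‖(1 : 𝒜)‖ ≤ 1) {R₀ W W' : 𝒜}
    (h : ‖(W' - W) * R₀‖ ≤ 1 / 2) : ‖perturbedResolvent R₀ W W'‖ ≤ 2 * ‖R₀‖ := by
  have hu := isUnit_one_add_of_norm_le h
  set S := Ring.inverse (1 + (W' - W) * R₀) with hS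
  have h1 : S = 1 - ((W' - W) * R₀) * S := by
    have := Ring.mul_inverse_cancel _ hu
    rw [← hS, add_mul, one_mul] at this
    rw [eq_sub_iff_add_eq, this]
  have h2 : ‖S‖ ≤ 1 + 1 / 2 * ‖S‖ := by
    calc ‖S‖ = ‖1 - ((W' - W) * R₀) * S‖ := by rw [← h1]
      _ ≤ ‖(1 : 𝒜)‖ + ‖((W' - W) * R₀) * S‖ := norm_sub_le _ _
      _ ≤ 1 + 1 / 2 * ‖S‖ := by
          exact add_le_add h𝒜 ((norm_mul_le _ _).trans
            (mul_le_mul_of_nonneg_right h (norm_nonneg _)))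
  calc ‖R₀ * S‖ ≤ ‖R₀‖ * ‖S‖ := norm_mul_le _ _
    _ ≤ ‖R₀‖ * 2 := by
        gcongr
        linarith
    _ = _ := mul_comm _ _

/-- With `B = b⁻¹`, the hypotheses say that `R₀ = (W - b)⁻¹`. -/
theorem perturbedResolvent_eq_left {B R₀ W W' : 𝒜} (h : ‖(W' - W) * R₀‖ ≤ 1 / 2)
    (h1 : R₀ = B * (W * R₀ - 1)) :
    perturbedResolvent R₀ W W' = B * (W' * perturbedResolvent R₀ W W' - 1) := by
  have hu := isUnit_one_add_of_norm_le h
  have h3 := Ring.mul_inverse_cancel _ hu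
  set S := Ring.inverse (1 + (W' - W) * R₀) with hS
  have h4 : W' * (R₀ * S) - 1 = (W * R₀ - 1) * S := by
    have h5 : S + (W' - W) * R₀ * S = 1 := by rw [← h3, add_mul, one_mul]
    calc W' * (R₀ * S) - 1 = W' * (R₀ * S) - (S + (W' - W) * R₀ * S) := by rw [h5]
      _ = (W * R₀ - 1) * S := by noncomm_ring
  change R₀ * S = B * (W' * (R₀ * S) - 1)
  rw [h4, ← mul_assoc, ← h1]

/-- The right-hand analogue of `perturbedResolvent_eq_left`. -/
theorem perturbedResolvent_eq_right {B R₀ W W' : 𝒜} (h : ‖(W' - W) * R₀‖ ≤ 1 / 2)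
    (h2 : R₀ * (W * B - 1) = B) :
    perturbedResolvent R₀ W W' = (perturbedResolvent R₀ W W' * W' - 1) * B := by
  have hu := isUnit_one_add_of_norm_le h
  have h3 := Ring.inverse_mul_cancel _ hu
  set S := Ring.inverse (1 + (W' - W) * R₀) with hS
  have h4 : W' * B - 1 = (1 + (W' - W) * R₀) * (W * B - 1) := by
    rw [add_mul, one_mul, mul_assoc, h2]
    noncomm_ring
  have h5 : R₀ * S * (W' * B - 1) = B := by
    rw [h4, mul_assoc, ← mul_assoc S, h3, one_mul, h2]
  change R₀ * S = (R₀ * S * W' - 1) * B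
  calc R₀ * S = R₀ * S * W' * B - R₀ * S * (W' * B - 1) := by noncomm_ring
    _ = R₀ * S * W' * B - B := by rw [h5]
    _ = _ := by noncomm_ring

/-- If conjugation with `E` turns `W` into `W'` and commutes with `B = b⁻¹`, then it turns `(W -
b)⁻¹` into `(W' - b)⁻¹`. Only the intertwining relations are used, so that `E` need not be
invertible. -/
theorem perturbedResolvent_intertwine {B E R₀ W W' : 𝒜} (h : ‖(W' - W) * R₀‖ ≤ 1 / 2)
    (h1 : R₀ = B * (W * R₀ - 1)) (h2 : R₀ * (W * B - 1) = B) (hEB : E * B = B * E)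
    (hEW : W * E = E * W') : R₀ * E = E * perturbedResolvent R₀ W W' := by
  have h3 := perturbedResolvent_eq_left h h1
  set R := perturbedResolvent R₀ W W'
  have h4 : E * R = B * (W * (E * R) - E) := by
    nth_rewrite 1 [h3]
    rw [← mul_assoc, hEB, mul_assoc, mul_sub, mul_one, ← mul_assoc E, ← hEW, mul_assoc]
  have h5 : R₀ * ((W * B - 1) * (W * (E * R) - E)) = R₀ * E := by
    congr 1
    rw [sub_mul, one_mul, mul_assoc, ← h4, sub_sub_cancel]
  rw [← h5, ← mul_assoc, h2, ← h4]

theorem continuousOn_perturbedResolvent {Z : Type*} [TopologicalSpace Z] {s : Set Z}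
    {R₀ W W' : Z → 𝒜} (hR : ContinuousOn R₀ s) (hW : ContinuousOn W s) (hW' : ContinuousOn W' s)
    (h : ∀ z ∈ s, ‖(W' z - W z) * R₀ z‖ ≤ 1 / 2) :
    ContinuousOn (fun z => perturbedResolvent (R₀ z) (W z) (W' z)) s := by
  refine hR.mul fun z hz => ?_
  obtain ⟨u, hu⟩ := isUnit_one_add_of_norm_le (h z hz)
  have h1 : ContinuousAt Ring.inverse (1 + (W' z - W z) * R₀ z) :=
    hu ▸ NormedRing.inverse_continuousAt u
  exact ContinuousAt.comp_continuousWithinAt (f := fun z => 1 + (W' z - W z) * R₀ z) h1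
    (continuousWithinAt_const.add (((hW'.sub hW).mul hR) z hz))

end Algebra

/-! ### Resolvents of compressions -/

/-- The resolvent of `P T P` commutes with `P`. -/
theorem commute_opResolvent_compress {T : L2 →ₗ.[ℂ] L2} {P : L2 →L[ℂ] L2}
    (hP : IsStarProjection P) {z : ℂ} (hz : z ∉ opSpectrum (compress P T)) :
    Commute P (opResolvent (compress P T) z) := by
  ext1 f
  set R := opResolvent (compress P T) z
  change P (R f) = R (P f)
  obtain ⟨h1, h2⟩ := (isResolventAt_opResolvent hz).1 f
  have h3 : P (R f) ∈ T.domain := mem_compress_domain.1 h1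
  have h4 : P (R f) ∈ (compress P T).domain := by
    rw [mem_compress_domain, hP.apply_apply]
    exact h3
  have h5 : compress P T ⟨P (R f), h4⟩ = P (compress P T ⟨R f, h1⟩) := by
    rw [compress_apply h4 (mem_compress_domain.1 h4), compress_apply h1 h3,
      hP.apply_apply (T ⟨P (R f), h3⟩)]
    congr 2
    exact Subtype.ext (hP.apply_apply _)
  have h6 := (isResolventAt_opResolvent hz).2 ⟨_, h4⟩
  rw [h5, ← map_smul, ← map_sub, h2] at h6
  exact h6.symm

/-- On the range of `P`, the resolvent of `P T P` has values in the range of `P` and solves the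
resolvent equation. -/
theorem opResolvent_compress_spec {T : L2 →ₗ.[ℂ] L2} {P : L2 →L[ℂ] L2}
    (hP : IsStarProjection P) {z : ℂ} (hz : z ∉ opSpectrum (compress P T)) (f : L2) :
    P (opResolvent (compress P T) z (P f)) = opResolvent (compress P T) z (P f) ∧
    ∃ h : opResolvent (compress P T) z (P f) ∈ T.domain,
      z • opResolvent (compress P T) z (P f) - P (T ⟨_, h⟩) = P f := by
  have hc : ∀ g, P (opResolvent (compress P T) z g) = opResolvent (compress P T) z (P g) :=
    fun g => DFunLike.congr_fun (commute_opResolvent_compress hP hz).eq g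
  have h0 : P (opResolvent (compress P T) z (P f)) = opResolvent (compress P T) z (P f) := by
    rw [hc, hP.apply_apply]
  obtain ⟨h1, h2⟩ := (isResolventAt_opResolvent hz).1 (P f)
  have h3 := mem_compress_domain.1 h1
  refine ⟨h0, h0 ▸ h3, ?_⟩
  rw [compress_apply h1 h3] at h2
  refine Eq.trans ?_ h2
  congr 3
  exact Subtype.ext h0.symm

theorem opResolvent_compress_apply {T : L2 →ₗ.[ℂ] L2} {P : L2 →L[ℂ] L2}
    (hP : IsStarProjection P) {z : ℂ} (hz : z ∉ opSpectrum (compress P T)) {f : L2}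
    (hf : P f ∈ T.domain) :
    opResolvent (compress P T) z (z • P f - P (T ⟨P f, hf⟩)) = P f := by
  have h4 : P f ∈ (compress P T).domain := by
    rw [mem_compress_domain, hP.apply_apply]
    exact hf
  have h6 := (isResolventAt_opResolvent hz).2 ⟨_, h4⟩
  rw [compress_apply h4 (mem_compress_domain.1 h4)] at h6
  refine Eq.trans ?_ h6
  congr 4
  exact Subtype.ext (hP.apply_apply _).symm

/-! ### The position operator relative to a center -/

theorem mem_posXSub_domain {c : ℝ} {f : L2} (hf : f ∈ posX.domain) :
    ∃ h : f ∈ (posXSub c).domain, posXSub c ⟨f, h⟩ = posX ⟨f, hf⟩ - (c : ℂ) • f := by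
  refine mem_mulOp_domain_of_ae ?_
  filter_upwards [mulOp_coe (w := fun x => x 0) ⟨f, hf⟩,
    Lp.coeFn_sub (posX ⟨f, hf⟩) ((c : ℂ) • f), Lp.coeFn_smul (c : ℂ) f] with x h1 h2 h3
  have h1' : posX ⟨f, hf⟩ x = ((x 0 : ℝ) : ℂ) * f x := h1
  rw [h2, Pi.sub_apply, h3, Pi.smul_apply, h1', smul_eq_mul]
  push_cast
  ring

theorem mem_posX_domain {c : ℝ} {f : L2} (hf : f ∈ (posXSub c).domain) : f ∈ posX.domain := by
  refine (mem_mulOp_domain_of_ae (w := fun x => x 0)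
    (h := posXSub c ⟨f, hf⟩ + (c : ℂ) • f) ?_).1
  filter_upwards [mulOp_coe (w := fun x => x 0 - c) ⟨f, hf⟩,
    Lp.coeFn_add (posXSub c ⟨f, hf⟩) ((c : ℂ) • f), Lp.coeFn_smul (c : ℂ) f] with x h1 h2 h3
  have h1' : posXSub c ⟨f, hf⟩ x = ((x 0 - c : ℝ) : ℂ) * f x := h1
  rw [h2, Pi.add_apply, h3, Pi.smul_apply, h1', smul_eq_mul]
  push_cast
  ring

theorem posXSub_domain (c : ℝ) : (posXSub c).domain = posX.domain := by
  ext f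
  exact ⟨mem_posX_domain, fun hf => (mem_posXSub_domain hf).1⟩

/-- The bounded inverse of `X - c + i`. -/
def posRes (c : ℝ) : L2 →L[ℂ] L2 := bmul (resFun fun x => x 0 - c)

theorem measurable_posXSub (c : ℝ) : Measurable fun x : Plane => x 0 - c := by fun_prop

theorem posRes_mem (c : ℝ) (h : L2) : ∃ hf : posRes c h ∈ (posXSub c).domain,
    posXSub c ⟨_, hf⟩ = h - Complex.I • posRes c h :=
  bmul_resFun_mem (measurable_posXSub c) h

theorem eq_posRes (c : ℝ) (f : (posXSub c).domain) :
    posRes c (posXSub c f + Complex.I • (f : L2)) = f :=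
  eq_bmul_resFun (measurable_posXSub c) f

theorem expMul_mul_posRes {s : ℝ} (hs : 0 ≤ s) (a : Plane) (c : ℝ) :
    expMul s (weight a) * posRes c = posRes c * expMul s (weight a) :=
  bmul_commute (bddMeas_exp_weight hs a) (bddMeas_resFun (measurable_posXSub c))

/-! ### The block-diagonal operator and its resolvent -/

/-- The bounded part of a block-diagonal operator: if `K` is the commutator `[X, P]`, then
`P (λ - X - V) P + (1 - P) (c + i - X - V) (1 - P)` is `blockPart P V K (λ - c) - (X - c + i)`. In
particular, the bounded part depends on `λ` and `c` only through their difference. -/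
def blockPart (P V K : L2 →L[ℂ] L2) (z : ℂ) : L2 →L[ℂ] L2 :=
  Complex.I • (1 - P) + K * (2 • P - 1) - P * V * P - (1 - P) * V * (1 - P) + z • P +
    Complex.I • 1

/-- The inverse of the block-diagonal operator `P (z - T) P + (1 - P) (c + i - T) (1 - P)`. The point
`c + i` is never in the spectrum of the second block, which serves to make the operator invertible
on all of `L²`. -/
def blockResolvent (P : L2 →L[ℂ] L2) (T : L2 →ₗ.[ℂ] L2) (c : ℝ) (z : ℂ) : L2 →L[ℂ] L2 :=
  opResolvent (compress P T) z * P +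
    opResolvent (compress (1 - P) T) (c + Complex.I) * (1 - P)

section Block

variable {P V K : L2 →L[ℂ] L2} {Xhat : L2 →ₗ.[ℂ] L2}

/-- The decomposition of the block-diagonal operator into a bounded part and `X - c + i`, with `T =
X + V`. -/
theorem blockPart_apply (hP : IsStarProjection P) (hK : HasCommutator posX P K)
    (hdom : Xhat.domain = posX.domain)
    (hV : ∀ f (h : f ∈ posX.domain) (h' : f ∈ Xhat.domain), Xhat ⟨f, h'⟩ = posX ⟨f, h⟩ + V f)
    (c : ℝ) (z : ℂ) {f : L2} (hf : f ∈ posX.domain) (h₁ : P f ∈ Xhat.domain)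
    (h₂ : (1 - P) f ∈ Xhat.domain) (hf' : f ∈ (posXSub c).domain) :
    blockPart P V K (z - c) f - (posXSub c ⟨f, hf'⟩ + Complex.I • f) =
      (z • P f - P (Xhat ⟨P f, h₁⟩)) +
        ((c + Complex.I : ℂ) • (1 - P) f - (1 - P) (Xhat ⟨(1 - P) f, h₂⟩)) := by
  obtain ⟨h3, h4⟩ := hK ⟨f, hf⟩
  obtain ⟨h5, h6⟩ := mem_posXSub_domain (c := c) hf
  have h7 : posX ⟨(1 - P) f, hdom.le h₂⟩ = posX ⟨f, hf⟩ - posX ⟨P f, h3⟩ :=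
    posX.map_sub ⟨f, hf⟩ ⟨P f, h3⟩
  -- `P K P = 0`
  have h8 : P (K (P f)) = 0 := by
    obtain ⟨h9, h10⟩ := hK ⟨P f, h3⟩
    have h11 : posX ⟨P (P f), h9⟩ = posX ⟨P f, h3⟩ := by
      congr 1
      exact Subtype.ext (hP.apply_apply f)
    have h12 := congrArg P h10
    change P (posX ⟨P (P f), h9⟩) = P (P (posX ⟨P f, h3⟩) + K (P f)) at h12
    rw [h11, map_add, hP.apply_apply] at h12
    exact (left_eq_add.1 h12)
  -- `K P = (1 - P) K`
  have h9 : K (P f) = K f - P (K f) := by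
    obtain ⟨h9, h10⟩ := hK ⟨P f, h3⟩
    have h11 : posX ⟨P (P f), h9⟩ = posX ⟨P f, h3⟩ := by
      congr 1
      exact Subtype.ext (hP.apply_apply f)
    change posX ⟨P (P f), h9⟩ = P (posX ⟨P f, h3⟩) + K (P f) at h10
    change posX ⟨P f, h3⟩ = P (posX ⟨f, hf⟩) + K f at h4
    rw [h11, h4, map_add, hP.apply_apply] at h10
    rw [eq_sub_iff_add_eq]
    have := add_left_cancel (h10.trans (add_assoc _ _ _))
    exact (this.trans (add_comm _ _)).symm
  rw [h6, hV _ h3 h₁, hV _ (hdom.le h₂) h₂, h7, h4]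
  have hm : ∀ (A B : L2 →L[ℂ] L2) g, (A * B) g = A (B g) := fun _ _ _ => rfl
  simp only [blockPart, sub_apply, add_apply, smul_apply, hm, one_apply_eq_self, map_add,
    map_sub, hP.apply_apply, h9,
    two_smul, smul_sub, sub_smul, add_smul]
  abel

end Block

theorem norm_one_le : ‖(1 : L2 →L[ℂ] L2)‖ ≤ 1 := ContinuousLinearMap.norm_id_le

theorem norm_le_one_of_isStarProjection {P : L2 →L[ℂ] L2} (hP : IsStarProjection P) : ‖P‖ ≤ 1 := by
  refine ContinuousLinearMap.opNorm_le_bound _ zero_le_one fun f => ?_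
  have h1 : ‖P f‖ * ‖P f‖ ≤ ‖f‖ * ‖P f‖ := by
    calc ‖P f‖ * ‖P f‖ = ‖inner ℂ (P f) (P f)‖ := by rw [inner_self_eq_norm_sq_to_K]; simp [sq]
      _ = ‖inner ℂ f (P f)‖ := by rw [hP.inner_apply, hP.apply_apply]
      _ ≤ _ := norm_inner_le_norm _ _
  rw [one_mul]
  rcases (norm_nonneg (P f)).eq_or_lt with h | h
  · rw [← h]
    exact norm_nonneg f
  · exact le_of_mul_le_mul_right h1 h

theorem norm_posRes_le (c : ℝ) : ‖posRes c‖ ≤ 1 :=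
  norm_bmul_le (bddMeas_resFun (measurable_posXSub c)) (norm_resFun_le _)

section Block

variable {P V K : L2 →L[ℂ] L2} {Xhat : L2 →ₗ.[ℂ] L2}

theorem blockPart_eq (P V K : L2 →L[ℂ] L2) (z : ℂ) :
    blockPart P V K z = blockPart P V K 0 + z • P := by
  simp only [blockPart, zero_smul]
  abel

theorem blockResolvent_mul (hP : IsStarProjection P) (c : ℝ) (z : ℂ) :
    blockResolvent P Xhat c z * P = opResolvent (compress P Xhat) z * P := by
  rw [blockResolvent, add_mul, mul_assoc, mul_assoc, hP.isIdempotentElem.eq, sub_mul, one_mul,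
    hP.isIdempotentElem.eq, sub_self, mul_zero, add_zero]

variable (hP : IsStarProjection P) (hK : HasCommutator posX P K)
    (hdom : Xhat.domain = posX.domain)
    (hV : ∀ f (h : f ∈ posX.domain) (h' : f ∈ Xhat.domain), Xhat ⟨f, h'⟩ = posX ⟨f, h⟩ + V f)
    {c : ℝ} {z : ℂ} (hz : z ∉ opSpectrum (compress P Xhat))
    (hc : (c + Complex.I : ℂ) ∉ opSpectrum (compress (1 - P) Xhat))

include hP hz hc in
theorem mul_blockResolvent : P * blockResolvent P Xhat c z =
    opResolvent (compress P Xhat) z * P := by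
  have h1 := (commute_opResolvent_compress hP hz).eq
  have h2 := (commute_opResolvent_compress hP.one_sub hc).eq
  have h3 : P * opResolvent (compress (1 - P) Xhat) (c + Complex.I) * (1 - P) = 0 := by
    have h4 : opResolvent (compress (1 - P) Xhat) (c + Complex.I) * (1 - P) =
        (1 - P) * opResolvent (compress (1 - P) Xhat) (c + Complex.I) * (1 - P) := by
      rw [h2, mul_assoc, hP.one_sub.isIdempotentElem.eq]
    have h0 : P * (1 - P) = 0 := by rw [mul_sub, mul_one, hP.isIdempotentElem.eq, sub_self]
    rw [mul_assoc, h4, ← mul_assoc, ← mul_assoc, h0, zero_mul, zero_mul]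
  rw [blockResolvent, mul_add, ← mul_assoc, ← mul_assoc, h3, add_zero, h1, mul_assoc,
    hP.isIdempotentElem.eq]

include hP hK hdom hV hz hc in
/-- `blockResolvent` is a right inverse of `blockPart - (X - c + i)`. The unbounded operator is
eliminated by means of `posRes c = (X - c + i)⁻¹`. -/
theorem blockResolvent_eq_left : blockResolvent P Xhat c z =
    posRes c * (blockPart P V K (z - c) * blockResolvent P Xhat c z - 1) := by
  ext1 f
  obtain ⟨h1, h2, h3⟩ := opResolvent_compress_spec hP hz f
  obtain ⟨h4, h5, h6⟩ := opResolvent_compress_spec hP.one_sub hc f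
  set g := blockResolvent P Xhat c z f with hg
  have hg' : g = opResolvent (compress P Xhat) z (P f) +
    opResolvent (compress (1 - P) Xhat) (c + Complex.I) ((1 - P) f) := rfl
  have hPg : P g = opResolvent (compress P Xhat) z (P f) := by
    rw [hg', map_add, h1, ← h4]
    simp [hP.apply_apply]
  have hPg' : (1 - P) g = opResolvent (compress (1 - P) Xhat) (c + Complex.I) ((1 - P) f) := by
    rw [sub_apply, one_apply_eq_self, hPg, hg']
    abel
  have hgd : g ∈ posX.domain := hdom.le (hg' ▸ Xhat.domain.add_mem h2 h5)
  obtain ⟨hgd', -⟩ := mem_posXSub_domain (c := c) hgd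
  have hd1 : P g ∈ Xhat.domain := hPg ▸ h2
  have hd2 : (1 - P) g ∈ Xhat.domain := hPg' ▸ h5
  have key := blockPart_apply hP hK hdom hV c z hgd hd1 hd2 hgd'
  have e1 : z • P g - P (Xhat ⟨P g, hd1⟩) = P f := by
    rw [← h3]
    simp only [hPg]
  have e2 : (c + Complex.I : ℂ) • (1 - P) g - (1 - P) (Xhat ⟨(1 - P) g, hd2⟩) = (1 - P) f := by
    rw [← h6]
    simp only [hPg']
  rw [e1, e2] at key
  have e3 : P f + (1 - P) f = f := by simp
  rw [e3] at key
  have := eq_posRes c ⟨g, hgd'⟩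
  change g = posRes c (blockPart P V K (z - c) g - f)
  rw [← key, sub_sub_cancel]
  exact this.symm

include hP hK hdom hV hz hc in
/-- `blockResolvent` is a left inverse of `blockPart - (X - c + i)`. -/
theorem blockResolvent_eq_right : blockResolvent P Xhat c z *
    (blockPart P V K (z - c) * posRes c - 1) = posRes c := by
  ext1 h
  obtain ⟨h1, h2⟩ := posRes_mem c h
  set f := posRes c h with hf
  have hfd : f ∈ posX.domain := mem_posX_domain h1
  have hd1 : P f ∈ Xhat.domain := by
    rw [hdom]
    exact (hK ⟨f, hfd⟩).1
  have hd2 : (1 - P) f ∈ Xhat.domain := by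
    rw [sub_apply, one_apply_eq_self]
    exact Xhat.domain.sub_mem (hdom.ge hfd) hd1
  have key := blockPart_apply hP hK hdom hV c z hfd hd1 hd2 h1
  rw [h2, sub_add_cancel] at key
  change blockResolvent P Xhat c z (blockPart P V K (z - c) f - h) = f
  have e1 := opResolvent_compress_apply hP hz hd1
  have e2 := opResolvent_compress_apply hP.one_sub hc hd2
  have e3 : ∀ g, blockResolvent P Xhat c z g = opResolvent (compress P Xhat) z (P g) +
    opResolvent (compress (1 - P) Xhat) (c + Complex.I) ((1 - P) g) := fun _ => rfl
  rw [key, e3]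
  have e4 : P (z • P f - P (Xhat ⟨P f, hd1⟩) + ((c + Complex.I : ℂ) • (1 - P) f -
      (1 - P) (Xhat ⟨(1 - P) f, hd2⟩))) = z • P f - P (Xhat ⟨P f, hd1⟩) := by
    simp only [map_add, map_sub, map_smul, hP.apply_apply, sub_apply, one_apply_eq_self, sub_self,
      smul_zero, add_zero]
  have e5 : (1 - P) (z • P f - P (Xhat ⟨P f, hd1⟩) + ((c + Complex.I : ℂ) • (1 - P) f -
      (1 - P) (Xhat ⟨(1 - P) f, hd2⟩))) = (c + Complex.I : ℂ) • (1 - P) f -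
      (1 - P) (Xhat ⟨(1 - P) f, hd2⟩) := by
    rw [sub_apply, one_apply_eq_self, e4, add_sub_cancel_left]
  rw [e4, e5, e1, e2]
  simp

end Block

/-! ### Exponentially tilted Riesz projections -/

theorem Contour.norm_integral_le (Γ : Contour) {V : Type*} [NormedAddCommGroup V]
    [NormedSpace ℂ V] {F : ℂ → V} {M : ℝ} (hF : ∀ z ∈ Γ.support, ‖F z‖ ≤ M) :
    ‖Γ.integral F‖ ≤ M * Γ.length := by
  rw [Contour.integral, Contour.length, Finset.mul_sum]
  refine (norm_sum_le _ _).trans (Finset.sum_le_sum fun i _ => ?_)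
  rw [← intervalIntegral.integral_const_mul]
  refine intervalIntegral.norm_integral_le_of_norm_le zero_le_one ?_ ?_
  · refine Filter.Eventually.of_forall fun t ht => ?_
    rw [norm_smul, mul_comm]
    exact mul_le_mul_of_nonneg_right
      (hF _ (Set.mem_iUnion.2 ⟨i, t, Set.Ioc_subset_Icc_self ht, rfl⟩)) (norm_nonneg _)
  · have := (Γ.intervalIntegrable i (G := fun _ => (1 : ℂ)) continuousOn_const).norm
    simp only [norm_smul, norm_one, mul_one] at this
    exact this.const_mul M

/-- The conjugate of `Q` by the exponential weight of rate `s ≤ s₀` centered anywhere is a bounded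
operator which maps into the domain of `X` and stays bounded after multiplication with `X - c + i`
from either side. -/
def LineLocalized (Q : L2 →L[ℂ] L2) (c s₀ M : ℝ) : Prop :=
  ∀ s ∈ Set.Icc 0 s₀, ∀ a : Plane, ∃ L N : L2 →L[ℂ] L2,
    Q * expMul s (weight a) = expMul s (weight a) * (posRes c * L) ∧
    posRes c * L = N * posRes c ∧ ‖L‖ ≤ M ∧ ‖N‖ ≤ M

theorem norm_two_pi_I_inv_le : ‖(2 * Real.pi * Complex.I : ℂ)⁻¹‖ ≤ 1 := by
  have := Real.pi_gt_three
  rw [norm_inv]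
  simp only [norm_mul, Complex.norm_I, Complex.norm_real, Complex.norm_ofNat, mul_one]
  rw [Real.norm_of_nonneg Real.pi_pos.le]
  exact inv_le_one_of_one_le₀ (by linarith)

theorem norm_blockResolvent_le {P : L2 →L[ℂ] L2} (hP : IsStarProjection P)
    {Xhat : L2 →ₗ.[ℂ] L2} (hX' : IsSelfAdjoint (compress (1 - P) Xhat)) {z : ℂ} {M : ℝ}
    (hz : ‖opResolvent (compress P Xhat) z‖ ≤ M) (c : ℝ) :
    ‖blockResolvent P Xhat c z‖ ≤ M + 1 := by
  have h1 := norm_opResolvent_le_of_im_ne_zero hX' (z := c + Complex.I) (by simp)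
  simp only [Complex.add_im, Complex.ofReal_im, Complex.I_im, zero_add, abs_one, div_one] at h1
  have hM : 0 ≤ M := (norm_nonneg _).trans hz
  refine (norm_add_le _ _).trans (add_le_add ?_ ?_)
  · refine (norm_mul_le _ _).trans ?_
    nlinarith [norm_nonneg P, norm_le_one_of_isStarProjection hP]
  · refine (norm_mul_le _ _).trans ?_
    nlinarith [norm_nonneg (1 - P), norm_le_one_of_isStarProjection hP.one_sub,
      norm_nonneg (opResolvent (compress (1 - P) Xhat) (c + Complex.I))]

set_option maxHeartbeats 1000000 in
/-- **Combes–Thomas estimate** for Riesz projections. The resolvent of the block-diagonal operator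
survives the conjugation with slowly growing exponential weights, since its bounded part changes
only little. -/
theorem exists_lineLocalized {P V K : L2 →L[ℂ] L2} {Xhat : L2 →ₗ.[ℂ] L2}
    (hP : IsStarProjection P) (hK : HasCommutator posX P K)
    (hdom : Xhat.domain = posX.domain)
    (hV : ∀ f (h : f ∈ posX.domain) (h' : f ∈ Xhat.domain), Xhat ⟨f, h'⟩ = posX ⟨f, h⟩ + V f)
    (hX' : IsSelfAdjoint (compress (1 - P) Xhat))
    {s₁ m₁ m₂ m₃ : ℝ} (hs₁ : 0 < s₁) (hm₁ : 0 ≤ m₁) (hm₂ : 0 ≤ m₂) (hm₃ : 0 ≤ m₃)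
    (tP : Tilts P s₁ m₁) (tV : Tilts V s₁ m₂) (tK : Tilts K s₁ m₃) {M L ℓ : ℝ}
    (hM : 0 ≤ M) (hL : 0 ≤ L) (hℓ : 0 ≤ ℓ) :
    ∃ s₀ C, 0 < s₀ ∧ s₀ ≤ s₁ ∧ 0 ≤ C ∧ ∀ (c : ℝ) (Γ : Contour),
      (∀ z ∈ Γ.support, z ∉ opSpectrum (compress P Xhat) ∧
        ‖opResolvent (compress P Xhat) z‖ ≤ M ∧ ‖z - c‖ ≤ L) → Γ.length ≤ ℓ →
      LineLocalized (rieszProj (compress P Xhat) Γ * P) c s₀ C := by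
  obtain ⟨m₀, hm₀, t₀⟩ : ∃ m₀, 0 ≤ m₀ ∧ Tilts (blockPart P V K 0) s₁ m₀ := by
    have tP' : Tilts (1 - P) s₁ (0 + m₁) := tilts_one.sub tP
    have h1 := (((((tP'.smul Complex.I).add (tK.mul ((tP.add tP).sub tilts_one) hm₃
      (by positivity))).sub ((tP.mul tV hm₁ hm₂).mul tP (by positivity) hm₁)).sub
      ((tP'.mul tV (by positivity) hm₂).mul tP' (by positivity) (by positivity))).add
      (tP.smul 0)).add (tilts_one.smul Complex.I)
    simp only [blockPart, two_smul]
    exact ⟨_, by positivity, h1⟩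
  set n₁ := 1 + m₁ * s₁ with hn₁
  set w := ‖blockPart P V K 0‖ + m₀ * s₁ + L * n₁ with hw
  set μ := m₀ + L * m₁ with hμ
  have hn₁0 : 0 ≤ n₁ := by positivity
  have hw0 : 0 ≤ w := by positivity
  have hμ0 : 0 ≤ μ := by positivity
  -- the tilt changes the bounded part by at most `μ s`, and the block resolvent is bounded by `M +
  -- 1`; their product must not exceed `1 / 2`
  refine ⟨min s₁ (1 / (2 * (μ + 1) * (M + 1))), (w * (2 * (M + 1)) + 1) * n₁ * ℓ, ?_,
    min_le_left _ _, by positivity, ?_⟩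
  · exact lt_min hs₁ (by positivity)
  intro c Γ hΓ hlen s hs a
  have hs1 : s ≤ s₁ := hs.2.trans (min_le_left _ _)
  have hs2 : μ * s * (M + 1) ≤ 1 / 2 := by
    have h1 : s ≤ 1 / (2 * (μ + 1) * (M + 1)) := hs.2.trans (min_le_right _ _)
    rw [le_div_iff₀ (by positivity)] at h1
    nlinarith [mul_nonneg hs.1 (by linarith : 0 ≤ M + 1)]
  set E := expMul s (weight a) with hE
  have hEi : Function.Injective E := expMul_injective (bddMeas_exp_weight hs.1 a)
  have hEB : E * posRes c = posRes c * E := expMul_mul_posRes hs.1 a c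
  obtain ⟨P', hP'1, hP'2⟩ := tP s ⟨hs.1, hs1⟩ a
  obtain ⟨W₀', hW1, hW2⟩ := t₀ s ⟨hs.1, hs1⟩ a
  have hP'n : ‖P'‖ ≤ n₁ := (Tilts.norm_le hm₁ hs1 hP'2).trans
    (add_le_add (norm_le_one_of_isStarProjection hP) le_rfl)
  have hW'n := Tilts.norm_le hm₀ hs1 hW2
  set R₀ : ℂ → L2 →L[ℂ] L2 := blockResolvent P Xhat c with hR₀
  set W : ℂ → L2 →L[ℂ] L2 := fun z => blockPart P V K (z - c) with hWdef
  set W' : ℂ → L2 →L[ℂ] L2 := fun z => W₀' + (z - c) • P' with hW'def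
  set R : ℂ → L2 →L[ℂ] L2 := fun z => perturbedResolvent (R₀ z) (W z) (W' z) with hRdef
  have hc : (c + Complex.I : ℂ) ∉ opSpectrum (compress (1 - P) Xhat) :=
    not_mem_opSpectrum_of_im_ne_zero hX' (by simp)
  have hR₀n : ∀ z ∈ Γ.support, ‖R₀ z‖ ≤ M + 1 := fun z hz =>
    norm_blockResolvent_le hP hX' (hΓ z hz).2.1 c
  have hW'z : ∀ z ∈ Γ.support, ‖W' z‖ ≤ w := fun z hz => by
    refine (norm_add_le _ _).trans (add_le_add hW'n ?_)
    rw [norm_smul]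
    exact mul_le_mul (hΓ z hz).2.2 hP'n (norm_nonneg _) hL
  have hpert : ∀ z ∈ Γ.support, ‖(W' z - W z) * R₀ z‖ ≤ 1 / 2 := fun z hz => by
    have h1 : W' z - W z = (W₀' - blockPart P V K 0) + (z - c) • (P' - P) := by
      simp only [hW'def, hWdef]
      rw [blockPart_eq, smul_sub]
      abel
    have h2 : ‖W' z - W z‖ ≤ μ * s := by
      rw [h1, hμ, add_mul, mul_assoc]
      refine (norm_add_le _ _).trans (add_le_add hW2 ?_)
      rw [norm_smul]
      exact mul_le_mul (hΓ z hz).2.2 hP'2 (norm_nonneg _) hL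
    refine (norm_mul_le _ _).trans (le_trans ?_ hs2)
    exact mul_le_mul h2 (hR₀n z hz) (norm_nonneg _) (mul_nonneg hμ0 hs.1)
  have hRn : ∀ z ∈ Γ.support, ‖R z‖ ≤ 2 * (M + 1) := fun z hz =>
    (norm_perturbedResolvent_le norm_one_le (hpert z hz)).trans
      (mul_le_mul_of_nonneg_left (hR₀n z hz) zero_le_two)
  have hWE : ∀ z, W z * E = E * W' z := fun z => by
    simp only [hW'def, hWdef]
    rw [blockPart_eq, add_mul, mul_add, hW1, smul_mul_assoc, mul_smul_comm, hP'1]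
  have hleft : ∀ z ∈ Γ.support, R₀ z = posRes c * (W z * R₀ z - 1) := fun z hz =>
    blockResolvent_eq_left hP hK hdom hV (hΓ z hz).1 hc
  have hright : ∀ z ∈ Γ.support, R₀ z * (W z * posRes c - 1) = posRes c := fun z hz =>
    blockResolvent_eq_right hP hK hdom hV (hΓ z hz).1 hc
  have hRE : ∀ z ∈ Γ.support, R₀ z * E = E * R z := fun z hz =>
    perturbedResolvent_intertwine (hpert z hz) (hleft z hz) (hright z hz) hEB (hWE z)
  -- the commutation of the block resolvent with `P` is inherited by the conjugates
  have hcomm : ∀ z ∈ Γ.support, R z * P' = P' * R z := fun z hz => by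
    have h1 : E * (R z * P') = E * (P' * R z) := by
      rw [← mul_assoc, ← hRE z hz, mul_assoc, ← hP'1, ← mul_assoc, hR₀,
        blockResolvent_mul hP, ← mul_blockResolvent hP (hΓ z hz).1 hc, mul_assoc]
      change P * (R₀ z * E) = _
      rw [hRE z hz, ← mul_assoc, hP'1, mul_assoc]
    ext1 f
    exact hEi (DFunLike.congr_fun h1 f)
  -- continuity of the integrands
  have cR₁ : ContinuousOn (opResolvent (compress P Xhat)) Γ.support :=
    continuousOn_opResolvent (fun z hz => (hΓ z hz).1) (fun z hz => (hΓ z hz).2.1)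
  have cR₀ : ContinuousOn R₀ Γ.support :=
    (cR₁.mul continuousOn_const).add continuousOn_const
  have cW : ContinuousOn W Γ.support := by
    have : W = fun z : ℂ => blockPart P V K 0 + (z - c) • P := by
      funext z
      exact blockPart_eq P V K _
    rw [this]
    fun_prop
  have cW' : ContinuousOn W' Γ.support := by fun_prop
  have cR : ContinuousOn R Γ.support := continuousOn_perturbedResolvent cR₀ cW cW' hpert
  have cF : ContinuousOn (fun z => (W' z * R z - 1) * P') Γ.support :=
    ((cW'.mul cR).sub continuousOn_const).mul continuousOn_const
  have cG : ContinuousOn (fun z => P' * (R z * W' z - 1)) Γ.support :=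
    continuousOn_const.mul ((cR.mul cW').sub continuousOn_const)
  -- integrals of products with constant factors
  have mulL : ∀ (A : L2 →L[ℂ] L2) {F : ℂ → L2 →L[ℂ] L2}, ContinuousOn F Γ.support →
      A * Γ.integral F = Γ.integral fun z => A * F z := fun A F hF =>
    Γ.map_integral (ContinuousLinearMap.mul ℂ (L2 →L[ℂ] L2) A) hF
  have mulR : ∀ (A : L2 →L[ℂ] L2) {F : ℂ → L2 →L[ℂ] L2}, ContinuousOn F Γ.support →
      Γ.integral F * A = Γ.integral fun z => F z * A := fun A F hF =>
    Γ.map_integral ((ContinuousLinearMap.mul ℂ (L2 →L[ℂ] L2)).flip A) hF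
  have hbd : ∀ {F : ℂ → L2 →L[ℂ] L2},
      (∀ z ∈ Γ.support, ‖F z‖ ≤ (w * (2 * (M + 1)) + 1) * n₁) →
      ‖(2 * Real.pi * Complex.I : ℂ)⁻¹ • Γ.integral F‖ ≤
        (w * (2 * (M + 1)) + 1) * n₁ * ℓ := fun {F} hF => by
    rw [norm_smul]
    have h1 := Γ.norm_integral_le hF
    have h2 : (w * (2 * (M + 1)) + 1) * n₁ * Γ.length ≤ (w * (2 * (M + 1)) + 1) * n₁ * ℓ :=
      mul_le_mul_of_nonneg_left hlen (by positivity)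
    nlinarith [norm_two_pi_I_inv_le, norm_nonneg (Γ.integral F),
      norm_nonneg (2 * Real.pi * Complex.I : ℂ)⁻¹]
  refine ⟨(2 * Real.pi * Complex.I : ℂ)⁻¹ • Γ.integral fun z => (W' z * R z - 1) * P',
    (2 * Real.pi * Complex.I : ℂ)⁻¹ • Γ.integral fun z => P' * (R z * W' z - 1), ?_, ?_,
    hbd fun z hz => ?_, hbd fun z hz => ?_⟩
  · rw [rieszProj, smul_mul_assoc, smul_mul_assoc, mul_smul_comm, mul_smul_comm,
      mul_assoc (Γ.integral _), ← mul_assoc E, mulR _ cR₁, mulL _ cF]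
    congr 1
    refine Γ.integral_congr fun z hz => ?_
    rw [mul_assoc E, ← mul_assoc (posRes c),
      ← perturbedResolvent_eq_left (hpert z hz) (hleft z hz), ← mul_assoc E]
    change _ = E * R z * P'
    rw [← hRE z hz, mul_assoc, ← hP'1, ← mul_assoc, ← mul_assoc, hR₀, blockResolvent_mul hP]
  · rw [smul_mul_assoc, mul_smul_comm, mulR _ cG, mulL _ cF]
    congr 1
    refine Γ.integral_congr fun z hz => ?_
    rw [← mul_assoc (posRes c), ← perturbedResolvent_eq_left (hpert z hz) (hleft z hz), mul_assoc,
      ← perturbedResolvent_eq_right (hpert z hz) (hright z hz)]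
    exact hcomm z hz
  · have h1 : ‖W' z * R z - 1‖ ≤ w * (2 * (M + 1)) + 1 :=
      (norm_sub_le _ _).trans (add_le_add ((norm_mul_le _ _).trans
        (mul_le_mul (hW'z z hz) (hRn z hz) (norm_nonneg _) hw0)) norm_one_le)
    exact (norm_mul_le _ _).trans (mul_le_mul h1 hP'n (norm_nonneg _) (by positivity))
  · have h1 : ‖R z * W' z - 1‖ ≤ w * (2 * (M + 1)) + 1 := by
      rw [mul_comm w]
      exact (norm_sub_le _ _).trans (add_le_add ((norm_mul_le _ _).trans
        (mul_le_mul (hRn z hz) (hW'z z hz) (norm_nonneg _) (by positivity))) norm_one_le)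
    rw [mul_comm _ n₁]
    exact (norm_mul_le _ _).trans (mul_le_mul hP'n h1 (norm_nonneg _) hn₁0)

theorem posRes_injective (c : ℝ) : Function.Injective (posRes c) :=
  bmul_injective (bddMeas_resFun (measurable_posXSub c)) (resFun_ne_zero _)

theorem expMul_zero (ρ : Plane → ℝ) : expMul 0 ρ = 1 := by
  rw [← bmul_one, expMul]
  congr 1
  funext x
  simp

/-- Intertwining relations with an injective operator determine the second operator. -/
theorem mul_left_cancel_of_injective {E A B : L2 →L[ℂ] L2} (hE : Function.Injective E)
    (h : E * A = E * B) : A = B :=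
  ContinuousLinearMap.ext fun f => hE (DFunLike.congr_fun h f)

/-- If `P` has a localized kernel, line localized operators on `ran P` have localized kernels, even
after multiplication with `X - c + i`. -/
theorem exists_hasExpKernel_of_lineLocalized {P K : L2 →L[ℂ] L2} {C₀ C₁ γ s₀ M : ℝ}
    (hP : IsStarProjection P) (hPk : HasExpKernel P C₀ γ) (hKk : HasExpKernel K C₁ γ)
    (hK : HasCommutator posX P K) (hC₀ : 0 ≤ C₀) (hC₁ : 0 ≤ C₁) (hγ : 0 < γ) (hs₀ : 0 < s₀)
    (hM : 0 ≤ M) :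
    ∃ C s, 0 < C ∧ 0 < s ∧ ∀ (Q : L2 →L[ℂ] L2) (c : ℝ), LineLocalized Q c s₀ M →
      P * Q = Q → Q * P = Q → HasExpKernel Q C s ∧
        ∃ L, HasExpKernel L C s ∧ Q = posRes c * L := by
  set s := min s₀ (γ / 2) with hs
  have hs0 : 0 < s := lt_min hs₀ (by positivity)
  have hss : s ≤ s₀ := min_le_left _ _
  have hsγ : s ≤ γ / 2 := min_le_right _ _
  have hI := expInt_nonneg γ
  set D₀ := C₀ * C₀ * Real.exp s * M * expInt γ with hD₀
  set D₁ := C₁ * C₀ * Real.exp s * M * expInt γ with hD₁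
  have h0 : 0 ≤ D₀ := by positivity
  have h1 : 0 ≤ D₁ := by positivity
  have hPs : star P = P := hP.isSelfAdjoint.star_eq
  refine ⟨D₀ + D₁ + 1, s, by positivity, hs0, fun Q c hQ hPQ hQP => ?_⟩
  have tQ : ∀ a : Plane, ∃ B' : L2 →L[ℂ] L2,
      Q ∘L expMul s (weight a) = expMul s (weight a) ∘L B' ∧ ‖B'‖ ≤ M := fun a => by
    obtain ⟨L, N, h1, h2, h3, h4⟩ := hQ s ⟨hs0.le, hss⟩ a
    refine ⟨_, h1, (norm_mul_le _ _).trans ?_⟩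
    nlinarith [norm_posRes_le c, norm_nonneg (posRes c), norm_nonneg L]
  obtain ⟨L, N, hL, -⟩ := hQ 0 ⟨le_rfl, hs₀.le⟩ 0
  rw [expMul_zero, mul_one, one_mul] at hL
  have tL : ∀ a : Plane, ∃ B' : L2 →L[ℂ] L2,
      L ∘L expMul s (weight a) = expMul s (weight a) ∘L B' ∧ ‖B'‖ ≤ M := fun a => by
    obtain ⟨L', N', h1, -, h3, -⟩ := hQ s ⟨hs0.le, hss⟩ a
    refine ⟨L', mul_left_cancel_of_injective (posRes_injective c) ?_, h3⟩
    change posRes c * (L * expMul s (weight a)) = posRes c * (expMul s (weight a) * L')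
    rw [← mul_assoc, ← hL, h1, ← mul_assoc, ← mul_assoc, expMul_mul_posRes hs0.le]
  have kQ : HasExpKernel Q D₀ s := by
    have := hasExpKernel_of_tilts hPk hPk hC₀ hC₀ hγ hs0.le hsγ tQ
    rw [hPs] at this
    have e : P ∘L Q ∘L P = Q := by
      change P * (Q * P) = Q
      rw [hQP, hPQ]
    rwa [e] at this
  refine ⟨kQ.mono h0 (by linarith) le_rfl, L, ?_, hL⟩
  have k1 := hasExpKernel_of_tilts hPk hPk hC₀ hC₀ hγ hs0.le hsγ tL
  have k2 := hasExpKernel_of_tilts hKk hPk hC₁ hC₀ hγ hs0.le hsγ tQ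
  rw [hPs] at k1 k2
  have k3 := k1.add k2 h0 h1 hs0
  have eLP : L * P = L := by
    refine mul_left_cancel_of_injective (posRes_injective c) ?_
    rw [← mul_assoc, ← hL, hQP]
  have eQ : K ∘L Q ∘L P = K * Q := by
    change K * (Q * P) = K * Q
    rw [hQP]
  have eL : P ∘L L ∘L P + K ∘L Q ∘L P = L := by
    rw [eQ]
    change P * (L * P) + K * Q = L
    rw [eLP]
    ext1 f
    -- `(X - c + i) P Q f = P (X - c + i) Q f + K Q f`
    have hQf : Q f = posRes c (L f) := DFunLike.congr_fun hL f
    obtain ⟨h2, h3⟩ := posRes_mem c (L f)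
    have hd : Q f ∈ posX.domain := hQf ▸ mem_posX_domain h2
    obtain ⟨h4, h5⟩ := mem_posXSub_domain (c := c) hd
    have h6 : posXSub c ⟨Q f, h4⟩ = L f - Complex.I • Q f := by
      rw [hQf] at h4
      simp only [hQf]
      exact h3
    obtain ⟨h7, h8⟩ := hK ⟨Q f, hd⟩
    have h9 : P (Q f) = Q f := DFunLike.congr_fun hPQ f
    have h10 : posX ⟨Q f, hd⟩ = P (posX ⟨Q f, hd⟩) + K (Q f) := by
      rw [← h8]
      congr 1
      exact Subtype.ext h9.symm
    have h11 : posX ⟨Q f, hd⟩ = L f - Complex.I • Q f + (c : ℂ) • Q f := by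
      rw [← h6, h5, sub_add_cancel]
    rw [h11, map_add, map_sub, map_smul, map_smul, h9] at h10
    change P (L f) + K (Q f) = L f
    have h12 : L f + (-(Complex.I • Q f) + (c : ℂ) • Q f) =
        P (L f) + K (Q f) + (-(Complex.I • Q f) + (c : ℂ) • Q f) := by
      rw [← sub_eq_zero] at h10 ⊢
      rw [← h10]
      abel
    exact (add_right_cancel h12).symm
  rw [eL] at k3
  exact k3.mono (by positivity) (by linarith) le_rfl

/-! ### Tilted operators on their natural domains -/

/-- For a bounded operator, the intertwining relation `Q E = E A` with `E = e^{-γw}` says that the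
operator conjugated by `e^{γw}` is everywhere defined and equal to `A`. -/
theorem tilt_ofBdd {Q A : L2 →L[ℂ] L2} {γ : ℝ} (hγ : 0 ≤ γ) {a : Plane}
    (h : Q * expMul γ (weight a) = expMul γ (weight a) * A) :
    tilt (ofBdd Q) γ a = ofBdd A := by
  have key : ∀ f : L2, ∃ hf : f ∈ (tilt (ofBdd Q) γ a).domain, tilt (ofBdd Q) γ a ⟨f, hf⟩ = A f := by
    intro f
    obtain ⟨h1, h2⟩ := expOp_neg hγ a f
    have h3 : f ∈ (opComp (ofBdd Q) (expOp (-γ) a)).domain := mem_opComp_domain.2 ⟨h1, trivial⟩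
    have h4 : opComp (ofBdd Q) (expOp (-γ) a) ⟨f, h3⟩ = expMul γ (weight a) (A f) := by
      rw [opComp_apply h3 h1 trivial, ofBdd_apply]
      change Q (expOp (-γ) a ⟨f, h1⟩) = _
      rw [h2]
      exact DFunLike.congr_fun h f
    obtain ⟨h5, h6⟩ := expMul_mem_expOp_domain hγ a (A f)
    have h7 : opComp (ofBdd Q) (expOp (-γ) a) ⟨f, h3⟩ ∈ (expOp γ a).domain := h4 ▸ h5
    refine ⟨mem_opComp_domain.2 ⟨h3, h7⟩, ?_⟩
    change expOp γ a ⟨_, h7⟩ = A f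
    rw [← h6]
    congr 1
    exact Subtype.ext h4
  refine LinearPMap.ext ?_ ?_
  · ext f
    exact ⟨fun _ => trivial, fun _ => (key f).1⟩
  · intro f hf _
    exact (key f).2

/-- Line localization in terms of the natural domains of the unbounded operators. -/
theorem LineLocalized.normLE {Q : L2 →L[ℂ] L2} {c s₀ M L : ℝ} (hQ : LineLocalized Q c s₀ M)
    (hM : 0 ≤ M) {η : ℝ} (hη : |η - c| ≤ L) {γ : ℝ} (hγ : γ ∈ Set.Icc 0 s₀) (a : Plane) :
    ((opComp (posXSub η) (tilt (ofBdd Q) γ a)).domain = ⊤ ∧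
        NormLE (opComp (posXSub η) (tilt (ofBdd Q) γ a)) (M * (2 + L))) ∧
      ((opComp (tilt (ofBdd Q) γ a) (posXSub η)).domain = posX.domain ∧
        NormLE (opComp (tilt (ofBdd Q) γ a) (posXSub η)) (M * (2 + L))) := by
  obtain ⟨U, N, h1, h2, hU, hN⟩ := hQ γ hγ a
  have hBn : ∀ g, ‖posRes c g‖ ≤ ‖g‖ := fun g =>
    ((posRes c).le_of_opNorm_le (norm_posRes_le c) g).trans (one_mul _).le
  have hcη : ‖(c - η : ℂ)‖ ≤ L := by
    rw [← Complex.ofReal_sub, Complex.norm_real, Real.norm_eq_abs, abs_sub_comm]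
    exact hη
  rw [tilt_ofBdd hγ.1 h1]
  have shift : ∀ f (hf : f ∈ (posXSub c).domain), ∃ h : f ∈ (posXSub η).domain,
      posXSub η ⟨f, h⟩ = posXSub c ⟨f, hf⟩ + (c - η : ℂ) • f := fun f hf => by
    obtain ⟨h3, h4⟩ := mem_posXSub_domain (c := η) (mem_posX_domain hf)
    obtain ⟨h5, h6⟩ := mem_posXSub_domain (c := c) (mem_posX_domain hf)
    refine ⟨h3, ?_⟩
    rw [h4, h6, sub_smul]
    abel
  refine ⟨?_, ?_⟩
  · have key : ∀ f : L2, ∃ hf : f ∈ (opComp (posXSub η) (ofBdd (posRes c * U))).domain,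
        opComp (posXSub η) (ofBdd (posRes c * U)) ⟨f, hf⟩ =
          U f - Complex.I • posRes c (U f) + (c - η : ℂ) • posRes c (U f) := by
      intro f
      obtain ⟨h3, h4⟩ := posRes_mem c (U f)
      obtain ⟨h5, h6⟩ := shift _ h3
      refine ⟨mem_opComp_domain.2 ⟨trivial, h5⟩, ?_⟩
      rw [← h4, ← h6]
      rfl
    have hd : (opComp (posXSub η) (ofBdd (posRes c * U))).domain = ⊤ :=
      eq_top_iff.2 fun f _ => (key f).1
    refine ⟨hd, ?_, ?_⟩
    · rw [hd]
      exact dense_univ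
    · rintro ⟨f, hf⟩
      rw [(key f).2]
      have e1 : ‖U f‖ ≤ M * ‖f‖ := U.le_of_opNorm_le hU f
      have e2 := hBn (U f)
      calc _ ≤ ‖U f‖ + ‖Complex.I • posRes c (U f)‖ + ‖(c - η : ℂ) • posRes c (U f)‖ :=
            (norm_add_le _ _).trans (add_le_add (norm_sub_le _ _) le_rfl)
        _ ≤ M * ‖f‖ + M * ‖f‖ + L * (M * ‖f‖) := by
            rw [norm_smul, norm_smul, Complex.norm_I, one_mul]
            exact add_le_add (add_le_add e1 (e2.trans e1))
              (mul_le_mul hcη (e2.trans e1) (norm_nonneg _) ((norm_nonneg _).trans hcη))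
        _ = M * (2 + L) * ‖f‖ := by ring
  · have hd : (opComp (ofBdd (posRes c * U)) (posXSub η)).domain = posX.domain := by
      rw [← posXSub_domain η]
      ext f
      exact ⟨fun h => (mem_opComp_domain.1 h).1, fun h => mem_opComp_domain.2 ⟨h, trivial⟩⟩
    refine ⟨hd, ?_, ?_⟩
    · rw [hd]
      exact mulOp_dense (by fun_prop)
    · rintro ⟨f, hf⟩
      have hfX : f ∈ posX.domain := hd ▸ hf
      obtain ⟨h3, -⟩ := mem_posXSub_domain (c := c) hfX
      obtain ⟨h5, h6⟩ := shift f h3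
      have e0 : opComp (ofBdd (posRes c * U)) (posXSub η) ⟨f, hf⟩ =
          N (f - Complex.I • posRes c f + (c - η : ℂ) • posRes c f) := by
        change (posRes c * U) (posXSub η ⟨f, h5⟩) = _
        have e3 := eq_posRes c ⟨f, h3⟩
        rw [map_add, map_smul] at e3
        rw [h2, h6]
        change N (posRes c _) = _
        rw [map_add, map_smul, eq_sub_of_add_eq e3]
      rw [e0]
      refine (N.le_of_opNorm_le hN _).trans ?_
      rw [mul_assoc]
      refine mul_le_mul_of_nonneg_left ?_ hM
      have e2 := hBn f
      calc _ ≤ ‖f‖ + ‖Complex.I • posRes c f‖ + ‖(c - η : ℂ) • posRes c f‖ :=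
            (norm_add_le _ _).trans (add_le_add (norm_sub_le _ _) le_rfl)
        _ ≤ ‖f‖ + ‖f‖ + L * ‖f‖ := by
            rw [norm_smul, norm_smul, Complex.norm_I, one_mul]
            exact add_le_add (add_le_add le_rfl e2)
              (mul_le_mul hcη e2 (norm_nonneg _) ((norm_nonneg _).trans hcη))
        _ = (2 + L) * ‖f‖ := by ring

/-! ### Separating a set with uniform gaps by circles -/

/-- Circles with real centers `c n` and radii `r n`, where `n` ranges over a set of integers, that
separate the bands `σ j`: each point of a band lies inside exactly one circle, the circles keep the
distance `δ` from the bands, each of them meets at most one band, and each band meets at most `m`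
of them. -/
structure SeparatingCircles {J : Type*} (σ : J → Set ℝ) where
  idx : Set ℤ
  c : ℤ → ℝ
  r : ℤ → ℝ
  δ : ℝ
  L : ℝ
  m : ℕ
  δ_pos : 0 < δ
  L_nonneg : 0 ≤ L
  r_pos : ∀ n ∈ idx, 0 < r n
  r_le : ∀ n ∈ idx, r n ≤ L
  dist_le : ∀ n ∈ idx, ∀ j, ∀ x ∈ σ j, δ ≤ |(|x - c n| - r n)|
  unique : ∀ n ∈ idx, ∀ n' ∈ idx, ∀ j, ∀ x ∈ σ j, |x - c n| < r n → |x - c n'| < r n' → n = n'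
  band : ∀ n ∈ idx, ∀ j, ∀ x ∈ σ j, ∀ k, ∀ y ∈ σ k, |x - c n| < r n → |y - c n| < r n → j = k
  cover_band : ∀ j, ∃ F : Finset ℤ, ↑F ⊆ idx ∧ F.card ≤ m ∧
    (∀ n ∈ F, ∃ x ∈ σ j, |x - c n| < r n) ∧ ∀ x ∈ σ j, ∃ n ∈ F, |x - c n| < r n
  cover_ball : ∀ R : ℝ, ∃ F : Finset ℤ, ↑F ⊆ idx ∧
    ∀ j, ∀ x ∈ σ j, |x| ≤ R → ∃ n ∈ F, |x - c n| < r n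

theorem exists_least_nat {p : ℕ → Prop} {N : ℕ} (h : ∃ k, 1 ≤ k ∧ k ≤ N ∧ p k) :
    ∃ k, 1 ≤ k ∧ k ≤ N ∧ p k ∧ ∀ l, 1 ≤ l → l < k → ¬ p l := by
  classical
  obtain ⟨h1, h2, h3⟩ := Nat.find_spec h
  exact ⟨Nat.find h, h1, h2, h3, fun l hl hlk hp =>
    Nat.find_min h hlk ⟨hl, hlk.le.trans h2, hp⟩⟩

/-- The line is divided into cells of length `d / 2`. Nonempty cells that are adjacent belong to the
same band, so that there are no long runs of nonempty cells. The circles pass through the midpoints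
of consecutive empty cells. -/
theorem exists_separatingCircles {J : Type*} {σ : J → Set ℝ} {d D : ℝ} (hd : 0 < d)
    (hgap : ∀ j k, j ≠ k → ∀ x ∈ σ j, ∀ y ∈ σ k, d ≤ |x - y|)
    (hdiam : ∀ j, ∀ x ∈ σ j, ∀ y ∈ σ j, |x - y| ≤ D) : Nonempty (SeparatingCircles σ) := by
  classical
  set δ := d / 2 with hδ
  have hδ0 : 0 < δ := by positivity
  set κ : ℝ → ℤ := fun x => ⌊x / δ⌋ with hκ
  have κ1 : ∀ x, κ x * δ ≤ x := fun x => by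
    have := Int.floor_le (x / δ)
    rwa [le_div_iff₀ hδ0] at this
  have κ2 : ∀ x, x < (κ x + 1) * δ := fun x => by
    have := Int.lt_floor_add_one (x / δ)
    rwa [div_lt_iff₀ hδ0] at this
  let blank : ℤ → Prop := fun n => ∀ j, ∀ x ∈ σ j, κ x ≠ n
  -- points in the same cell or in adjacent cells have distance less than `d`
  have adj : ∀ i j, ∀ x ∈ σ i, ∀ y ∈ σ j, κ x ≤ κ y → κ y ≤ κ x + 1 → i = j := by
    intro i j x hx y hy h1 h2
    by_contra hij
    have h3 := hgap i j hij x hx y hy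
    have h1' : (κ x : ℝ) ≤ κ y := by exact_mod_cast h1
    have h2' : (κ y : ℝ) ≤ κ x + 1 := by exact_mod_cast h2
    have := κ1 x
    have := κ1 y
    have := κ2 x
    have := κ2 y
    have : |x - y| < d := by
      rw [abs_lt]
      constructor <;> nlinarith
    linarith
  have run : ∀ (k : ℕ) (m : ℤ), (∀ l : ℤ, m < l → l < m + k → ¬ blank l) →
      ∀ i j, ∀ x ∈ σ i, ∀ y ∈ σ j, κ x = m → κ y = m + k → i = j := by
    intro k
    induction k with
    | zero =>
      intro m _ i j x hx y hy h1 h2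
      exact adj i j x hx y hy (by simp [h1, h2]) (by simp [h1, h2])
    | succ k ih =>
      intro m h i j x hx y hy h1 h2
      push_cast at h2 h
      rcases Nat.eq_zero_or_pos k with rfl | hk
      · exact adj i j x hx y hy (by push_cast at h2; omega) (by push_cast at h2; omega)
      · have h3 := h (m + k) (by omega) (by omega)
        simp only [blank, not_forall, not_not] at h3
        obtain ⟨i', x', hx', h4⟩ := h3
        have h5 := ih m (fun l h6 h7 => h l h6 (by omega)) i i' x hx x' hx' h1 h4
        rw [h5]
        exact adj i' j x' hx' y hy (by omega) (by omega)
  obtain ⟨N, hN⟩ := exists_nat_ge (D / δ + 2)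
  have hN1 : D ≤ (N - 2) * δ := by
    have : D / δ ≤ N - 2 := by linarith
    rwa [div_le_iff₀ hδ0] at this
  -- a run of `N + 2` nonempty cells would contain points of one band with a distance exceeding `D`
  have hb : ∀ m : ℤ, ∃ k : ℕ, 1 ≤ k ∧ k ≤ N + 2 ∧ blank (m + k) := by
    intro m
    by_contra! H
    have h1 := H 1 le_rfl (by omega)
    have h2 := H (N + 2) (by omega) le_rfl
    simp only [blank, not_forall, not_not] at h1 h2
    obtain ⟨i, x, hx, h1⟩ := h1
    obtain ⟨j, y, hy, h2⟩ := h2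
    have h3 := run (N + 1) (m + 1) (fun l h3 h4 => by
      have := H (l - m).toNat (by omega) (by omega)
      rwa [show m + ((l - m).toNat : ℤ) = l by omega] at this) i j x hx y hy
      (by rw [h1]; simp) (by rw [h2]; push_cast; ring)
    subst h3
    have h4 := hdiam i x hx y hy
    have h5 := κ2 x
    have h6 := κ1 y
    rw [h1] at h5
    rw [h2] at h6
    push_cast at h5 h6
    rw [abs_le] at h4
    nlinarith
  choose up up1 up2 up3 up4 using fun m : ℤ => exists_least_nat (hb m)
  have down : ∀ m : ℤ, ∃ n, n < m ∧ m - (N + 2) ≤ n ∧ blank n ∧ ∀ l, n < l → l < m → ¬ blank l := by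
    intro m
    have h1 : ∃ k, 1 ≤ k ∧ k ≤ N + 2 ∧ blank (m - k) := by
      obtain ⟨k, h1, h2, h3⟩ := hb (m - (N + 2) - 1)
      exact ⟨N + 3 - k, by omega, by omega, by
        rwa [show m - ((N + 3 - k : ℕ) : ℤ) = m - (N + 2) - 1 + k by omega]⟩
    obtain ⟨k, h1, h2, h3, h4⟩ := exists_least_nat h1
    refine ⟨m - k, by omega, by omega, h3, fun l h5 h6 h7 => h4 (m - l).toNat (by omega) (by omega) ?_⟩
    rwa [show m - ((m - l).toNat : ℤ) = l by omega]
  -- the circle indexed by an empty cell `n` passes through the midpoint of `n` and that of the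
  -- next empty cell `n + up n`
  let mid : ℤ → ℝ := fun n => (n + 1 / 2) * δ
  let c : ℤ → ℝ := fun n => (mid n + mid (n + up n)) / 2
  let r : ℤ → ℝ := fun n => (mid (n + up n) - mid n) / 2
  have hr : ∀ n, r n = up n * δ / 2 := fun n => by
    simp only [r, mid]
    push_cast
    ring
  -- the position of a point of a band with respect to a circle
  have pos : ∀ n, blank n → ∀ j, ∀ x ∈ σ j,
      (n < κ x ∧ κ x < n + up n ∧ |x - c n| ≤ r n - δ / 2) ∨
      (¬ (n < κ x ∧ κ x < n + up n) ∧ r n + δ / 2 ≤ |x - c n|) := by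
    intro n hn j x hx
    have h1 := hn j x hx
    have h2 := up3 n j x hx
    have h3 := κ1 x
    have h4 := κ2 x
    rcases lt_or_gt_of_ne h1 with h5 | h5
    · right
      refine ⟨by omega, le_trans ?_ (neg_le_abs _)⟩
      have h6 : (κ x : ℝ) + 1 ≤ n := by exact_mod_cast h5
      simp only [c, r, mid]
      nlinarith
    · rcases lt_or_gt_of_ne h2 with h6 | h6
      · left
        refine ⟨h5, h6, ?_⟩
        have h7 : (n : ℝ) + 1 ≤ κ x := by exact_mod_cast h5
        have h8 : (κ x : ℝ) + 1 ≤ ((n + up n : ℤ) : ℝ) := by exact_mod_cast h6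
        rw [abs_le]
        simp only [c, r, mid]
        constructor <;> nlinarith
      · right
        refine ⟨by omega, le_trans ?_ (le_abs_self _)⟩
        have h8 : ((n + up n : ℤ) : ℝ) + 1 ≤ κ x := by exact_mod_cast h6
        simp only [c, r, mid]
        nlinarith
  have inside : ∀ n, blank n → ∀ j, ∀ x ∈ σ j, (|x - c n| < r n ↔ n < κ x ∧ κ x < n + up n) := by
    intro n hn j x hx
    rcases pos n hn j x hx with h | h
    · exact ⟨fun _ => ⟨h.1, h.2.1⟩, fun _ => by linarith [h.2.2]⟩
    · exact ⟨fun h' => by linarith [h.2], fun h' => absurd h' h.1⟩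
  have upmin : ∀ n l : ℤ, n < l → l < n + up n → ¬ blank l := fun n l h1 h2 => by
    have := up4 n (l - n).toNat (by omega) (by omega)
    rwa [show n + ((l - n).toNat : ℤ) = l by omega] at this
  have cover : ∀ j, ∀ x ∈ σ j, ∃ n, blank n ∧ |x - c n| < r n ∧ n < κ x ∧ κ x - (N + 2) ≤ n := by
    intro j x hx
    obtain ⟨n, h1, h2, h3, h4⟩ := down (κ x)
    refine ⟨n, h3, (inside n h3 j x hx).2 ⟨h1, ?_⟩, h1, h2⟩
    by_contra! h5
    rcases h5.lt_or_eq with h6 | h6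
    · exact h4 _ (by have := up1 n; omega) h6 (up3 n)
    · exact up3 n j x hx h6.symm
  refine ⟨⟨{n | blank n}, c, r, δ / 2, (N + 2) * δ / 2, 3 * (N + 3), by positivity, by positivity, ?_, ?_, ?_, ?_, ?_,
    ?_, ?_⟩⟩
  · intro n _
    rw [hr]
    have : (1 : ℝ) ≤ up n := by exact_mod_cast up1 n
    positivity
  · intro n _
    rw [hr]
    have : (up n : ℝ) ≤ N + 2 := by exact_mod_cast up2 n
    nlinarith
  · intro n hn j x hx
    rcases pos n hn j x hx with h | h
    · rw [abs_sub_comm]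
      exact le_trans (by linarith [h.2.2]) (le_abs_self _)
    · exact le_trans (by linarith [h.2]) (le_abs_self _)
  · intro n hn n' hn' j x hx h1 h2
    rw [inside n hn j x hx] at h1
    rw [inside n' hn' j x hx] at h2
    rcases lt_trichotomy n n' with h | h | h
    · exact absurd hn' (upmin n n' h (by omega))
    · exact h
    · exact absurd hn (upmin n' n h (by omega))
  · intro n hn j x hx k y hy h1 h2
    rw [inside n hn j x hx] at h1
    rw [inside n hn k y hy] at h2
    rcases le_total (κ x) (κ y) with h | h
    · exact run (κ y - κ x).toNat (κ x) (fun l h3 h4 => upmin n l (by omega) (by omega)) j k x hx y hy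
        rfl (by omega)
    · exact (run (κ x - κ y).toNat (κ y) (fun l h3 h4 => upmin n l (by omega) (by omega)) k j y hy x hx
        rfl (by omega)).symm
  · intro j
    rcases (σ j).eq_empty_or_nonempty with h0 | ⟨x₀, hx₀⟩
    · exact ⟨∅, by simp, by simp, by simp, by simp [h0]⟩
    refine ⟨(Finset.Icc (κ x₀ - (N + 2) - N) (κ x₀ + N)).filter
      (fun n => blank n ∧ ∃ x ∈ σ j, |x - c n| < r n), ?_, ?_, ?_, ?_⟩
    · intro n hn
      exact (Finset.mem_filter.1 hn).2.1
    · refine (Finset.card_filter_le _ _).trans ?_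
      rw [Int.card_Icc]
      omega
    · intro n hn
      exact (Finset.mem_filter.1 hn).2.2
    · intro x hx
      obtain ⟨n, h1, h2, h3, h4⟩ := cover j x hx
      refine ⟨n, Finset.mem_filter.2 ⟨Finset.mem_Icc.2 ?_, h1, x, hx, h2⟩, h2⟩
      have h5 := hdiam j x hx x₀ hx₀
      rw [abs_le] at h5
      have k1 := κ1 x
      have k2 := κ2 x
      have k3 := κ1 x₀
      have k4 := κ2 x₀
      have h6 : (κ x : ℝ) < κ x₀ + N := by
        by_contra! h
        nlinarith
      have h7 : (κ x₀ : ℝ) < κ x + N := by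
        by_contra! h
        nlinarith
      have h6' : κ x < κ x₀ + N := by exact_mod_cast h6
      have h7' : κ x₀ < κ x + N := by exact_mod_cast h7
      constructor <;> omega
  · intro R
    refine ⟨(Finset.Icc (κ (-R) - (N + 2)) (κ R)).filter blank, ?_, ?_⟩
    · intro n hn
      exact (Finset.mem_filter.1 hn).2
    · intro j x hx hxR
      obtain ⟨n, h1, h2, h3, h4⟩ := cover j x hx
      rw [abs_le] at hxR
      have h5 : κ (-R) ≤ κ x := Int.floor_le_floor (div_le_div_of_nonneg_right hxR.1 hδ0.le)
      have h6 : κ x ≤ κ R := Int.floor_le_floor (div_le_div_of_nonneg_right hxR.2 hδ0.le)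
      exact ⟨n, Finset.mem_filter.2 ⟨Finset.mem_Icc.2 ⟨by omega, by omega⟩, h1⟩, h2⟩

/-! ### Contours made of circles -/

theorem hasDerivAt_circle (c r t : ℝ) : HasDerivAt (fun t : ℝ => circleMap c r (2 * Real.pi * t))
    ((2 * Real.pi) • deriv (circleMap c r) (2 * Real.pi * t)) t := by
  have h1 : HasDerivAt (fun t : ℝ => 2 * Real.pi * t) (2 * Real.pi) t := by
    simpa using (hasDerivAt_id t).const_mul (2 * Real.pi)
  have h2 := (differentiable_circleMap (c : ℂ) r (2 * Real.pi * t)).hasDerivAt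
  exact h2.scomp t h1

theorem norm_deriv_circle (c r t : ℝ) :
    ‖deriv (fun t : ℝ => circleMap c r (2 * Real.pi * t)) t‖ = 2 * Real.pi * |r| := by
  rw [(hasDerivAt_circle _ _ t).deriv, norm_smul, deriv_circleMap, norm_mul (circleMap _ _ _),
    norm_circleMap_zero, Complex.norm_I, mul_one, Real.norm_of_nonneg Real.two_pi_pos.le]

/-- The union of the circles with center `c n` and radius `r n`, `n ∈ F`. -/
def circleContour (F : Finset ℤ) (c r : ℤ → ℝ) : Contour where
  n := F.card
  curve i t := circleMap (c (F.equivFin.symm i)) (r (F.equivFin.symm i)) (2 * Real.pi * t)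
  lipschitz i := by
    refine ⟨Real.nnabs (2 * Real.pi * r (F.equivFin.symm i)), LipschitzWith.lipschitzOnWith ?_⟩
    refine lipschitzWith_of_nnnorm_deriv_le (fun t => (hasDerivAt_circle _ _ t).differentiableAt)
      fun t => ?_
    rw [← NNReal.coe_le_coe, coe_nnnorm, norm_deriv_circle, Real.coe_nnabs, abs_mul,
      abs_of_pos Real.two_pi_pos]
  closed i := by
    simp [circleMap]

section

variable (F : Finset ℤ) (c r : ℤ → ℝ)

theorem circleContour_integral {V : Type*} [NormedAddCommGroup V] [NormedSpace ℂ V] (G : ℂ → V) :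
    (circleContour F c r).integral G = ∑ n ∈ F, ∮ z in C(c n, r n), G z := by
  have h1 : ∀ n : ℤ, (∫ t in (0 : ℝ)..1, deriv (fun t : ℝ => circleMap (c n) (r n) (2 * Real.pi * t)) t •
      G (circleMap (c n) (r n) (2 * Real.pi * t))) = ∮ z in C(c n, r n), G z := by
    intro n
    have h2 := intervalIntegral.smul_integral_comp_mul_left (a := 0) (b := 1)
      (fun θ => deriv (circleMap (c n) (r n)) θ • G (circleMap (c n) (r n) θ)) (2 * Real.pi)
    rw [mul_zero, mul_one] at h2
    rw [circleIntegral, ← h2, ← intervalIntegral.integral_smul]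
    refine intervalIntegral.integral_congr fun t _ => ?_
    rw [(hasDerivAt_circle _ _ t).deriv, smul_assoc]
  rw [← Finset.sum_coe_sort, ← Equiv.sum_comp F.equivFin.symm]
  exact Finset.sum_congr rfl fun i _ => h1 _

theorem circleContour_length :
    (circleContour F c r).length = ∑ n ∈ F, 2 * Real.pi * |r n| := by
  rw [← Finset.sum_coe_sort, ← Equiv.sum_comp F.equivFin.symm]
  refine Finset.sum_congr rfl fun i _ => ?_
  have h1 : ∀ t, ‖deriv ((circleContour F c r).curve i) t‖ =
      2 * Real.pi * |r (F.equivFin.symm i)| := by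
    intro t
    exact norm_deriv_circle _ _ t
  simp only [h1]
  simp

theorem mem_circleContour_support {z : ℂ} (hz : z ∈ (circleContour F c r).support) :
    ∃ n ∈ F, ‖z - c n‖ = |r n| := by
  obtain ⟨i, t, -, rfl⟩ := Set.mem_iUnion.1 hz
  refine ⟨F.equivFin.symm i, (F.equivFin.symm i).2, ?_⟩
  change ‖circleMap _ _ _ - _‖ = _
  rw [circleMap_sub_center, norm_circleMap_zero]

variable {F c r}

theorem circleContour_windingNumber {x : ℝ} (h : ∀ n ∈ F, 0 < r n ∧ |x - c n| ≠ r n) :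
    (circleContour F c r).windingNumber x = ∑ n ∈ F, if |x - c n| < r n then 1 else 0 := by
  have hpi : (2 * Real.pi * Complex.I : ℂ) ≠ 0 := by simp [Real.pi_ne_zero]
  rw [Contour.windingNumber, circleContour_integral, Finset.mul_sum]
  refine Finset.sum_congr rfl fun n hn => ?_
  obtain ⟨h1, h2⟩ := h n hn
  have hd : dist (x : ℂ) (c n) = |x - c n| := by
    rw [Complex.dist_eq, ← Complex.ofReal_sub, Complex.norm_real, Real.norm_eq_abs]
  split_ifs with h3
  · rw [circleIntegral.integral_sub_inv_of_mem_ball (by rwa [Metric.mem_ball, hd]),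
      inv_mul_cancel₀ hpi]
  · have h4 : r n < |x - c n| := lt_of_le_of_ne (not_lt.1 h3) (Ne.symm h2)
    have h5 : (∮ z in C(c n, r n), (z - (x : ℂ))⁻¹) = 0 := by
      refine Complex.circleIntegral_eq_zero_of_differentiable_on_off_countable h1.le
        Set.countable_empty ?_ ?_
      · refine ContinuousOn.inv₀ (by fun_prop) fun z hz => ?_
        rintro h
        rw [sub_eq_zero.1 h, Metric.mem_closedBall] at hz
        rw [hd] at hz
        linarith
      · intro z hz
        refine DifferentiableAt.inv (by fun_prop) ?_
        rintro h
        have hz := hz.1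
        rw [sub_eq_zero.1 h, Metric.mem_ball] at hz
        rw [hd] at hz
        linarith
    rw [h5, mul_zero]

end

/-! ### Band contours -/

section

variable {J : Type*} {σ : J → Set ℝ} (κ : SeparatingCircles σ) {T : L2 →ₗ.[ℂ] L2}

theorem SeparatingCircles.le_norm_sub {n : ℤ} (hn : n ∈ κ.idx) {z : ℂ}
    (hz : ‖z - κ.c n‖ = |κ.r n|) {j : J} {x : ℝ} (hx : x ∈ σ j) : κ.δ ≤ ‖z - x‖ := by
  have h1 := κ.dist_le n hn j x hx
  rw [abs_of_pos (κ.r_pos n hn)] at hz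
  refine h1.trans ?_
  have h2 : ‖(x : ℂ) - κ.c n‖ = |x - κ.c n| := by
    rw [← Complex.ofReal_sub, Complex.norm_real, Real.norm_eq_abs]
  rw [← hz, ← h2]
  have := abs_norm_sub_norm_le ((x : ℂ) - κ.c n) (z - κ.c n)
  rwa [sub_sub_sub_cancel_right, norm_sub_rev (x : ℂ) z] at this

/-- The contour that consists of the circles with index in `F`. -/
def SeparatingCircles.contour (F : Finset ℤ) : Contour := circleContour F κ.c κ.r

variable (hT : IsSelfAdjoint T) (hS : opSpectrum T = ⋃ j, (fun x : ℝ => (x : ℂ)) '' σ j)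
  {F : Finset ℤ} (hF : ↑F ⊆ κ.idx)

include hT hS hF in
theorem SeparatingCircles.resolvent {z : ℂ} (hz : z ∈ (κ.contour F).support) :
    z ∉ opSpectrum T ∧ ‖opResolvent T z‖ ≤ 1 / κ.δ := by
  obtain ⟨n, hn, hz'⟩ := mem_circleContour_support F κ.c κ.r hz
  have h1 : ∀ x ∈ opSpectrum T, κ.δ ≤ ‖z - x‖ := by
    intro x hx
    rw [hS] at hx
    obtain ⟨j, y, hy, rfl⟩ := Set.mem_iUnion.1 hx
    exact κ.le_norm_sub (hF hn) hz' hy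
  have h2 : z ∉ opSpectrum T := fun h => by
    have := h1 z h
    rw [sub_self, norm_zero] at this
    exact absurd κ.δ_pos (not_lt.2 this)
  exact ⟨h2, norm_opResolvent_le hT h2 κ.δ_pos h1⟩

include hT hS hF in
theorem SeparatingCircles.admissible : Admissible T (κ.contour F) :=
  ⟨fun _ hz => (κ.resolvent hT hS hF hz).1, _, fun _ hz => (κ.resolvent hT hS hF hz).2⟩

include hF in
theorem SeparatingCircles.length_le {m : ℕ} (hm : F.card ≤ m) :
    (κ.contour F).length ≤ m * (2 * Real.pi * κ.L) := by
  rw [SeparatingCircles.contour, circleContour_length]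
  have hpi := Real.pi_pos
  have hL := κ.L_nonneg
  calc _ ≤ F.card • (2 * Real.pi * κ.L) := by
        refine Finset.sum_le_card_nsmul _ _ _ fun n hn => ?_
        rw [abs_of_pos (κ.r_pos n (hF hn))]
        exact mul_le_mul_of_nonneg_left (κ.r_le n (hF hn)) (by positivity)
    _ ≤ _ := by
        rw [nsmul_eq_mul]
        exact mul_le_mul_of_nonneg_right (by exact_mod_cast hm) (by positivity)

include hF in
theorem SeparatingCircles.ne_of_mem {n : ℤ} (hn : n ∈ F) {j : J} {x : ℝ} (hx : x ∈ σ j) :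
    0 < κ.r n ∧ |x - κ.c n| ≠ κ.r n := by
  refine ⟨κ.r_pos n (hF hn), fun h => ?_⟩
  have h1 := κ.dist_le n (hF hn) j x hx
  rw [h, sub_self, abs_zero] at h1
  exact absurd κ.δ_pos (not_lt.2 h1)

include hF in
theorem SeparatingCircles.windingNumber_eq_one {j : J} {x : ℝ} (hx : x ∈ σ j)
    (h : ∃ n ∈ F, |x - κ.c n| < κ.r n) : (κ.contour F).windingNumber x = 1 := by
  obtain ⟨n, hn, h1⟩ := h
  rw [SeparatingCircles.contour, circleContour_windingNumber
    (fun k hk => κ.ne_of_mem hF hk hx), Finset.sum_eq_single_of_mem n hn, if_pos h1]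
  intro k hk hkn
  rw [if_neg]
  exact fun h2 => hkn (κ.unique k (hF hk) n (hF hn) j x hx h2 h1)

include hF in
theorem SeparatingCircles.windingNumber_eq_zero {j : J} {x : ℝ} (hx : x ∈ σ j)
    (h : ∀ n ∈ F, ¬ |x - κ.c n| < κ.r n) : (κ.contour F).windingNumber x = 0 := by
  rw [SeparatingCircles.contour, circleContour_windingNumber
    (fun k hk => κ.ne_of_mem hF hk hx)]
  exact Finset.sum_eq_zero fun n hn => if_neg (h n hn)

end

section

variable {P V : L2 →L[ℂ] L2} {Xhat : L2 →ₗ.[ℂ] L2}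

/-- Uniform localization of the spectral subspaces of `P X̂ P` inside of `ran P`. -/
theorem exists_uniform_localization (hP : IsStarProjection P) {C₀ γ₁ : ℝ} (hC₀ : 0 < C₀)
    (hγ₁ : 0 < γ₁) (hk : HasExpKernel P C₀ γ₁) (hX : IsSelfAdjoint Xhat)
    (hdom : Xhat.domain = posX.domain)
    (hV : ∀ f (h : f ∈ posX.domain) (h' : f ∈ Xhat.domain), Xhat ⟨f, h'⟩ = posX ⟨f, h⟩ + V f)
    {γ₀ m : ℝ} (hγ₀ : 0 < γ₀) (hm : 0 ≤ m) (tV : Tilts V γ₀ m) {M L ℓ : ℝ} (hM : 0 ≤ M)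
    (hL : 0 ≤ L) (hℓ : 0 ≤ ℓ) :
    ∃ C s s₀ M', 0 < C ∧ 0 < s ∧ 0 < s₀ ∧ 0 ≤ M' ∧ ∀ (c : ℝ) (Γ : Contour),
      (∀ z ∈ Γ.support, z ∉ opSpectrum (compress P Xhat) ∧
        ‖opResolvent (compress P Xhat) z‖ ≤ M ∧ ‖z - c‖ ≤ L) → Γ.length ≤ ℓ →
      LineLocalized (rieszProj (compress P Xhat) Γ * P) c s₀ M' ∧
      HasExpKernel (rieszProj (compress P Xhat) Γ * P) C s ∧
      ∃ U, HasExpKernel U C s ∧ rieszProj (compress P Xhat) Γ * P = posRes c * U := by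
  obtain ⟨K, hKk, hK'⟩ := hk.exists_commutator hC₀.le hγ₁ 0
  have hK : HasCommutator posX P K := hK' _ fun _ _ => rfl
  obtain ⟨m₁, hm₁, tP⟩ := hk.exists_tilts hC₀.le hγ₁
  obtain ⟨m₃, hm₃, tK⟩ := hKk.exists_tilts (by positivity) (by positivity)
  have hX' : IsSelfAdjoint (compress (1 - P) Xhat) :=
    isSelfAdjoint_compress hX hP.one_sub (hK.of_perturbation hdom hV).one_sub
  set s₁ := min γ₀ (γ₁ / 2 / 2) with hs₁
  have h1 : s₁ ≤ γ₀ := min_le_left _ _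
  have h2 : s₁ ≤ γ₁ / 2 / 2 := min_le_right _ _
  obtain ⟨s₀, M', hs₀, -, hM', key⟩ := exists_lineLocalized hP hK hdom hV hX'
    (lt_min hγ₀ (by positivity)) hm₁ hm hm₃ (tP.mono (h2.trans (by linarith))) (tV.mono h1)
    (tK.mono h2) hM hL hℓ
  obtain ⟨C, s, hC, hs, key'⟩ := exists_hasExpKernel_of_lineLocalized hP
    (hk.mono hC₀.le le_rfl (by linarith : γ₁ / 2 ≤ γ₁)) hKk hK hC₀.le (by positivity)
    (by positivity) hs₀ hM'
  refine ⟨C, s, s₀, M', hC, hs, hs₀, hM', fun c Γ hΓ hlen => ?_⟩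
  have h3 := key c Γ hΓ hlen
  have hcomm : Commute P (rieszProj (compress P Xhat) Γ) :=
    commute_rieszProj ⟨fun z hz => (hΓ z hz).1, M, fun z hz => (hΓ z hz).2.1⟩
      fun z hz => commute_opResolvent_compress hP hz
  obtain ⟨h4, h5⟩ := key' _ c h3
    (by rw [← mul_assoc, hcomm.eq, mul_assoc, hP.isIdempotentElem.eq])
    (by rw [mul_assoc, hP.isIdempotentElem.eq])
  exact ⟨h3, h4, h5⟩

end

/-! ### Band projectors -/

section

variable {J : Type*} {σ : J → Set ℝ} {d D : ℝ} {T : L2 →ₗ.[ℂ] L2} {P : L2 →L[ℂ] L2}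

/-- The circles that meet a band separate it from all other bands. -/
theorem SeparatingCircles.windingNumber_band (κ : SeparatingCircles σ)
    {j : J} {F : Finset ℤ} (hF : ↑F ⊆ κ.idx)
    (h1 : ∀ n ∈ F, ∃ x ∈ σ j, |x - κ.c n| < κ.r n)
    (h2 : ∀ x ∈ σ j, ∃ n ∈ F, |x - κ.c n| < κ.r n) :
    (∀ x ∈ σ j, (κ.contour F).windingNumber x = 1) ∧
      ∀ k, k ≠ j → ∀ x ∈ σ k, (κ.contour F).windingNumber x = 0 := by
  refine ⟨fun x hx => κ.windingNumber_eq_one hF hx (h2 x hx), fun k hk x hx => ?_⟩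
  refine κ.windingNumber_eq_zero hF hx fun n hn h => ?_
  obtain ⟨y, hy, h3⟩ := h1 n hn
  exact hk (κ.band n (hF hn) k x hx j y hy h h3)

/-- The separating circles that meet a band are a contour for this band. -/
theorem exists_isBandProjectors (hT : IsSelfAdjoint T) (hσ : UniformSpectralGaps T σ d D)
    (κ : SeparatingCircles σ) : ∃ Q, IsBandProjectors P T σ d D Q := by
  choose F hF hcard hF1 hF2 using κ.cover_band
  -- `D + d > 0` unless `D` is negative, in which case there are no points in the bands at all
  refine ⟨_, fun j => κ.contour (F j), 1 / κ.δ * d,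
    if D < 0 then 0 else κ.m * (2 * Real.pi * κ.L) / (D + d), fun j => ⟨?_, ?_, ?_, ?_, ?_, rfl⟩⟩
  · exact Set.disjoint_left.2 fun z hz => (κ.resolvent hT hσ.spectrum_eq (hF j) hz).1
  · exact (κ.windingNumber_band (hF j) (hF1 j) (hF2 j)).1
  · exact (κ.windingNumber_band (hF j) (hF1 j) (hF2 j)).2
  · intro z hz
    rw [mul_assoc, mul_inv_cancel₀ hσ.pos.ne', mul_one]
    exact (κ.resolvent hT hσ.spectrum_eq (hF j) hz).2
  · have h1 := κ.length_le (hF j) (hcard j)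
    split_ifs with hD
    · -- all bands are empty, and so is the contour
      have h2 : F j = ∅ := by
        refine Finset.eq_empty_of_forall_notMem fun n hn => ?_
        obtain ⟨x, hx, -⟩ := hF1 j n hn
        have := hσ.diam j x hx x hx
        rw [sub_self, abs_zero] at this
        linarith
      change (circleContour (F j) κ.c κ.r).length ≤ _
      rw [circleContour_length, h2]
      simp
    · have := hσ.pos
      rw [div_mul_cancel₀ _ (by linarith)]
      exact h1

/-- The band projectors do not depend on the contours, which can be replaced by the separating
circles. -/
theorem IsBandProjectors.eq_rieszProj (hT : IsSelfAdjoint T) (hσ : UniformSpectralGaps T σ d D)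
    (κ : SeparatingCircles σ) {Q : J → L2 →L[ℂ] L2} (hQ : IsBandProjectors P T σ d D Q) {j : J}
    {F : Finset ℤ} (hF : ↑F ⊆ κ.idx)
    (h1 : ∀ n ∈ F, ∃ x ∈ σ j, |x - κ.c n| < κ.r n)
    (h2 : ∀ x ∈ σ j, ∃ n ∈ F, |x - κ.c n| < κ.r n) :
    Q j = P * (rieszProj T (κ.contour F) * P) := by
  obtain ⟨Γ, C, C', h⟩ := hQ
  obtain ⟨h3, h4, h5, h6, -, h7⟩ := h j
  obtain ⟨h8, h9⟩ := κ.windingNumber_band hF h1 h2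
  rw [h7, ← rieszProj_eq_of_windingNumber_eq hT
    ⟨fun z hz => Set.disjoint_left.1 h3 hz, _, h6⟩ (κ.admissible hT hσ.spectrum_eq hF) ?_]
  · rfl
  · intro x hx
    rw [hσ.spectrum_eq] at hx
    obtain ⟨k, y, hy, rfl⟩ := Set.mem_iUnion.1 hx
    rcases eq_or_ne k j with rfl | hk
    · rw [h4 y hy, h8 y hy]
    · rw [h5 k hk y hy, h9 k hk y hy]

end

theorem isStarProjection_rieszProj_mul {T : L2 →ₗ.[ℂ] L2} (hT : IsSelfAdjoint T) {P : L2 →L[ℂ] L2}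
    (hP : IsStarProjection P) (hcomm : ∀ z ∉ opSpectrum T, Commute P (opResolvent T z)) {Γ : Contour}
    (hΓ : Admissible T Γ)
    (h : ∀ x ∈ opSpectrum T, Γ.windingNumber x = 0 ∨ Γ.windingNumber x = 1) :
    IsStarProjection (rieszProj T Γ * P) :=
  (isStarProjection_rieszProj hT hΓ h).mul hP (commute_rieszProj hΓ hcomm).symm

/-- Uniform localization of the band projectors. The contours given with `Q` need not stay near the
bands, hence they are replaced by circles before the Combes–Thomas estimate is applied with a center
`c` in the band. -/
theorem UniformSpectralGaps.isUniformlyLocalized {J : Type*} {σ : J → Set ℝ} {d D : ℝ}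
    {P V : L2 →L[ℂ] L2} {Xhat : L2 →ₗ.[ℂ] L2} (hσ : UniformSpectralGaps (compress P Xhat) σ d D)
    (κ : SeparatingCircles σ) (hT : IsSelfAdjoint (compress P Xhat))
    (hP : IsStarProjection P) {C₀ γ₁ : ℝ} (hC₀ : 0 < C₀)
    (hγ₁ : 0 < γ₁) (hk : HasExpKernel P C₀ γ₁) (hX : IsSelfAdjoint Xhat)
    (hdom : Xhat.domain = posX.domain)
    (hV : ∀ f (h : f ∈ posX.domain) (h' : f ∈ Xhat.domain), Xhat ⟨f, h'⟩ = posX ⟨f, h⟩ + V f)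
    {γ₀ m : ℝ} (hγ₀ : 0 < γ₀) (hm : 0 ≤ m) (tV : Tilts V γ₀ m)
    {Q : J → L2 →L[ℂ] L2} (hQ : IsBandProjectors P (compress P Xhat) σ d D Q) :
    IsUniformlyLocalized σ Q := by
  have hL0 := κ.L_nonneg
  have hδ := κ.δ_pos
  have hpi := Real.pi_pos
  obtain ⟨C, s, s₀, M', hC, hs, hs₀, hM', key⟩ := exists_uniform_localization hP hC₀ hγ₁ hk hX hdom
    hV hγ₀ hm tV (M := 1 / κ.δ) (L := 2 * κ.L + |D|) (ℓ := κ.m * (2 * Real.pi * κ.L))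
    (by positivity) (by positivity) (by positivity)
  refine ⟨C, M' * (2 + |D|) + 1, min s s₀, hC, by positivity, lt_min hs hs₀, fun j => ?_⟩
  obtain ⟨F, hF, hcard, hF1, hF2⟩ := κ.cover_band j
  obtain ⟨c, hc1, hc2⟩ : ∃ c : ℝ, (∀ x ∈ σ j, |x - c| ≤ |D|) ∧
      ∀ n ∈ F, |κ.c n - c| ≤ κ.L + |D| := by
    rcases (σ j).eq_empty_or_nonempty with h0 | ⟨x₀, hx₀⟩
    · refine ⟨0, by simp [h0], fun n hn => ?_⟩
      obtain ⟨x, hx, -⟩ := hF1 n hn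
      simp [h0] at hx
    · have h1 : ∀ x ∈ σ j, |x - x₀| ≤ |D| := fun x hx =>
        (hσ.diam j x hx x₀ hx₀).trans (le_abs_self D)
      refine ⟨x₀, h1, fun n hn => ?_⟩
      obtain ⟨x, hx, h2⟩ := hF1 n hn
      calc |κ.c n - x₀| ≤ |κ.c n - x| + |x - x₀| := abs_sub_le _ _ _
        _ ≤ κ.L + |D| := by
          rw [abs_sub_comm]
          exact add_le_add (h2.le.trans (κ.r_le n (hF hn))) (h1 x hx)
  have hres := fun z hz => κ.resolvent hT hσ.spectrum_eq hF (z := z) hz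
  obtain ⟨k1, k2, -⟩ := key c (κ.contour F) (fun z hz => ⟨(hres z hz).1, (hres z hz).2, by
    obtain ⟨n, hn, h1⟩ := mem_circleContour_support F κ.c κ.r hz
    rw [abs_of_pos (κ.r_pos n (hF hn))] at h1
    calc ‖z - c‖ ≤ ‖z - κ.c n‖ + ‖(κ.c n : ℂ) - c‖ := norm_sub_le_norm_sub_add_norm_sub _ _ _
      _ ≤ κ.L + (κ.L + |D|) := by
        rw [h1, ← Complex.ofReal_sub, Complex.norm_real, Real.norm_eq_abs]
        exact add_le_add (κ.r_le n (hF hn)) (hc2 n hn)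
      _ = 2 * κ.L + |D| := by ring⟩) (κ.length_le hF hcard)
  have hcomm : ∀ z ∉ opSpectrum (compress P Xhat), Commute P (opResolvent (compress P Xhat) z) :=
    fun z hz => commute_opResolvent_compress hP hz
  have hadm := κ.admissible hT hσ.spectrum_eq hF
  have hQj : Q j = rieszProj (compress P Xhat) (κ.contour F) * P := by
    rw [hQ.eq_rieszProj hT hσ κ hF hF1 hF2, ← mul_assoc, (commute_rieszProj hadm hcomm).eq,
      mul_assoc, hP.isIdempotentElem.eq]
  obtain ⟨h8, h9⟩ := κ.windingNumber_band hF hF1 hF2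
  rw [hQj]
  refine ⟨isStarProjection_rieszProj_mul hT hP hcomm hadm fun x hx => ?_,
    k2.mono hC.le le_rfl (min_le_left _ _), fun η hη γ hγ a => ?_⟩
  · rw [hσ.spectrum_eq] at hx
    obtain ⟨k, y, hy, rfl⟩ := Set.mem_iUnion.1 hx
    rcases eq_or_ne k j with rfl | hk
    · exact Or.inr (h8 y hy)
    · exact Or.inl (h9 k hk y hy)
  · obtain ⟨⟨e1, e2, e3⟩, e4, e5, e6⟩ :=
      k1.normLE hM' (hc1 η hη) ⟨hγ.1, hγ.2.trans (min_le_right _ _)⟩ a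
    have mono : ∀ f : L2, M' * (2 + |D|) * ‖f‖ ≤ (M' * (2 + |D|) + 1) * ‖f‖ := fun f =>
      mul_le_mul_of_nonneg_right (by linarith) (norm_nonneg f)
    exact ⟨⟨e1, e2, fun f => (e3 f).trans (mono f)⟩, e4, e5, fun f => (e6 f).trans (mono f)⟩

/-! ### Concentration in boxes -/

/-- `f` is concentrated near the point `c`, in the sense that `(x_i - c_i) f` is square-integrable
with norm at most `M ‖f‖`. -/
def Concentrated (f : L2) (c : Plane) (M : ℝ) : Prop :=
  ∀ i, ∃ g : L2, (g =ᵐ[volume] fun x => ((x i - c i : ℝ) : ℂ) * f x) ∧ ‖g‖ ≤ M * ‖f‖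

theorem measurableSet_weight_le (c : Plane) (W : ℝ) : MeasurableSet {x | weight c x ≤ W} :=
  measurableSet_le (measurable_weight c) measurable_const

/-- Chebyshev's inequality: at least half of the mass of a concentrated function lies in a fixed
box. -/
theorem Concentrated.norm_sq_le {f : L2} {c : Plane} {M : ℝ} (hM : 0 < M)
    (h : Concentrated f c M) : ENNReal.ofReal (‖f‖ ^ 2) ≤
      2 * ∫⁻ x in {x | weight c x ≤ Real.sqrt (1 + 4 * M ^ 2)}, ‖f x‖ₑ ^ 2 := by
  obtain ⟨g₀, h0, n0⟩ := h 0
  obtain ⟨g₁, h1, n1⟩ := h 1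
  set B := {x | weight c x ≤ Real.sqrt (1 + 4 * M ^ 2)} with hB
  have hBm : MeasurableSet B := measurableSet_weight_le _ _
  have htot : (∫⁻ x in B, ‖f x‖ₑ ^ 2) + ∫⁻ x in Bᶜ, ‖f x‖ₑ ^ 2 = ENNReal.ofReal (‖f‖ ^ 2) := by
    rw [lintegral_add_compl _ hBm, ofReal_norm_sq]
  have hle : ENNReal.ofReal (4 * M ^ 2) * ∫⁻ x in Bᶜ, ‖f x‖ₑ ^ 2 ≤
      ENNReal.ofReal (2 * M ^ 2 * ‖f‖ ^ 2) := by
    have hm : AEMeasurable (fun x => ‖f x‖ₑ ^ 2) (volume : Measure Plane) :=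
      ((Lp.aestronglyMeasurable f).enorm).pow_const 2
    calc ENNReal.ofReal (4 * M ^ 2) * ∫⁻ x in Bᶜ, ‖f x‖ₑ ^ 2
        = ∫⁻ x in Bᶜ, ENNReal.ofReal (4 * M ^ 2) * ‖f x‖ₑ ^ 2 :=
          (lintegral_const_mul'' _ hm.restrict).symm
      _ ≤ ∫⁻ x in Bᶜ, (‖g₀ x‖ₑ ^ 2 + ‖g₁ x‖ₑ ^ 2) := by
          refine lintegral_mono_ae ?_
          filter_upwards [ae_restrict_mem hBm.compl, ae_restrict_of_ae h0, ae_restrict_of_ae h1]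
            with x hx e0 e1
          rw [e0, e1, enorm_mul, enorm_mul, mul_pow, mul_pow, ← add_mul]
          refine mul_le_mul_left ?_ _
          rw [← ofReal_norm, ← ofReal_norm, Complex.norm_real, Complex.norm_real,
            ← ENNReal.ofReal_pow (norm_nonneg _), ← ENNReal.ofReal_pow (norm_nonneg _),
            ← ENNReal.ofReal_add (by positivity) (by positivity), Real.norm_eq_abs,
            Real.norm_eq_abs, sq_abs, sq_abs]
          refine ENNReal.ofReal_le_ofReal ?_
          have h2 : Real.sqrt (1 + 4 * M ^ 2) < weight c x := not_le.1 hx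
          rw [weight, Real.sqrt_lt_sqrt_iff (by positivity)] at h2
          linarith
      _ ≤ ∫⁻ x, (‖g₀ x‖ₑ ^ 2 + ‖g₁ x‖ₑ ^ 2) := setLIntegral_le_lintegral _ _
      _ = ENNReal.ofReal (‖g₀‖ ^ 2) + ENNReal.ofReal (‖g₁‖ ^ 2) := by
          rw [lintegral_add_left' (((Lp.aestronglyMeasurable g₀).enorm).pow_const 2),
            ofReal_norm_sq, ofReal_norm_sq]
      _ ≤ ENNReal.ofReal (2 * M ^ 2 * ‖f‖ ^ 2) := by
          rw [← ENNReal.ofReal_add (by positivity) (by positivity)]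
          refine ENNReal.ofReal_le_ofReal ?_
          have k0 := pow_le_pow_left₀ (norm_nonneg _) n0 2
          have k1 := pow_le_pow_left₀ (norm_nonneg _) n1 2
          rw [mul_pow] at k0 k1
          linarith
  have hfin : ∀ s : Set Plane, ∫⁻ x in s, ‖f x‖ₑ ^ 2 ≠ ⊤ := fun s => by
    refine ne_top_of_le_ne_top (ENNReal.ofReal_ne_top (r := ‖f‖ ^ 2)) ?_
    rw [ofReal_norm_sq]
    exact setLIntegral_le_lintegral _ _
  rw [← ENNReal.ofReal_toReal (hfin B), ← ENNReal.ofReal_toReal (hfin Bᶜ),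
    ← ENNReal.ofReal_add (by positivity) (by positivity)] at htot
  rw [← ENNReal.ofReal_toReal (hfin Bᶜ), ← ENNReal.ofReal_mul (by positivity),
    ENNReal.ofReal_le_ofReal_iff (by positivity)] at hle
  rw [ENNReal.ofReal_eq_ofReal_iff (by positivity) (by positivity)] at htot
  rw [← ENNReal.ofReal_toReal (hfin B), two_mul,
    ← ENNReal.ofReal_add (by positivity) (by positivity)]
  refine ENNReal.ofReal_le_ofReal ?_
  have hM2 : 0 < M ^ 2 := by positivity
  nlinarith

theorem volume_weight_le_lt_top (c : Plane) (W : ℝ) :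
    (volume : Measure Plane) {x | weight c x ≤ W} < ⊤ := by
  refine lt_of_le_of_lt (measure_mono (t := Metric.closedBall c W) fun x hx => ?_)
    measure_closedBall_lt_top
  rw [Metric.mem_closedBall, dist_eq_norm]
  exact (norm_sub_le_weight c x).trans hx

/-- A space of uniformly concentrated functions in the range of a projection with a localized kernel
is finite-dimensional: the mass of an orthonormal family in a box is bounded by the local trace of
the projection. -/
theorem finiteDimensional_of_concentrated {Q : L2 →L[ℂ] L2} {C γ : ℝ} (hC : 0 ≤ C) (hγ : 0 < γ)
    (hQ : HasExpKernel Q C γ) {V : Submodule ℂ L2} {c : Plane} {M : ℝ} (hM : 0 < M)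
    (hV : ∀ v ∈ V, Q v = v ∧ Concentrated v c M) : FiniteDimensional ℂ V := by
  obtain ⟨u, -, hu, hub⟩ := hQ.exists_sections hγ
  set B := {x | weight c x ≤ Real.sqrt (1 + 4 * M ^ 2)} with hB
  have hvol : (volume : Measure Plane) B ≠ ⊤ := (volume_weight_le_lt_top c _).ne
  obtain ⟨b, hb0, hb⟩ : ∃ b : ℝ, 0 ≤ b ∧ ∀ᵐ x, ‖u x‖ ≤ b := by
    refine ⟨C * Real.sqrt (expInt (2 * γ)), by positivity, ?_⟩
    filter_upwards [hub] with x hx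
    exact norm_le_of_exp_bound (γ := 2 * γ) hC (by positivity) x (by
      filter_upwards [hx] with y hy
      rwa [mul_div_cancel_left₀ _ (two_ne_zero)])
  have key : ∀ (k : ℕ) (e : Fin k → L2), Orthonormal ℂ e → (∀ i, e i ∈ V) →
      (k : ENNReal) ≤ 2 * (ENNReal.ofReal (b ^ 2) * volume B) := by
    intro k e he heV
    have h1 : ∀ i, (1 : ENNReal) ≤ 2 * ∫⁻ x in B, ‖e i x‖ₑ ^ 2 := fun i => by
      have := (hV _ (heV i)).2.norm_sq_le hM
      rwa [he.1 i, one_pow, ENNReal.ofReal_one] at this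
    have hm : ∀ i, AEMeasurable (fun x => ‖e i x‖ₑ ^ 2) (volume.restrict B) := fun i =>
      (((Lp.aestronglyMeasurable (e i)).enorm).pow_const 2).restrict
    calc (k : ENNReal) = ∑ _i : Fin k, 1 := by simp
      _ ≤ ∑ i, 2 * ∫⁻ x in B, ‖e i x‖ₑ ^ 2 := Finset.sum_le_sum fun i _ => h1 i
      _ = 2 * ∫⁻ x in B, ∑ i, ‖e i x‖ₑ ^ 2 := by
          rw [← Finset.mul_sum, lintegral_finsetSum' _ fun i _ => hm i]
      _ ≤ 2 * ∫⁻ _ in B, ENNReal.ofReal (b ^ 2) := by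
          refine mul_le_mul_right (lintegral_mono_ae (ae_restrict_of_ae ?_)) _
          filter_upwards [hb, ae_all_iff.2 fun i => hu (e i)] with x hx hx'
          have h2 : ∀ i, ‖e i x‖ₑ ^ 2 = ENNReal.ofReal (‖inner ℂ (e i) (u x)‖ ^ 2) := fun i => by
            have := hx' i
            rw [(hV _ (heV i)).1] at this
            rw [this, ← ofReal_norm, ← ENNReal.ofReal_pow (norm_nonneg _), norm_inner_symm]
          simp only [h2]
          rw [← ENNReal.ofReal_sum_of_nonneg fun i _ => by positivity]
          exact ENNReal.ofReal_le_ofReal ((he.sum_inner_products_le (u x)).trans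
            (pow_le_pow_left₀ (norm_nonneg _) hx 2))
      _ = _ := by rw [setLIntegral_const]
  obtain ⟨n, hn⟩ := ENNReal.exists_nat_gt
    (ENNReal.mul_ne_top (by simp : (2 : ENNReal) ≠ ⊤)
      (ENNReal.mul_ne_top (ENNReal.ofReal_ne_top (r := b ^ 2)) hvol))
  -- linearly independent families are replaced by an orthonormal basis of their span
  have hrank : Module.rank ℂ V ≤ n := by
    refine rank_le fun s hs => ?_
    have h2 : Module.finrank ℂ (Submodule.span ℂ (Set.range fun i : s => (i : V))) = s.card := by
      rw [finrank_span_eq_card hs, Fintype.card_coe]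
    set W := Submodule.span ℂ (Set.range fun i : s => (i : V)) with hW
    have : FiniteDimensional ℂ W := FiniteDimensional.span_of_finite ℂ (Set.finite_range _)
    have he := (stdOrthonormalBasis ℂ W).orthonormal
    have he' := (he.comp_linearIsometry W.subtypeₗᵢ).comp_linearIsometry V.subtypeₗᵢ
    have h3 := key _ _ he' fun i => SetLike.coe_mem _
    rw [h2] at h3
    have h4 : (s.card : ENNReal) < n := h3.trans_lt hn
    exact_mod_cast h4.le
  exact Module.rank_lt_aleph0_iff.1 (hrank.trans_lt (Cardinal.natCast_lt_aleph0))

/-- Exponential decay of a function which satisfies linear equations `(x_i - c_i) ψ = A_i ψ` with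
localized operators `A_i`: conjugation with a truncated exponential weight preserves the form of the
equations, hence the function `e^{sρ} ψ` is concentrated in a box which does not depend on the
truncation. -/
theorem exists_lintegral_exp_weight_le {C γ : ℝ} (hC : 0 ≤ C) (hγ : 0 < γ) :
    ∃ D, 0 < D ∧ ∀ (A₀ A₁ : L2 →L[ℂ] L2) (ψ : L2) (c : Plane), HasExpKernel A₀ C γ →
      HasExpKernel A₁ C γ → ‖ψ‖ = 1 →
      (A₀ ψ =ᵐ[volume] fun x => ((x 0 - c 0 : ℝ) + Complex.I) * ψ x) →
      (A₁ ψ =ᵐ[volume] fun x => ((x 1 - c 1 : ℝ) : ℂ) * ψ x) →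
      ∫⁻ x, ENNReal.ofReal (Real.exp (2 * (γ / 2) * weight c x) * ‖ψ x‖ ^ 2) ≤
        ENNReal.ofReal D := by
  have hI := expInt_nonneg γ
  have hI' := expInt_nonneg (γ / 4)
  set s := γ / 2 with hs
  have hs0 : 0 ≤ s := by positivity
  set M := C * expInt γ + C * (4 / γ) * expInt (γ / 4) * s + 1 with hM
  have hM0 : 0 < M := by positivity
  set W := Real.sqrt (1 + 4 * M ^ 2) with hW
  refine ⟨2 * Real.exp (2 * s * W), by positivity, fun A₀ A₁ ψ c h0 h1 hψ e0 e1 => ?_⟩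
  -- the truncated weights
  let ρ : ℕ → Plane → ℝ := fun m x => min (weight c x) m
  have hρm : ∀ m, Measurable (ρ m) := fun m => (measurable_weight c).min measurable_const
  have hρ0 : ∀ m x, 0 ≤ ρ m x := fun m x => le_min (weight_nonneg c x) m.cast_nonneg
  have hρL : ∀ m x y, |ρ m x - ρ m y| ≤ ‖x - y‖ := fun m x y =>
    (abs_min_sub_min_le_max _ _ _ _).trans (by
      rw [sub_self, abs_zero]
      exact max_le (abs_weight_sub_le c x y) (norm_nonneg _))
  have hb : ∀ m, BddMeas fun x => (Real.exp (s * ρ m x) : ℂ) := fun m => by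
    have := hρm m
    refine ⟨by fun_prop, Real.exp (s * m), fun x => ?_⟩
    rw [Complex.norm_real, Real.norm_of_nonneg (Real.exp_pos _).le]
    exact Real.exp_le_exp.2 (mul_le_mul_of_nonneg_left (min_le_right _ _) hs0)
  have hbi : ∀ m, BddMeas fun x => (Real.exp (-s * ρ m x) : ℂ) := fun m =>
    bddMeas_exp (hρm m) fun x => mul_nonneg hs0 (hρ0 m x)
  have key : ∀ m, ∫⁻ x, ENNReal.ofReal (Real.exp (2 * s * ρ m x) * ‖ψ x‖ ^ 2) ≤
      ENNReal.ofReal (2 * Real.exp (2 * s * W)) := by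
    intro m
    set φ := bmul (fun x => (Real.exp (s * ρ m x) : ℂ)) ψ with hφ
    have hφx := bmul_coe (hb m) ψ
    have hEφ : expMul s (ρ m) φ = ψ := by
      refine Lp.ext ?_
      filter_upwards [bmul_coe (hbi m) φ, hφx] with x h2 h3
      rw [expMul, h2, h3, ← mul_assoc, ← Complex.ofReal_mul, ← Real.exp_add]
      simp
    have tilt_eq : ∀ {A A' : L2 →L[ℂ] L2} {q : Plane → ℂ},
        A ∘L expMul s (ρ m) = expMul s (ρ m) ∘L A' → (A ψ =ᵐ[volume] fun x => q x * ψ x) →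
        A' φ =ᵐ[volume] fun x => q x * φ x := by
      intro A A' q hA hq
      have h2 : A ψ = expMul s (ρ m) (A' φ) := by
        rw [← hEφ]
        exact DFunLike.congr_fun hA φ
      filter_upwards [hq, bmul_coe (hbi m) (A' φ), hφx] with x h3 h4 h5
      rw [h2, expMul, h4] at h3
      rw [h5, mul_left_comm, ← h3, ← mul_assoc, ← Complex.ofReal_mul, ← Real.exp_add]
      simp
    have hn : ∀ {A A' : L2 →L[ℂ] L2}, HasExpKernel A C γ →
        ‖A' - A‖ ≤ C * (4 / γ) * expInt (γ / 4) * s → ‖A'‖ ≤ M - 1 := by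
      intro A A' hA h2
      have h3 := hA.norm_le hC hγ
      have h4 : ‖A'‖ ≤ ‖A‖ + ‖A' - A‖ := norm_le_insert' A' A
      linarith
    obtain ⟨A₀', t0, n0⟩ := h0.exists_tilt hC hγ (hρm m) (hρ0 m) (hρL m) hs0 le_rfl
    obtain ⟨A₁', t1, n1⟩ := h1.exists_tilt hC hγ (hρm m) (hρ0 m) (hρL m) hs0 le_rfl
    have hconc : Concentrated φ c M := by
      intro i
      fin_cases i
      · refine ⟨A₀' φ - Complex.I • φ, ?_, ?_⟩
        · filter_upwards [tilt_eq t0 e0, Lp.coeFn_sub (A₀' φ) (Complex.I • φ),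
            Lp.coeFn_smul Complex.I φ] with x h2 h3 h4
          rw [h3, Pi.sub_apply, h2, h4, Pi.smul_apply, smul_eq_mul, ← sub_mul, add_sub_cancel_right]
          rfl
        · refine (norm_sub_le _ _).trans ?_
          rw [norm_smul, Complex.norm_I]
          have := A₀'.le_of_opNorm_le (hn h0 n0) φ
          linarith
      · refine ⟨A₁' φ, tilt_eq t1 e1, (A₁'.le_of_opNorm_le (hn h1 n1) φ).trans ?_⟩
        exact mul_le_mul_of_nonneg_right (by linarith) (norm_nonneg _)
    have hφe : ∀ᵐ x, ‖φ x‖ₑ ^ 2 = ENNReal.ofReal (Real.exp (2 * s * ρ m x) * ‖ψ x‖ ^ 2) := by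
      filter_upwards [hφx] with x h2
      rw [h2, ← ofReal_norm, ← ENNReal.ofReal_pow (norm_nonneg _), norm_mul, Complex.norm_real,
        Real.norm_of_nonneg (Real.exp_pos _).le, mul_pow, ← Real.exp_nat_mul]
      congr 3
      push_cast
      ring
    rw [← lintegral_congr_ae hφe, ← ofReal_norm_sq]
    refine (hconc.norm_sq_le hM0).trans ?_
    rw [ENNReal.ofReal_mul zero_le_two, ENNReal.ofReal_ofNat]
    refine mul_le_mul_right ?_ _
    calc ∫⁻ x in {x | weight c x ≤ W}, ‖φ x‖ₑ ^ 2
        ≤ ∫⁻ x in {x | weight c x ≤ W}, ENNReal.ofReal (Real.exp (2 * s * W)) * ‖ψ x‖ₑ ^ 2 := by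
          refine lintegral_mono_ae ?_
          filter_upwards [ae_restrict_mem (measurableSet_weight_le c W),
            ae_restrict_of_ae hφe] with x h2 h3
          rw [h3, ENNReal.ofReal_mul (Real.exp_pos _).le, ENNReal.ofReal_pow (norm_nonneg _),
            ofReal_norm]
          refine mul_le_mul_left (ENNReal.ofReal_le_ofReal (Real.exp_le_exp.2 ?_)) _
          exact mul_le_mul_of_nonneg_left ((min_le_left _ _).trans h2) (by positivity)
      _ ≤ ∫⁻ x, ENNReal.ofReal (Real.exp (2 * s * W)) * ‖ψ x‖ₑ ^ 2 := setLIntegral_le_lintegral _ _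
      _ = ENNReal.ofReal (Real.exp (2 * s * W)) := by
          rw [lintegral_const_mul' _ _ ENNReal.ofReal_ne_top, ← ofReal_norm_sq, hψ]
          simp
  -- remove the truncation
  have hsup : ∀ x, ENNReal.ofReal (Real.exp (2 * s * weight c x) * ‖ψ x‖ ^ 2) ≤
      ⨆ m : ℕ, ENNReal.ofReal (Real.exp (2 * s * ρ m x) * ‖ψ x‖ ^ 2) := fun x => by
    obtain ⟨m, hm⟩ := exists_nat_ge (weight c x)
    refine le_trans ?_ (le_iSup _ m)
    simp only [ρ, min_eq_left hm, le_refl]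
  refine (lintegral_mono hsup).trans ?_
  rw [lintegral_iSup']
  · exact iSup_le key
  · intro m
    have := hρm m
    exact ((by fun_prop : Measurable fun x => Real.exp (2 * s * ρ m x)).aemeasurable.mul
      ((Lp.aestronglyMeasurable ψ).norm.aemeasurable.pow_const 2)).ennreal_ofReal
  · refine Filter.Eventually.of_forall fun x m m' hmm => ENNReal.ofReal_le_ofReal ?_
    refine mul_le_mul_of_nonneg_right (Real.exp_le_exp.2 (mul_le_mul_of_nonneg_left ?_
      (by positivity))) (by positivity)
    exact min_le_min_left _ (by exact_mod_cast hmm)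

/-! ### Eigenvectors of normal operators -/

/-- A nonzero normal operator which is of finite rank away from `0` has an eigenvector. -/
theorem exists_eigenvector_of_isStarNormal {N : L2 →L[ℂ] L2} (hN : IsStarNormal N) (h0 : N ≠ 0)
    (hfin : ∀ (κ : ℝ) (V : Submodule ℂ L2), (∀ v ∈ V, ∃ w, N w = v ∧ ‖w‖ ≤ κ * ‖v‖) →
      FiniteDimensional ℂ V) :
    ∃ (μ : ℂ) (v : L2), μ ≠ 0 ∧ v ≠ 0 ∧ N v = μ • v := by
  have : Nontrivial L2 := by
    by_contra h
    rw [not_nontrivial_iff_subsingleton] at h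
    exact h0 (ContinuousLinearMap.ext fun f => Subsingleton.elim _ _)
  set r := ‖N‖ / 2 with hr
  have hr0 : 0 < r := by
    have := norm_pos_iff.2 h0
    positivity
  -- a cutoff near `0`, and the inverse function outside of the cutoff
  let g : ℂ → ℂ := fun z => (max 0 (‖z‖ - r) : ℝ)
  let k : ℂ → ℂ := fun z => (starRingEnd ℂ) z * ((max (‖z‖ ^ 2) (r ^ 2) : ℝ) : ℂ)⁻¹
  have hpos : ∀ z : ℂ, 0 < max (‖z‖ ^ 2) (r ^ 2) := fun z => lt_max_of_lt_right (by positivity)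
  have hg : Continuous g := by fun_prop
  have hk : Continuous k := by
    refine (Complex.continuous_conj).mul (Continuous.inv₀ (by fun_prop) fun z => ?_)
    exact Complex.ofReal_ne_zero.2 (hpos z).ne'
  have hkg : ∀ z, z * (k z * g z) = g z := by
    intro z
    by_cases hz : ‖z‖ ≤ r
    · have : g z = 0 := by
        simp only [g]
        rw [max_eq_left (by linarith), Complex.ofReal_zero]
      rw [this, mul_zero, mul_zero]
    · push Not at hz
      have h1 : max (‖z‖ ^ 2) (r ^ 2) = ‖z‖ ^ 2 :=
        max_eq_left (pow_le_pow_left₀ hr0.le hz.le 2)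
      have h2 : z ≠ 0 := norm_pos_iff.1 (hr0.trans hz)
      have h3 : z * k z = 1 := by
        simp only [k]
        rw [h1, ← mul_assoc, Complex.mul_conj, Complex.normSq_eq_norm_sq]
        exact mul_inv_cancel₀ (Complex.ofReal_ne_zero.2 (by positivity))
      rw [← mul_assoc, h3, one_mul]
  set G := cfc g N with hG
  set K := cfc k N with hK
  have hNG : N * (K * G) = G := by
    calc N * (K * G) = cfc (fun z : ℂ => z) N * (cfc k N * cfc g N) := by rw [cfc_id' ℂ N]
      _ = cfc (fun z => z * (k z * g z)) N := by
        rw [← cfc_mul k g N hk.continuousOn hg.continuousOn,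
          ← cfc_mul (fun z : ℂ => z) (fun z => k z * g z) N continuousOn_id
            (hk.mul hg).continuousOn]
      _ = G := by simp only [hkg, hG]
  have hNcomm : Commute N G := by
    have := cfc_commute_cfc (fun z : ℂ => z) g N
    rwa [cfc_id' ℂ N] at this
  have hNK : Commute N K := by
    have := cfc_commute_cfc (fun z : ℂ => z) k N
    rwa [cfc_id' ℂ N] at this
  have hG0 : G ≠ 0 := by
    intro hG0
    obtain ⟨z, hz, hz'⟩ := spectrum.exists_nnnorm_eq_spectralRadius N
    rw [IsStarNormal.spectralRadius_eq_nnnorm N] at hz'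
    have hz2 : ‖z‖ = ‖N‖ := congrArg NNReal.toReal (ENNReal.coe_injective hz')
    have h1 := norm_apply_le_norm_cfc g N hz hg.continuousOn
    rw [← hG, hG0, norm_zero] at h1
    simp only [g, Complex.norm_real] at h1
    rw [max_eq_right (by rw [hz2]; linarith), Real.norm_of_nonneg (by rw [hz2]; linarith),
      hz2] at h1
    linarith
  set V : Submodule ℂ L2 := G.toLinearMap.range with hV
  have hNKv : ∀ v ∈ V, N (K v) = v := by
    rintro _ ⟨x, rfl⟩
    exact DFunLike.congr_fun hNG x
  have : FiniteDimensional ℂ V := hfin ‖K‖ V fun v hv => ⟨K v, hNKv v hv, K.le_opNorm v⟩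
  have hinv : ∀ v ∈ V, N.toLinearMap v ∈ V := by
    rintro _ ⟨x, rfl⟩
    exact ⟨N x, (DFunLike.congr_fun hNcomm.eq x).symm⟩
  have : Nontrivial V := by
    rw [Submodule.nontrivial_iff_ne_bot]
    intro h
    refine hG0 (ContinuousLinearMap.ext fun x => ?_)
    have h1 : G x ∈ V := ⟨x, rfl⟩
    rw [h] at h1
    exact (Submodule.mem_bot ℂ).1 h1
  -- the range of the cutoff `G` is invariant under `N`, nonzero and finite-dimensional
  obtain ⟨μ, hμ⟩ := Module.End.exists_eigenvalue (N.toLinearMap.restrict hinv)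
  obtain ⟨v, hv⟩ := hμ.exists_hasEigenvector
  have h1 : N v = μ • (v : L2) := congrArg Subtype.val hv.apply_eq_smul
  have h2 : (v : L2) ≠ 0 := fun h => hv.2 (Subtype.ext h)
  refine ⟨μ, v, fun hμ0 => h2 ?_, h2, h1⟩
  have h3 : N (K (v : L2)) = K (N (v : L2)) := DFunLike.congr_fun hNK.eq (v : L2)
  rw [← hNKv v v.2, h3, h1, hμ0, zero_smul, map_zero]

/-- A bounded operator commutes with the projection onto a subspace that is invariant under the
operator and its adjoint. -/
theorem commute_starProjection {A : L2 →L[ℂ] L2} {M : Submodule ℂ L2} [M.HasOrthogonalProjection]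
    (h : ∀ f ∈ M, A f ∈ M) (h' : ∀ f ∈ M, star A f ∈ M) : Commute A M.starProjection := by
  ext1 f
  change A (M.starProjection f) = M.starProjection (A f)
  have h1 : A (f - M.starProjection f) ∈ Mᗮ := by
    rw [Submodule.mem_orthogonal]
    intro g hg
    rw [← ContinuousLinearMap.adjoint_inner_left, ← ContinuousLinearMap.star_eq_adjoint]
    exact (Submodule.mem_orthogonal _ _).1 (M.sub_starProjection_mem_orthogonal f) _ (h' g hg)
  have h2 : M.starProjection (A (f - M.starProjection f)) = 0 :=
    (Submodule.starProjection_apply_eq_zero_iff M).2 h1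
  have h3 : M.starProjection (A (M.starProjection f)) = A (M.starProjection f) :=
    Submodule.starProjection_eq_self_iff.2 (h _ (M.starProjection_apply_mem f))
  rw [map_sub, map_sub, h3, sub_eq_zero] at h2
  exact h2.symm

/-- The resolvent preserves the orthogonal complement of an eigenvector. -/
theorem inner_resolvent_eq_zero {T : L2 →ₗ.[ℂ] L2} (hT : IsSelfAdjoint T) {z : ℂ} (hz : z.im ≠ 0)
    {ψ : L2} {t : ℝ} {hψ : ψ ∈ T.domain} (h : T ⟨ψ, hψ⟩ = (t : ℂ) • ψ) {f : L2}
    (hf : inner ℂ ψ f = 0) : inner ℂ ψ (opResolvent T z f) = 0 := by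
  have hz0 := not_mem_opSpectrum_of_im_ne_zero hT hz
  have hz' : (starRingEnd ℂ) z ∉ opSpectrum T := conj_not_mem_opSpectrum hT hz0
  have h1 := (isResolventAt_opResolvent hz').2 ⟨ψ, hψ⟩
  rw [h, ← sub_smul, map_smul] at h1
  change ((starRingEnd ℂ) z - t) • opResolvent T ((starRingEnd ℂ) z) ψ = ψ at h1
  have h2 : (starRingEnd ℂ) z - t ≠ 0 := fun h => hz (by
    have := congrArg Complex.im h
    simpa using this)
  rw [← ContinuousLinearMap.adjoint_inner_left, ← ContinuousLinearMap.star_eq_adjoint,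
    star_opResolvent hT hz0 hz']
  rw [← h1, inner_smul_left, mul_eq_zero] at hf
  exact hf.resolve_left ((map_ne_zero _).2 h2)

/-- If a self-adjoint operator is of finite rank away from infinity inside the range of a
commuting projection, then this range has an orthonormal basis of eigenvectors. -/
theorem exists_eigenbasis {Q : L2 →L[ℂ] L2} (hQ : IsStarProjection Q) {T : L2 →ₗ.[ℂ] L2}
    (hT : IsSelfAdjoint T) (hcomm : ∀ z ∉ opSpectrum T, Commute Q (opResolvent T z))
    (hfin : ∀ (κ : ℝ) (V : Submodule ℂ L2),
      (∀ v ∈ V, ∃ w, Q w = w ∧ opResolvent T Complex.I w = v ∧ ‖w‖ ≤ κ * ‖v‖) →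
      FiniteDimensional ℂ V) :
    ∃ b : Set L2, Orthonormal ℂ (Subtype.val : b → L2) ∧
      (∀ ψ ∈ b, Q ψ = ψ ∧ ∃ (t : ℝ) (h : ψ ∈ T.domain), T ⟨ψ, h⟩ = (t : ℂ) • ψ) ∧
      ∀ f, (∀ ψ ∈ b, inner ℂ ψ f = 0) → Q f = 0 := by
  have hI := I_not_mem_opSpectrum hT
  set R := opResolvent T Complex.I with hR
  let E : Set L2 := {ψ | Q ψ = ψ ∧ ∃ (t : ℝ) (h : ψ ∈ T.domain), T ⟨ψ, h⟩ = (t : ℂ) • ψ}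
  obtain ⟨b, hb⟩ := zorn_subset {b : Set L2 | Orthonormal ℂ (Subtype.val : b → L2) ∧ b ⊆ E}
    fun c hc hchain => ⟨⋃₀ c, ⟨orthonormal_sUnion_of_directed hchain.directedOn
      fun x hx => (hc hx).1, Set.sUnion_subset fun x hx => (hc hx).2⟩,
      fun _ => Set.subset_sUnion_of_mem⟩
  obtain ⟨⟨hb1, hb2⟩, hmax⟩ := hb
  refine ⟨b, hb1, hb2, ?_⟩
  -- the orthogonal complement of the eigenvectors in the range of `Q`
  let S : Submodule ℂ L2 := Submodule.span ℂ ((1 - Q).toLinearMap.range ∪ b)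
  let M := Sᗮ
  have hM : ∀ f, f ∈ M ↔ Q f = f ∧ ∀ ψ ∈ b, inner ℂ ψ f = 0 := by
    intro f
    constructor
    · intro hf
      rw [Submodule.mem_orthogonal] at hf
      refine ⟨?_, fun ψ hψ => hf ψ (Submodule.subset_span (Or.inr hψ))⟩
      have h1 := hf ((1 - Q) f) (Submodule.subset_span (Or.inl ⟨f, rfl⟩))
      rw [hQ.one_sub.inner_apply] at h1
      have h2 : inner ℂ ((1 - Q) f) ((1 - Q) f) = 0 := by
        rw [hQ.one_sub.inner_apply, hQ.one_sub.apply_apply]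
        exact h1
      rw [inner_self_eq_zero, sub_apply, one_apply_eq_self, sub_eq_zero] at h2
      exact h2.symm
    · rintro ⟨h1, h2⟩
      rw [Submodule.mem_orthogonal]
      intro g hg
      refine Submodule.span_induction (p := fun g _ => inner ℂ g f = 0) ?_ (inner_zero_left _) ?_ ?_ hg
      · rintro g (⟨g, rfl⟩ | hg)
        · change inner ℂ ((1 - Q) g) f = 0
          rw [hQ.one_sub.inner_apply, sub_apply, one_apply_eq_self, h1, sub_self, inner_zero_right]
        · exact h2 g hg
      · intro x y _ _ hx hy
        rw [inner_add_left, hx, hy, add_zero]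
      · intro a x _ hx
        rw [inner_smul_left, hx, mul_zero]
  set Z := M.starProjection with hZ
  have hRM : ∀ z : ℂ, z.im ≠ 0 → ∀ f ∈ M, opResolvent T z f ∈ M := by
    intro z hz f hf
    rw [hM] at hf ⊢
    refine ⟨?_, fun ψ hψ => ?_⟩
    · have := DFunLike.congr_fun (hcomm z (not_mem_opSpectrum_of_im_ne_zero hT hz)).eq f
      change Q (opResolvent T z f) = opResolvent T z (Q f) at this
      rw [this, hf.1]
    · obtain ⟨-, t, h1, h2⟩ := hb2 hψ
      exact inner_resolvent_eq_zero hT hz h2 (hf.2 ψ hψ)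
  have hRs : star R = opResolvent T ((starRingEnd ℂ) Complex.I) :=
    star_opResolvent hT hI (conj_not_mem_opSpectrum hT hI)
  have hRZ : Commute R Z := commute_starProjection (hRM _ (by simp)) (by
    rw [hRs]
    exact hRM _ (by simp))
  have hZs : star Z = Z := (isStarProjection_starProjection (U := M)).isSelfAdjoint.star_eq
  have hZZ : Z * Z = Z := (isStarProjection_starProjection (U := M)).isIdempotentElem.eq
  have hRZ' : Commute (star R) Z := by
    have := commute_star_star.2 hRZ
    rwa [hZs] at this
  have hRn : Commute (star R) R := (isStarNormal_opResolvent hT hI).star_comm_self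
  have hQZ : ∀ f, Q (Z f) = Z f := fun f => ((hM _).1 (M.starProjection_apply_mem f)).1
  have hN : IsStarNormal (R * Z) := by
    refine ⟨?_⟩
    rw [star_mul, hZs]
    have c1 : Commute Z (R * Z) := hRZ.symm.mul_right (Commute.refl Z)
    have c2 : Commute (star R) (R * Z) := hRn.mul_right hRZ'
    exact c1.mul_left c2
  -- a nonzero compression of the resolvent to the complement `M` would have an eigenvector
  by_cases h0 : R * Z = 0
  · intro f hf
    have h1 : Q f ∈ M := by
      rw [hM, hQ.apply_apply]
      refine ⟨rfl, fun ψ hψ => ?_⟩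
      rw [← hQ.inner_apply, (hb2 hψ).1]
      exact hf ψ hψ
    have h2 : R (Q f) = 0 := by
      have := DFunLike.congr_fun h0 (Q f)
      change R (Z (Q f)) = 0 at this
      rwa [hZ, Submodule.starProjection_eq_self_iff.2 h1] at this
    exact opResolvent_injective hI h2
  · exfalso
    obtain ⟨μ, v, hμ, hv, hNv⟩ := exists_eigenvector_of_isStarNormal hN h0 fun κ V hV =>
      hfin κ V fun v hv => by
        obtain ⟨w, h1, h2⟩ := hV v hv
        refine ⟨Z w, hQZ w, h1, ?_⟩
        refine le_trans ?_ h2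
        exact (Z.le_of_opNorm_le (norm_le_one_of_isStarProjection
          (isStarProjection_starProjection (U := M))) w).trans (one_mul _).le
    change R (Z v) = μ • v at hNv
    have hvM : v ∈ M := by
      have h1 : R (Z v) ∈ M := hRM _ (by simp) _ (M.starProjection_apply_mem v)
      rw [hNv] at h1
      exact (M.smul_mem_iff hμ).1 h1
    have hZv : Z v = v := Submodule.starProjection_eq_self_iff.2 hvM
    rw [hZv] at hNv
    obtain ⟨h1, h2⟩ := (isResolventAt_opResolvent hI).1 v
    have hvT : v ∈ T.domain := by
      have h3 := h1
      change R v ∈ T.domain at h3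
      rw [hNv] at h3
      exact (T.domain.smul_mem_iff hμ).1 h3
    have hTv : T ⟨v, hvT⟩ = (Complex.I - μ⁻¹) • v := by
      have h3 : T ⟨R v, h1⟩ = μ • T ⟨v, hvT⟩ := by
        rw [← T.map_smul]
        congr 1
        exact Subtype.ext hNv
      change Complex.I • R v - T ⟨R v, h1⟩ = v at h2
      rw [h3, hNv] at h2
      have h4 : μ⁻¹ • (Complex.I • μ • v - μ • T ⟨v, hvT⟩) = μ⁻¹ • v := by rw [h2]
      rw [smul_sub, smul_comm Complex.I μ, inv_smul_smul₀ hμ, inv_smul_smul₀ hμ] at h4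
      rw [sub_smul, ← h4, sub_sub_cancel]
    have him : (Complex.I - μ⁻¹).im = 0 := by
      have h3 := inner_apply_self_im hT ⟨v, hvT⟩
      change (inner ℂ v (T ⟨v, hvT⟩)).im = 0 at h3
      rw [hTv, inner_smul_right, inner_self_eq_norm_sq_to_K] at h3
      have h4 : ((Complex.I - μ⁻¹) * (((‖v‖ ^ 2 : ℝ)) : ℂ)).im = 0 := by
        rw [← h3]
        push_cast
        rfl
      rw [Complex.im_mul_ofReal, mul_eq_zero] at h4
      exact h4.resolve_right (by
        have := norm_pos_iff.2 hv
        positivity)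
    have hre : Complex.I - μ⁻¹ = ((Complex.I - μ⁻¹).re : ℂ) :=
      Complex.ext rfl (by rw [him, Complex.ofReal_im])
    set t := (Complex.I - μ⁻¹).re with ht
    -- the normalized eigenvector contradicts maximality
    set e : L2 := ((‖v‖⁻¹ : ℝ) : ℂ) • v with he
    have heM : e ∈ M := M.smul_mem _ hvM
    have hen : ‖e‖ = 1 := by
      rw [he, norm_smul, Complex.norm_real, Real.norm_of_nonneg (by positivity),
        inv_mul_cancel₀ (norm_ne_zero_iff.2 hv)]
    have heE : e ∈ E := by
      refine ⟨((hM e).1 heM).1, t, T.domain.smul_mem _ hvT, ?_⟩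
      have h3 : T ⟨e, T.domain.smul_mem _ hvT⟩ = ((‖v‖⁻¹ : ℝ) : ℂ) • T ⟨v, hvT⟩ :=
        T.map_smul _ ⟨v, hvT⟩
      rw [h3, hTv, hre, he, smul_comm]
    have heb : ∀ ψ ∈ b, inner ℂ ψ e = 0 := ((hM e).1 heM).2
    have hins : Orthonormal ℂ (Subtype.val : ↥(insert e b : Set L2) → L2) := by
      classical
      rw [orthonormal_subtype_iff_ite] at hb1 ⊢
      intro x hx y hy
      rcases hx with rfl | hx <;> rcases hy with rfl | hy
      · rw [if_pos rfl, inner_self_eq_norm_sq_to_K, hen]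
        simp
      · have h3 : inner ℂ e y = 0 := inner_eq_zero_symm.1 (heb y hy)
        rw [h3, if_neg]
        rintro rfl
        rw [inner_self_eq_zero] at h3
        rw [h3, norm_zero] at hen
        exact zero_ne_one hen
      · have h3 := heb x hx
        rw [h3, if_neg]
        rintro rfl
        rw [inner_self_eq_zero] at h3
        rw [h3, norm_zero] at hen
        exact zero_ne_one hen
      · exact hb1 x hx y hy
    have h5 := hmax ⟨hins, Set.insert_subset heE hb2⟩ (Set.subset_insert e b)
    have h6 := heb e (h5 (Set.mem_insert e b))
    rw [inner_self_eq_zero] at h6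
    rw [h6, norm_zero] at hen
    exact zero_ne_one hen

/-! ### Localized bases -/

/-- If `f = (X - c + i)⁻¹ h`, then `h = (X - c + i) f` as a function. -/
theorem coe_of_eq_posRes {c : ℝ} {f h : L2} (hf : f = posRes c h) :
    h =ᵐ[volume] fun x => ((x 0 - c : ℝ) + Complex.I) * f x := by
  filter_upwards [bmul_coe (bddMeas_resFun (measurable_posXSub c)) h] with x h1
  rw [hf, posRes, h1, resFun, mul_inv_cancel_left₀]
  have h2 := inv_ne_zero (resFun_ne_zero (fun x : Plane => x 0 - c) x)
  rwa [resFun, inv_inv] at h2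

/-- A line localized projection `Q` has a basis of localized functions, the eigenfunctions of
`Q Y Q`, where `Y` is the other position operator. -/
theorem exists_localized_basis {C s : ℝ} (hC : 0 < C) (hs : 0 < s) :
    ∃ D, 0 < D ∧ ∀ (Q U : L2 →L[ℂ] L2) (c : ℝ), IsStarProjection Q → HasExpKernel Q C s →
      HasExpKernel U C s → Q = posRes c * U →
      ∃ b : Set L2, Orthonormal ℂ (Subtype.val : b → L2) ∧
        (∀ ψ ∈ b, Q ψ = ψ ∧ ∃ a : Plane, ∫⁻ x, ENNReal.ofReal
          (Real.exp (2 * (s / 2 / 2) * weight a x) * ‖ψ x‖ ^ 2) ≤ ENNReal.ofReal D) ∧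
        ∀ f, (∀ ψ ∈ b, inner ℂ ψ f = 0) → Q f = 0 := by
  have hC' : 0 ≤ C * (2 / s) := by positivity
  obtain ⟨D, hD, key⟩ := exists_lintegral_exp_weight_le (C := C + C * (2 / s)) (γ := s / 2)
    (by positivity) (by positivity)
  refine ⟨D, hD, fun Q U c hQ hQk hUk hQU => ?_⟩
  obtain ⟨K, hKk, hK'⟩ := hQk.exists_commutator hC.le hs 1
  have hK : HasCommutator (mulOp fun x => x 1) Q K := hK' _ fun _ _ => rfl
  have hY : IsSelfAdjoint (mulOp fun x => x 1) := isSelfAdjoint_mulOp (by fun_prop)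
  have hT := isSelfAdjoint_compress hY hQ hK
  set T := compress Q (mulOp fun x => x 1) with hTdef
  have hQx : ∀ ψ, Q ψ = ψ → U ψ =ᵐ[volume] fun x => ((x 0 - c : ℝ) + Complex.I) * ψ x :=
    fun ψ hψ => coe_of_eq_posRes (hψ.symm.trans (DFunLike.congr_fun hQU ψ))
  -- on the range of `Q`, the operator `Y` is the sum of `Q Y Q` and the commutator
  have hYx : ∀ (ψ : L2) (h : ψ ∈ (mulOp fun x => x 1).domain), Q ψ = ψ →
      (Q (mulOp _ ⟨ψ, h⟩) + K ψ) =ᵐ[volume] fun x => ((x 1 : ℝ) : ℂ) * ψ x := by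
    intro ψ h hψ
    obtain ⟨h1, h2⟩ := hK ⟨ψ, h⟩
    have h3 : mulOp (fun x => x 1) ⟨Q ψ, h1⟩ = mulOp (fun x => x 1) ⟨ψ, h⟩ := by
      congr 1
      exact Subtype.ext hψ
    rw [← h2, h3]
    exact mulOp_coe _
  obtain ⟨b, hb1, hb2, hb3⟩ := exists_eigenbasis hQ hT
    (fun z hz => commute_opResolvent_compress hQ hz) (by
    intro κ V hV
    refine finiteDimensional_of_concentrated hC.le hs hQk (c := !₂[c, 0])
      (M := 1 + |κ| + ‖K‖ + ‖U‖) (by positivity) fun v hv => ?_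
    obtain ⟨w, h1, h2, h3⟩ := hV v hv
    obtain ⟨h4, h5, h6⟩ := opResolvent_compress_spec hQ (I_not_mem_opSpectrum hT) w
    simp only [h1] at h4 h5 h6
    simp only [← hTdef, h2] at h4 h5 h6
    refine ⟨h4, fun i => ?_⟩
    have hvn := norm_nonneg v
    fin_cases i
    · refine ⟨U v - Complex.I • v, ?_, ?_⟩
      · filter_upwards [hQx v h4, Lp.coeFn_sub (U v) (Complex.I • v),
          Lp.coeFn_smul Complex.I v] with x e1 e2 e3
        rw [e2, Pi.sub_apply, e1, e3, Pi.smul_apply, smul_eq_mul, ← sub_mul, add_sub_cancel_right]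
        simp
      · refine (norm_sub_le _ _).trans ?_
        rw [norm_smul, Complex.norm_I]
        nlinarith [U.le_opNorm v, norm_nonneg K, abs_nonneg κ]
    · refine ⟨Complex.I • v - w + K v, ?_, ?_⟩
      · rw [show Complex.I • v - w = Q (mulOp (fun x => x 1) ⟨v, h5⟩) by
          rw [← h6]
          abel]
        filter_upwards [hYx v h5 h4] with x e1
        rw [e1]
        simp
      · refine (norm_add_le _ _).trans ?_
        have e1 : ‖Complex.I • v - w‖ ≤ ‖v‖ + |κ| * ‖v‖ := by
          refine (norm_sub_le _ _).trans ?_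
          rw [norm_smul, Complex.norm_I, one_mul]
          exact add_le_add le_rfl (h3.trans (mul_le_mul_of_nonneg_right (le_abs_self κ) hvn))
        nlinarith [K.le_opNorm v, norm_nonneg U])
  refine ⟨b, hb1, fun ψ hψ => ⟨(hb2 ψ hψ).1, ?_⟩, hb3⟩
  obtain ⟨hQψ, t, h1, h2⟩ := hb2 ψ hψ
  refine ⟨!₂[c, t], key U K ψ _ (hUk.mono hC.le (by linarith) (by linarith))
    (hKk.mono hC' (by linarith) le_rfl) (hb1.1 ⟨ψ, hψ⟩) ?_ ?_⟩
  · filter_upwards [hQx ψ hQψ] with x e1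
    rw [e1]
    simp
  · have h3 : ψ ∈ (mulOp fun x => x 1).domain := by
      have := mem_compress_domain.1 h1
      rwa [hQψ] at this
    have h4 : Q (mulOp (fun x => x 1) ⟨ψ, h3⟩) = (t : ℂ) • ψ := by
      rw [← h2]
      change _ = Q (mulOp (fun x => x 1) ⟨Q ψ, mem_compress_domain.1 h1⟩)
      congr 2
      exact Subtype.ext hQψ.symm
    have h5 := hYx ψ h3 hQψ
    rw [h4] at h5
    filter_upwards [h5, Lp.coeFn_add ((t : ℂ) • ψ) (K ψ), Lp.coeFn_smul (t : ℂ) ψ] with x e1 e2 e3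
    rw [e2, Pi.add_apply, e3, Pi.smul_apply, smul_eq_mul, ← eq_sub_iff_add_eq'] at e1
    rw [e1]
    simp [sub_mul]

theorem rieszProj_contour_eq_sum {J : Type*} {σ : J → Set ℝ} (κ : SeparatingCircles σ)
    (T : L2 →ₗ.[ℂ] L2) (F : Finset ℤ) :
    rieszProj T (κ.contour F) = ∑ n ∈ F, rieszProj T (κ.contour {n}) := by
  simp only [rieszProj, SeparatingCircles.contour, circleContour_integral, Finset.sum_singleton,
    Finset.smul_sum]

/-- The Riesz projections of all circles add up to the identity in the strong sense: a vector that is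
annihilated by all of them vanishes, since `(i - T)⁻¹` is small on the part of the spectrum outside
of a large ball. -/
theorem eq_zero_of_rieszProj_apply_eq_zero {J : Type*} {σ : J → Set ℝ} (κ : SeparatingCircles σ)
    {T : L2 →ₗ.[ℂ] L2} (hT : IsSelfAdjoint T)
    (hS : opSpectrum T = ⋃ j, (fun x : ℝ => (x : ℂ)) '' σ j) {f : L2}
    (hf : ∀ n ∈ κ.idx, rieszProj T (κ.contour {n}) f = 0) : f = 0 := by
  refine opResolvent_injective (I_not_mem_opSpectrum hT) ?_
  have key : ∀ R : ℝ, 0 < R → ‖opResolvent T Complex.I f‖ ≤ 1 / R * ‖f‖ := by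
    intro R hR
    obtain ⟨F, hF, hFR⟩ := κ.cover_ball R
    have h1 := norm_opResolvent_sub_le hT (κ.admissible hT hS hF) (c := 1 / R) (by positivity)
      fun x hx => by
        rw [hS] at hx
        obtain ⟨j, y, hy, rfl⟩ := Set.mem_iUnion.1 hx
        by_cases h : ∃ n ∈ F, |y - κ.c n| < κ.r n
        · exact Or.inl (κ.windingNumber_eq_one hF hy h)
        · refine Or.inr ⟨κ.windingNumber_eq_zero hF hy (by simpa using h), ?_⟩
          have h2 : R < |y| := by
            by_contra! h3
            exact h (hFR j y hy h3)
          rw [norm_inv, one_div]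
          refine inv_anti₀ hR ?_
          have h3 := Complex.abs_re_le_norm (Complex.I - y)
          rw [Complex.sub_re, Complex.I_re, Complex.ofReal_re, zero_sub, abs_neg] at h3
          exact h2.le.trans h3
    have h2 : rieszProj T (κ.contour F) f = 0 := by
      rw [rieszProj_contour_eq_sum, sum_apply]
      exact Finset.sum_eq_zero fun n hn => hf n (hF hn)
    have h3 := (opResolvent T Complex.I - opResolvent T Complex.I * rieszProj T (κ.contour F)
      ).le_of_opNorm_le h1 f
    have h4 : (opResolvent T Complex.I - opResolvent T Complex.I * rieszProj T (κ.contour F)) f =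
        opResolvent T Complex.I f := by
      change opResolvent T Complex.I f - opResolvent T Complex.I (rieszProj T (κ.contour F) f) = _
      rw [h2, map_zero, sub_zero]
    rwa [h4] at h3
  by_contra h0
  have h1 : 0 < ‖opResolvent T Complex.I f‖ := norm_pos_iff.2 h0
  have h2 := key ((‖f‖ + 1) / ‖opResolvent T Complex.I f‖) (by positivity)
  rw [one_div, inv_div, div_mul_eq_mul_div, le_div_iff₀ (by positivity)] at h2
  nlinarith [norm_nonneg f]

/-- The localized bases of the Riesz projections of single circles are combined to a basis of the
range of `P`. The circles can be treated separately as each point of the spectrum lies in only one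
of them. -/
theorem UniformSpectralGaps.hasExpLocWannierBasis {J : Type*} {σ : J → Set ℝ} {d D : ℝ}
    {P V : L2 →L[ℂ] L2} {Xhat : L2 →ₗ.[ℂ] L2} (hσ : UniformSpectralGaps (compress P Xhat) σ d D)
    (κ : SeparatingCircles σ) (hT : IsSelfAdjoint (compress P Xhat))
    (hP : IsStarProjection P) {C₀ γ₁ : ℝ} (hC₀ : 0 < C₀)
    (hγ₁ : 0 < γ₁) (hk : HasExpKernel P C₀ γ₁) (hX : IsSelfAdjoint Xhat)
    (hdom : Xhat.domain = posX.domain)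
    (hV : ∀ f (h : f ∈ posX.domain) (h' : f ∈ Xhat.domain), Xhat ⟨f, h'⟩ = posX ⟨f, h⟩ + V f)
    {γ₀ m : ℝ} (hγ₀ : 0 < γ₀) (hm : 0 ≤ m) (tV : Tilts V γ₀ m) : HasExpLocWannierBasis P := by
  have hL0 := κ.L_nonneg
  have hδ := κ.δ_pos
  have hpi := Real.pi_pos
  set T := compress P Xhat with hTdef
  obtain ⟨C, s, s₀, M', hC, hs, hs₀, hM', key⟩ := exists_uniform_localization hP hC₀ hγ₁ hk hX hdom
    hV hγ₀ hm tV (M := 1 / κ.δ) (L := κ.L) (ℓ := (1 : ℕ) * (2 * Real.pi * κ.L))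
    (by positivity) hL0 (by positivity)
  obtain ⟨B, hB, hbasis⟩ := exists_localized_basis hC hs
  have hF : ∀ n ∈ κ.idx, (↑({n} : Finset ℤ) : Set ℤ) ⊆ κ.idx := fun n hn => by simpa using hn
  have hadm : ∀ n ∈ κ.idx, Admissible T (κ.contour {n}) := fun n hn =>
    κ.admissible hT hσ.spectrum_eq (hF n hn)
  have hcomm : ∀ z ∉ opSpectrum T, Commute P (opResolvent T z) :=
    fun z hz => commute_opResolvent_compress hP hz
  have hw : ∀ n ∈ κ.idx, ∀ j, ∀ x ∈ σ j, ((κ.contour {n}).windingNumber x = 0 ∧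
      ¬ |x - κ.c n| < κ.r n) ∨ ((κ.contour {n}).windingNumber x = 1 ∧ |x - κ.c n| < κ.r n) := by
    intro n hn j x hx
    by_cases h : |x - κ.c n| < κ.r n
    · exact Or.inr ⟨κ.windingNumber_eq_one (hF n hn) hx ⟨n, Finset.mem_singleton_self n, h⟩, h⟩
    · exact Or.inl ⟨κ.windingNumber_eq_zero (hF n hn) hx (by simpa using h), h⟩
  let Q : ℤ → L2 →L[ℂ] L2 := fun n => rieszProj T (κ.contour {n}) * P
  have hQ : ∀ n ∈ κ.idx, IsStarProjection (Q n) := fun n hn =>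
    isStarProjection_rieszProj_mul hT hP hcomm (hadm n hn) fun x hx => by
      rw [hσ.spectrum_eq] at hx
      obtain ⟨j, y, hy, rfl⟩ := Set.mem_iUnion.1 hx
      exact (hw n hn j y hy).imp And.left And.left
  have hEP : ∀ n ∈ κ.idx, Commute P (rieszProj T (κ.contour {n})) := fun n hn =>
    commute_rieszProj (hadm n hn) hcomm
  have hPQ : ∀ n ∈ κ.idx, ∀ f, P (Q n f) = Q n f := fun n hn f => by
    have := DFunLike.congr_fun (hEP n hn).eq (P f)
    change P (rieszProj T (κ.contour {n}) (P f)) = rieszProj T (κ.contour {n}) (P (P f)) at this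
    rwa [hP.apply_apply] at this
  have hQQ : ∀ n ∈ κ.idx, ∀ k ∈ κ.idx, n ≠ k → Q n * Q k = 0 := fun n hn k hk hnk => by
    have h1 : rieszProj T (κ.contour {n}) * rieszProj T (κ.contour {k}) = 0 :=
      rieszProj_mul_eq_zero hT (hadm n hn) (hadm k hk) fun x hx => by
        rw [hσ.spectrum_eq] at hx
        obtain ⟨j, y, hy, rfl⟩ := Set.mem_iUnion.1 hx
        rcases hw n hn j y hy with h | h
        · exact Or.inl h.1
        · rcases hw k hk j y hy with h' | h'
          · exact Or.inr h'.1
          · exact absurd (κ.unique n hn k hk j y hy h.2 h'.2) hnk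
    calc Q n * Q k = rieszProj T (κ.contour {n}) * (P * rieszProj T (κ.contour {k})) * P := by
          simp only [Q, mul_assoc]
      _ = 0 := by rw [(hEP k hk).eq, ← mul_assoc, h1, zero_mul, zero_mul]
  have hloc : ∀ n : κ.idx, ∃ b : Set L2, Orthonormal ℂ (Subtype.val : b → L2) ∧
        (∀ ψ ∈ b, Q n ψ = ψ ∧ ∃ a : Plane, ∫⁻ x, ENNReal.ofReal
          (Real.exp (2 * (s / 2 / 2) * weight a x) * ‖ψ x‖ ^ 2) ≤ ENNReal.ofReal B) ∧
        ∀ f, (∀ ψ ∈ b, inner ℂ ψ f = 0) → Q n f = 0 := by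
    rintro ⟨n, hn⟩
    obtain ⟨-, k1, U, k2, k3⟩ := key (κ.c n) (κ.contour {n}) (fun z hz => by
      obtain ⟨h1, h2⟩ := κ.resolvent hT hσ.spectrum_eq (hF n hn) hz
      refine ⟨h1, h2, ?_⟩
      obtain ⟨k, hk, h3⟩ := mem_circleContour_support _ κ.c κ.r hz
      rw [Finset.mem_singleton.1 hk, abs_of_pos (κ.r_pos n hn)] at h3
      exact h3.le.trans (κ.r_le n hn)) (κ.length_le (hF n hn) (by simp))
    exact hbasis _ U (κ.c n) (hQ n hn) k1 k2 k3
  choose b hb1 hb2 hb3 using hloc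
  let ι : Type := {ψ : L2 // ∃ n, ψ ∈ b n}
  have hon : Orthonormal ℂ (Subtype.val : ι → L2) := by
    refine ⟨fun ⟨ψ, n, hψ⟩ => (hb1 n).1 ⟨ψ, hψ⟩, ?_⟩
    rintro ⟨ψ, n, hψ⟩ ⟨φ, k, hφ⟩ hne
    change inner ℂ ψ φ = 0
    by_cases hnk : n = k
    · subst hnk
      exact (hb1 n).2 (i := ⟨ψ, hψ⟩) (j := ⟨φ, hφ⟩) fun h => hne (Subtype.ext (Subtype.mk.inj h))
    · rw [← (hb2 n ψ hψ).1, ← (hb2 k φ hφ).1, (hQ n n.2).inner_apply]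
      have := DFunLike.congr_fun (hQQ n n.2 k k.2 fun h => hnk (Subtype.ext h)) φ
      change Q n (Q k φ) = 0 at this
      rw [this, inner_zero_right]
  choose c hc using fun i : ι => (hb2 i.2.choose i i.2.choose_spec).2
  refine ⟨ι, hon.countable_of_separableSpace, Subtype.val, c, B, s / 2 / 2, hB, by positivity, hon,
    ?_, hc⟩
  set S := Submodule.span ℂ (Set.range (Subtype.val : ι → L2)) with hS
  have hmem : ∀ f, f ∈ P.toLinearMap.range ↔ P f = f := fun f => mem_range_iff hP
  refine le_antisymm ?_ ?_
  · refine Submodule.topologicalClosure_minimal _ ?_ ?_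
    · rw [hS, Submodule.span_le]
      rintro _ ⟨⟨ψ, n, hψ⟩, rfl⟩
      refine (hmem ψ).2 ?_
      rw [← (hb2 n ψ hψ).1, hPQ n n.2]
    · have : (P.toLinearMap.range : Set L2) = {f | P f = f} := Set.ext hmem
      rw [this]
      exact isClosed_eq P.continuous continuous_id
  · intro f hf
    rw [← Submodule.orthogonal_orthogonal_eq_closure, Submodule.mem_orthogonal]
    intro g hg
    have hQg : ∀ n ∈ κ.idx, Q n g = 0 := fun n hn => hb3 ⟨n, hn⟩ g fun ψ hψ =>
      (Submodule.mem_orthogonal _ _).1 hg ψ (Submodule.subset_span ⟨⟨ψ, _, hψ⟩, rfl⟩)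
    have hPg : P g = 0 := eq_zero_of_rieszProj_apply_eq_zero κ hT hσ.spectrum_eq hQg
    rw [← (hmem f).1 hf, ← hP.inner_apply, hPg, inner_zero_left]

end GWF

end

theorem lemmaA6 {J : Type*} [Countable J]
    (P : L2 →L[ℂ] L2) (hP : IsExpLocProjector P)
    (Xhat : L2 →ₗ.[ℂ] L2) (hdom : posX.domain ≤ Xhat.domain)
    (hsymm : Xhat.IsFormalAdjoint Xhat)
    (C : ℝ) (hC : NormLE (Xhat - posX) C) :
    (Xhat.domain = posX.domain ∧ IsSelfAdjoint Xhat ∧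
      (compress P Xhat).domain =
        (posX.domain ⊓ P.toLinearMap.range) ⊔ (P.toLinearMap.range)ᗮ ∧
      IsSelfAdjoint (compress P Xhat)) ∧
    ∀ (C' γ₀ : ℝ), 0 < γ₀ →
      (∀ γ ∈ Set.Icc 0 γ₀, ∀ a : Plane, NormLE (tilt Xhat γ a - Xhat) (C' * γ)) →
      ∀ (σ : J → Set ℝ) (d D : ℝ), UniformSpectralGaps (compress P Xhat) σ d D →
        (∃ Q : J → L2 →L[ℂ] L2, IsBandProjectors P (compress P Xhat) σ d D Q) ∧
        (∀ Q : J → L2 →L[ℂ] L2, IsBandProjectors P (compress P Xhat) σ d D Q →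
          IsUniformlyLocalized σ Q) ∧
        HasExpLocWannierBasis P := by
  obtain ⟨hPs, C₀, γ₁, hC₀, hγ₁, hk⟩ := hP
  have hX : IsSelfAdjoint posX := isSelfAdjoint_mulOp (by fun_prop)
  obtain ⟨V, hVs, hV⟩ := exists_bounded_perturbation hX hdom hsymm hC
  have hdom' : Xhat.domain = posX.domain := domain_eq_of_bounded_perturbation hX hdom hsymm hVs hV
  have hXh : IsSelfAdjoint Xhat := isSelfAdjoint_of_bounded_perturbation hX hdom' hsymm hVs hV
  obtain ⟨K, -, hK'⟩ := hk.exists_commutator hC₀.le hγ₁ 0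
  have hK : HasCommutator posX P K := hK' _ fun _ _ => rfl
  have hT : IsSelfAdjoint (compress P Xhat) :=
    isSelfAdjoint_compress hXh hPs (hK.of_perturbation hdom' hV)
  refine ⟨⟨hdom', hXh, ?_, hT⟩, fun C' γ₀ hγ₀ H σ d D hσ => ?_⟩
  · rw [← hdom']
    exact compress_domain hPs
  · obtain ⟨κ⟩ := exists_separatingCircles hσ.pos hσ.gap hσ.diam
    have tV := tilts_of_perturbation hdom' hV H
    exact ⟨exists_isBandProjectors hT hσ κ,
      fun Q hQ => hσ.isUniformlyLocalized κ hT hPs hC₀ hγ₁ hk hXh hdom' hV hγ₀ (abs_nonneg _) tV hQ,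
      hσ.hasExpLocWannierBasis κ hT hPs hC₀ hγ₁ hk hXh hdom' hV hγ₀ (abs_nonneg _) tV⟩
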